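/- Let $l\in\{1,2\}$, $\xi\in\{1,2\}$, $\kappa\in\mathbb R$, and let $T_l=-\frac{d^2}{dr^2}+\frac{l(l+1)}{r^2}$ and $D_l w(r)=r^{l+1}\bigl(\frac1r\frac{d}{dr}\bigr)^l\frac{w(r)}{r}$ on $r>0$. Boundary values $u^{(j)}(0)$ are limits of $u^{(j)}(r)$ as $r\to0+$. The boundary conditions $\mathrm{BC}_{l\xi\kappa}$ are that $u(0),\dots,u^{(5)}(0)$ exist and - $\xi=1$: $u(0)=u'(0)=0$, $\kappa u''(0)=u'''(0)$; - $\xi=2$, $l=1$: $u(0)=u^{(4)}(0)=0$, $\kappa u''(0)=u'''(0)$; - $\xi=2$, $l=2$: $u'(0)=u'''(0)=u^{(4)}(0)=0$, $\kappa^5u(0)=u^{(5)}(0)$. Let $T^3_{l\xi\kappa}$ be the operator in $L^2(0,\infty)$ acting as $T_l^3$ on all $u\in L^2(0,\infty)$ with locally absolutely continuous fifth derivative, $u^{(6)}\in L^2$, $T_l^3u\in L^2$, satisfying $\mathrm{BC}_{l\xi\kappa}$. Let $z\in\mathbb C$ with $0<\arg z<\pi/3$. For $k=0,1,2$ (indices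 modulo 3) put $g_k=D_l\exp(ie^{i\pi k/3}zr)$, $d_k=D_l\exp(-ie^{i\pi k/3}zr)$ and $h_k=d_k+\alpha_kg_k+\beta_kg_{k+1}+\gamma_kg_{k+2}$, where, with $c=\frac89\kappa$ if $l=1$, $c=\frac58\kappa$ if $l=2,\xi=1$, and $c=-\frac78\kappa^5$ if $l=2,\xi=2$, the coefficients are as follows. - $\xi=1,l=1$, $p=3z+2e^{i\pi/6}c$: $p\alpha_0=2e^{5i\pi/6}c-3z$, $p\beta_0=2e^{7i\pi/6}c$, $p\gamma_0=2e^{-i\pi/6}c$; $p\alpha_1=-3z$, $p\beta_1=2e^{5i\pi/6}c$, $p\gamma_1=-2ic$; $p\alpha_2=-(2ic+3z)$, $p\beta_2=2ic$, $p\gamma_2=2e^{7i\pi/6}c$. - $\xi=1,l=2$, $p=2z+3e^{i\pi/6}c$: $p\alpha_0=3e^{7i\pi/6}c-2e^{i\pi/3}z$, $p\beta_0=2e^{i\pi/3}z$, $p\gamma_0=-2z$; $p\alpha_1=3e^{7i\pi/6}c$, $p\beta_1=2e^{2i\pi/3}z$, $p\gamma_1=-2e^{i\pi/3}z$; $p\alpha_2=3e^{7i\pi/6}c+2e^{2i\pi/3}z$,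 $p\beta_2=-2z$, $p\gamma_2=-2e^{2i\pi/3}z$. - $\xi=2,l=1$, $p=z+2e^{i\pi/6}c$: $p\alpha_0=z+2e^{-i\pi/6}c$, $p\beta_0=-2(e^{i\pi/3}z+e^{i\pi/6}c)$, $p\gamma_0=2(e^{2i\pi/3}z+e^{5i\pi/6}c)$; $p\alpha_1=-3z$, $p\beta_1=2(e^{i\pi/3}z+e^{5i\pi/6}c)$, $p\gamma_1=-2(e^{2i\pi/3}z+ic)$; $p\alpha_2=z+2ic$, $p\beta_2=-2(e^{i\pi/3}z+ic)$, $p\gamma_2=2(e^{2i\pi/3}z-e^{i\pi/6}c)$. - $\xi=2,l=2$, $p=z^5+2e^{5i\pi/6}c$: $p\alpha_0=2e^{i\pi/6}c-z^5$, $p\beta_0=2(z^5-e^{i\pi/6}c)$, $p\gamma_0=-2(z^5+e^{5i\pi/6}c)$; $p\alpha_1=3z^5$, $p\beta_1=-2(z^5+ic)$, $p\gamma_1=2(e^{i\pi/6}c-z^5)$; $p\alpha_2=-(z^5+2ic)$, $p\beta_2=-2(z^5+e^{5i\pi/6}c)$, $p\gamma_2=2(z^5+ic)$. Let $W_0=-2iz^3,\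 W_1=2iz^3,\ W_2=-2iz^3$ for $l=1$, and $W_0=-2iz^5,\ W_1=2ie^{2i\pi/3}z^5,\ W_2=2ie^{i\pi/3}z^5$ for $l=2$. Let $\theta$ be the Heaviside function with $\theta(0)=\frac12$, and $$R(r,s;z)=\sum_{k=0}^2\frac{e^{2\pi ik/3}}{3z^4W_k}\bigl(h_k(r)g_k(s)\theta(s-r)+h_k(s)g_k(r)\theta(r-s)\bigr).$$ Assume $p(z)\neq0$. Then: 1. $(T_l^3-z^6)g_k=(T_l^3-z^6)h_k=0$ on $(0,\infty)$, and each $g_k$ decays exponentially at infinity. 2. $d_k+\alpha g_k+\beta g_{k+1}+\gamma g_{k+2}$ (with $\alpha,\beta,\gamma\in\mathbb C$) satisfies $\mathrm{BC}_{l\xi\kappa}$ if and only if $(\alpha,\beta,\gamma)=(\alpha_k,\beta_k,\gamma_k)$; in particular $h_k$ does. 3. $d_k'g_k-d_kg_k'=W_k$ for all $r>0$. 4. $R(r,s;z)=R(s,r;z)$ for $r,s>0$; for each $s>0$, $R(\cdot,s;z)$ satisfies $\mathrm{BC}_{l\xi\kappa}$; and there is $\varepsilon>0$ such that for every $s>0$,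 $|R(r,s;z)|\le C_se^{-\varepsilon r}$ for all $r>0$. 5. $(T_l^3-z^6)R(\cdot,s;z)=\delta(\cdot-s)$ in the sense of distributions on $(0,\infty)$, for each $s>0$. 6. $R$ is the resolvent kernel of $T^3_{l\xi\kappa}$ at $z^6$: the operator $T^3_{l\xi\kappa}-z^6$ maps its domain bijectively onto $L^2(0,\infty)$, the inverse is bounded, and $\bigl((T^3_{l\xi\kappa}-z^6)^{-1}f\bigr)(r)=\int_0^\infty R(r,s;z)f(s)\,ds$ (an absolutely convergent integral for every $r>0$, the equality holding for almost every $r>0$) for all $f\in L^2(0,\infty)$. -/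

import Mathlib

open Real Set Filter Topology MeasureTheory
open scoped ContDiff

noncomputable section

namespace RadialCube

/-! ### Differential operations on functions of `r > 0` -/

/-- The radial operation `T_l = -d²/dr² + l(l+1)/r²`. -/
def radT (l : ℕ) (u : ℝ → ℂ) : ℝ → ℂ :=
  fun r => -iteratedDeriv 2 u r + ((l : ℂ) * (l + 1) / (r : ℂ) ^ 2) * u r

/-- The sixth-order operation `T_l³`. -/
def radT3 (l : ℕ) (u : ℝ → ℂ) : ℝ → ℂ := radT l (radT l (radT l u))

/-- The operation `(1/r) d/dr`. -/
def invD (f : ℝ → ℂ) : ℝ → ℂ := fun r => (1 / (r : ℂ)) * deriv f r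

/-- The operation `D_l w = r^{l+1} ((1/r) d/dr)^l (w/r)`. -/
def radD (l : ℕ) (w : ℝ → ℂ) : ℝ → ℂ :=
  fun r => (r : ℂ) ^ (l + 1) * (invD^[l] (fun x : ℝ => w x / (x : ℂ))) r

/-! ### Boundary conditions at the origin -/

/-- `b 0, …, b 5` are the boundary values `u(0), u'(0), …, u⁽⁵⁾(0)`, taken as limits from the
right. -/
def HasBoundaryValues (u : ℝ → ℂ) (b : ℕ → ℂ) : Prop :=
  ∀ j < 6, Tendsto (iteratedDeriv j u) (𝓝[>] (0 : ℝ)) (𝓝 (b j))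

/-- The boundary conditions of type `ξ = 1` (for `l = 1, 2`) and of type `ξ = 2` (separately for
`l = 1` and `l = 2`), as relations between the boundary values. -/
def BoundaryRel (l ξ : ℕ) (κ : ℝ) (b : ℕ → ℂ) : Prop :=
  if ξ = 1 then b 0 = 0 ∧ b 1 = 0 ∧ (κ : ℂ) * b 2 = b 3
  else if l = 1 then b 0 = 0 ∧ b 4 = 0 ∧ (κ : ℂ) * b 2 = b 3
  else b 1 = 0 ∧ b 3 = 0 ∧ b 4 = 0 ∧ (κ : ℂ) ^ 5 * b 0 = b 5

/-- The function `u` has boundary values at zero and they obey the boundary conditions. -/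
def SatisfiesBC (l ξ : ℕ) (κ : ℝ) (u : ℝ → ℂ) : Prop :=
  ∃ b : ℕ → ℂ, HasBoundaryValues u b ∧ BoundaryRel l ξ κ b

/-! ### The operator `T_{lξκ}³` in `L²(0, ∞)` -/

/-- Lebesgue measure on the half-line `(0, ∞)`. -/
abbrev halfLine : Measure ℝ := volume.restrict (Ioi (0 : ℝ))

/-- The Hilbert space `L²(0, ∞)`. -/
abbrev HalfL2 : Type := Lp ℂ 2 halfLine

/-- Membership in the domain of `T_{lξκ}³`: `u` is square integrable, its fifth derivative is
absolutely continuous with square integrable derivative `u⁽⁶⁾`, the boundary conditions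
hold, and `T_l³ u` is square integrable. -/
structure InDomain (l ξ : ℕ) (κ : ℝ) (u : ℝ → ℂ) : Prop where
  contDiffOn : ContDiffOn ℝ 5 u (Ioi 0)
  memLp : MemLp u 2 halfLine
  sixth : ∃ w : ℝ → ℂ, MemLp w 2 halfLine ∧ ∀ a b : ℝ, 0 < a → 0 < b →
    iteratedDeriv 5 u b - iteratedDeriv 5 u a = ∫ x in a..b, w x
  bc : SatisfiesBC l ξ κ u
  memLp_radT3 : MemLp (radT3 l u) 2 halfLine

theorem contDiffAt_iteratedDeriv {n m : ℕ} {u : ℝ → ℂ} {r : ℝ}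
    (h : ContDiffAt ℝ (n + m : ℕ) u r) : ContDiffAt ℝ n (iteratedDeriv m u) r := by
  have h2 : ContDiffAt ℝ n (iteratedFDeriv ℝ m u) r :=
    h.iteratedFDeriv_right (m := (n : WithTop ℕ∞)) (i := m) (by norm_cast)
  rw [iteratedDeriv_eq_equiv_comp]
  exact ((ContinuousMultilinearMap.piFieldEquiv ℝ (Fin m) ℂ).symm.contDiff.contDiffAt).comp r h2

/-- Auxiliary regularity at a point: `u` is of class `C^n` near `r` and its `n`-th derivative is
differentiable at `r`. -/
def RegAt (n : ℕ) (u : ℝ → ℂ) (r : ℝ) : Prop :=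
  ContDiffAt ℝ n u r ∧ DifferentiableAt ℝ (iteratedDeriv n u) r

theorem contDiffAt_potential_mul {n l : ℕ} {u : ℝ → ℂ} {r : ℝ} (hr : 0 < r)
    (h : ContDiffAt ℝ n u r) :
    ContDiffAt ℝ n (fun x : ℝ => ((l : ℂ) * (l + 1) / (x : ℂ) ^ 2) * u x) r := by
  have hx : ContDiffAt ℝ n (fun x : ℝ => (x : ℂ)) r := Complex.ofRealCLM.contDiff.contDiffAt
  have hne : ((r : ℂ)) ^ 2 ≠ 0 := pow_ne_zero _ (by exact_mod_cast hr.ne')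
  have hinv : ContDiffAt ℝ n (fun x : ℝ => ((x : ℂ) ^ 2)⁻¹) r := (hx.pow 2).inv hne
  simp only [div_eq_mul_inv]
  exact (contDiffAt_const.mul hinv).mul h

theorem RegAt.radT {n l : ℕ} {u : ℝ → ℂ} {r : ℝ} (hr : 0 < r) (h : RegAt (n + 2) u r) :
    RegAt n (radT l u) r := by
  have h1 := h.1
  have hV : ContDiffAt ℝ (n + 2 : ℕ) (fun x : ℝ => ((l : ℂ) * (l + 1) / (x : ℂ) ^ 2) * u x) r :=
    contDiffAt_potential_mul hr h1
  have hle : ((n : ℕ) : WithTop ℕ∞) ≤ ((n + 2 : ℕ) : WithTop ℕ∞) := by norm_cast; omega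
  refine ⟨(contDiffAt_iteratedDeriv h1).neg.add (hV.of_le hle), ?_⟩
  have hne : ∀ m : ℕ, ((m : ℕ) : WithTop ℕ∞) ≠ ∞ := fun m => by simp
  have hev : iteratedDeriv n (RadialCube.radT l u) =ᶠ[𝓝 r] fun x => -iteratedDeriv (n + 2) u x +
      iteratedDeriv n (fun x : ℝ => ((l : ℂ) * (l + 1) / (x : ℂ) ^ 2) * u x) x := by
    have e1 := h1.eventually (hne (n + 2))
    have e2 := hV.eventually (hne (n + 2))
    filter_upwards [e1, e2] with x hx1 hx2
    have hA : ContDiffAt ℝ n (-iteratedDeriv 2 u) x := (contDiffAt_iteratedDeriv (m := 2) hx1).neg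
    have := iteratedDeriv_add hA (hx2.of_le hle)
    have hcomp : iteratedDeriv n (iteratedDeriv 2 u) = iteratedDeriv (n + 2) u := by
      simp only [iteratedDeriv_eq_iterate, Function.iterate_add_apply]
    rw [iteratedDeriv_neg, hcomp] at this
    exact this
  refine DifferentiableAt.congr_of_eventuallyEq ?_ hev
  refine h.2.neg.add ?_
  exact (contDiffAt_iteratedDeriv (n := 1) (m := n)
    (hV.of_le (by norm_cast; omega))).differentiableAt (by norm_num)

theorem iteratedDeriv_two_add {u v : ℝ → ℂ} {r : ℝ} (hu : RegAt 1 u r) (hv : RegAt 1 v r) :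
    iteratedDeriv 2 (fun x => u x + v x) r = iteratedDeriv 2 u r + iteratedDeriv 2 v r := by
  have e : deriv (fun x => u x + v x) =ᶠ[𝓝 r] fun x => deriv u x + deriv v x := by
    filter_upwards [hu.1.eventually (by simp), hv.1.eventually (by simp)] with x hx hy
    exact deriv_add (hx.differentiableAt (by simp)) (hy.differentiableAt (by simp))
  have h1 := hu.2
  have h2 := hv.2
  simp only [iteratedDeriv_succ, iteratedDeriv_zero] at h1 h2 ⊢
  rw [e.deriv_eq]
  exact deriv_add h1 h2

theorem RegAt.mono {n m : ℕ} (hmn : m ≤ n) {u : ℝ → ℂ} {r : ℝ} (h : RegAt n u r) :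
    RegAt m u r := by
  rcases hmn.eq_or_lt with rfl | hlt
  · exact h
  · exact ⟨h.1.of_le (by exact_mod_cast hmn), (contDiffAt_iteratedDeriv (n := 1) (m := m)
      (h.1.of_le (by norm_cast; omega))).differentiableAt (by norm_num)⟩

theorem radT_add {l : ℕ} {u v : ℝ → ℂ} {r : ℝ} (hu : RegAt 1 u r) (hv : RegAt 1 v r) :
    radT l (fun x => u x + v x) r = radT l u r + radT l v r := by
  simp only [RadialCube.radT, iteratedDeriv_two_add hu hv]
  ring

theorem radT_smul (l : ℕ) (c : ℂ) (u : ℝ → ℂ) :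
    radT l (fun x => c * u x) = fun x => c * radT l u x := by
  funext r
  have : iteratedDeriv 2 (fun x => c * u x) r = c * iteratedDeriv 2 u r := by
    simp
  simp only [RadialCube.radT, this]
  ring

theorem radT3_smul (l : ℕ) (c : ℂ) (u : ℝ → ℂ) :
    radT3 l (fun x => c * u x) = fun x => c * radT3 l u x := by
  simp only [radT3, radT_smul]

theorem radT_congr {l : ℕ} {u v : ℝ → ℂ} {r : ℝ} (h : u =ᶠ[𝓝 r] v) :
    radT l u =ᶠ[𝓝 r] radT l v := by
  filter_upwards [h.eventuallyEq_nhds] with x hx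
  simp only [RadialCube.radT, hx.iteratedDeriv_eq 2, hx.eq_of_nhds]

theorem radT3_congr {l : ℕ} {u v : ℝ → ℂ} {r : ℝ} (h : u =ᶠ[𝓝 r] v) :
    radT3 l u r = radT3 l v r :=
  (radT_congr (radT_congr (radT_congr h))).eq_of_nhds

theorem RegAt.eventually_contDiffAt {n : ℕ} {u : ℝ → ℂ} {r : ℝ} (h : RegAt n u r) :
    ∀ᶠ x in 𝓝 r, ContDiffAt ℝ n u x := h.1.eventually (by simp)

theorem ContDiffAt.regAt {n m : ℕ} (hmn : m < n) {u : ℝ → ℂ} {r : ℝ} (h : ContDiffAt ℝ n u r) :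
    RegAt m u r :=
  ⟨h.of_le (by exact_mod_cast hmn.le), (contDiffAt_iteratedDeriv (n := 1) (m := m)
      (h.of_le (by norm_cast; omega))).differentiableAt (by norm_num)⟩

theorem radT3_add {l : ℕ} {u v : ℝ → ℂ} {r : ℝ} (hr : 0 < r) (hu : RegAt 5 u r)
    (hv : RegAt 5 v r) :
    radT3 l (fun x => u x + v x) r = radT3 l u r + radT3 l v r := by
  have hpos : ∀ᶠ x in 𝓝 r, (0 : ℝ) < x := eventually_gt_nhds hr
  have h4 : ∀ {w : ℝ → ℂ} {x : ℝ}, ContDiffAt ℝ 5 w x → RegAt 4 w x := fun h =>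
    ContDiffAt.regAt (n := 5) (by norm_num) (by exact_mod_cast h)
  have s1 : radT l (fun x => u x + v x) =ᶠ[𝓝 r] fun x => radT l u x + radT l v x := by
    filter_upwards [hu.eventually_contDiffAt, hv.eventually_contDiffAt] with x hx hy
    exact radT_add ((h4 hx).mono (by norm_num)) ((h4 hy).mono (by norm_num))
  have s2 : radT l (fun x => radT l u x + radT l v x) =ᶠ[𝓝 r]
      fun x => radT l (radT l u) x + radT l (radT l v) x := by
    filter_upwards [hpos, hu.eventually_contDiffAt, hv.eventually_contDiffAt] with x h0 hx hy
    exact radT_add (((h4 hx).radT (n := 2) h0).mono (by norm_num))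
      (((h4 hy).radT (n := 2) h0).mono (by norm_num))
  have s3 : radT l (fun x => radT l (radT l u) x + radT l (radT l v) x) r =
      radT3 l u r + radT3 l v r :=
    radT_add ((hu.radT (n := 3) hr).radT (n := 1) hr) ((hv.radT (n := 3) hr).radT (n := 1) hr)
  rw [← s3]
  exact (radT_congr ((radT_congr s1).trans s2)).eq_of_nhds

theorem InDomain.ae_regAt {l ξ : ℕ} {κ : ℝ} {u : ℝ → ℂ} (h : InDomain l ξ κ u) :
    ∀ᵐ r ∂halfLine, RegAt 5 u r := by
  obtain ⟨w, hw, hint⟩ := h.sixth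
  have hloc : LocallyIntegrable ((Ioi (0 : ℝ)).indicator w) volume := by
    have h2 : MemLp ((Ioi (0 : ℝ)).indicator w) 2 volume :=
      (memLp_indicator_iff_restrict measurableSet_Ioi).2 hw
    exact h2.locallyIntegrable (by norm_num)
  rw [ae_restrict_iff' measurableSet_Ioi]
  filter_upwards [LocallyIntegrable.ae_hasDerivAt_integral hloc] with r hr hpos
  have hpos' : (0 : ℝ) < r := hpos
  refine ⟨h.contDiffOn.contDiffAt (Ioi_mem_nhds hpos'), ?_⟩
  have hev : iteratedDeriv 5 u =ᶠ[𝓝 r] fun x =>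
      iteratedDeriv 5 u r + ∫ t in r..x, (Ioi (0 : ℝ)).indicator w t := by
    filter_upwards [eventually_gt_nhds hpos'] with x hx
    have := hint r x hpos' hx
    rw [intervalIntegral.integral_congr (g := w), ← this]
    · ring
    · intro t ht
      have : (0 : ℝ) < t := lt_of_lt_of_le (lt_min hpos' hx) ht.1
      simp [this]
  exact ((hr r).differentiableAt.const_add _).congr_of_eventuallyEq hev

theorem InDomain.radT3_add_ae {l ξ : ℕ} {κ : ℝ} {u v : ℝ → ℂ} (hu : InDomain l ξ κ u)
    (hv : InDomain l ξ κ v) :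
    radT3 l (fun x => u x + v x) =ᵐ[halfLine] fun x => radT3 l u x + radT3 l v x := by
  filter_upwards [hu.ae_regAt, hv.ae_regAt, ae_restrict_mem measurableSet_Ioi] with r h1 h2 hr
  exact radT3_add hr h1 h2

theorem HasBoundaryValues.add {u v : ℝ → ℂ} {b c : ℕ → ℂ} (hu : HasBoundaryValues u b)
    (hv : HasBoundaryValues v c) (hu5 : ContDiffOn ℝ 5 u (Ioi 0))
    (hv5 : ContDiffOn ℝ 5 v (Ioi 0)) :
    HasBoundaryValues (fun x => u x + v x) (fun j => b j + c j) := by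
  intro j hj
  refine ((hu j hj).add (hv j hj)).congr' ?_
  filter_upwards [self_mem_nhdsWithin] with x hx
  have hle : ((j : ℕ) : WithTop ℕ∞) ≤ 5 := by norm_cast; omega
  exact (iteratedDeriv_add ((hu5.contDiffAt (Ioi_mem_nhds hx)).of_le hle)
    ((hv5.contDiffAt (Ioi_mem_nhds hx)).of_le hle)).symm

theorem InDomain.add {l ξ : ℕ} {κ : ℝ} {u v : ℝ → ℂ} (hu : InDomain l ξ κ u)
    (hv : InDomain l ξ κ v) : InDomain l ξ κ (fun x => u x + v x) where
  contDiffOn := hu.contDiffOn.add hv.contDiffOn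
  memLp := hu.memLp.add hv.memLp
  sixth := by
    obtain ⟨w, hw, hwi⟩ := hu.sixth
    obtain ⟨w', hw', hwi'⟩ := hv.sixth
    refine ⟨fun x => w x + w' x, hw.add hw', fun a b ha hb => ?_⟩
    have key : ∀ {f : ℝ → ℂ}, MemLp f 2 halfLine → IntervalIntegrable f volume a b := by
      intro f hf
      rw [intervalIntegrable_iff]
      have hsub : uIoc a b ⊆ Ioi (0 : ℝ) := fun t ht => lt_of_le_of_lt (le_min ha.le hb.le) ht.1
      have h2 : MemLp f 2 (volume.restrict (uIoc a b)) :=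
        hf.mono_measure (Measure.restrict_mono hsub le_rfl)
      have : IsFiniteMeasure (volume.restrict (uIoc a b)) :=
        ⟨by simp [uIoc]⟩
      exact h2.integrable (by norm_num)
    have hd : ∀ {x : ℝ}, 0 < x → iteratedDeriv 5 (fun x => u x + v x) x =
        iteratedDeriv 5 u x + iteratedDeriv 5 v x := fun hx =>
      iteratedDeriv_add (hu.contDiffOn.contDiffAt (Ioi_mem_nhds hx))
        (hv.contDiffOn.contDiffAt (Ioi_mem_nhds hx))
    rw [intervalIntegral.integral_add (key hw) (key hw'), ← hwi a b ha hb, ← hwi' a b ha hb,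
      hd ha, hd hb]
    ring
  bc := by
    obtain ⟨b, hb, hr⟩ := hu.bc
    obtain ⟨c, hc, hr'⟩ := hv.bc
    refine ⟨_, hb.add hc hu.contDiffOn hv.contDiffOn, ?_⟩
    unfold BoundaryRel at *
    split_ifs at * <;> simp_all [mul_add]
  memLp_radT3 := (hu.memLp_radT3.add hv.memLp_radT3).ae_eq (hu.radT3_add_ae hv).symm

theorem InDomain.smul {l ξ : ℕ} {κ : ℝ} (c : ℂ) {u : ℝ → ℂ} (hu : InDomain l ξ κ u) :
    InDomain l ξ κ (fun x => c * u x) where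
  contDiffOn := contDiffOn_const.mul hu.contDiffOn
  memLp := hu.memLp.const_mul c
  sixth := by
    obtain ⟨w, hw, hwi⟩ := hu.sixth
    refine ⟨fun x => c * w x, hw.const_mul c, fun a b ha hb => ?_⟩
    have hd : ∀ x : ℝ, iteratedDeriv 5 (fun x => c * u x) x = c * iteratedDeriv 5 u x := fun x => by
      simp
    rw [intervalIntegral.integral_const_mul, ← hwi a b ha hb, hd, hd]
    ring
  bc := by
    obtain ⟨b, hb, hr⟩ := hu.bc
    refine ⟨fun j => c * b j, fun j hj => ?_, ?_⟩
    · have hd : iteratedDeriv j (fun x => c * u x) = fun x => c * iteratedDeriv j u x := by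
        funext x
        simp
      rw [hd]
      exact (hb j hj).const_mul c
    · unfold BoundaryRel at *
      split_ifs at * <;> simp_all [mul_left_comm]
  memLp_radT3 := by
    rw [radT3_smul]
    exact hu.memLp_radT3.const_mul c

theorem InDomain.zero (l ξ : ℕ) (κ : ℝ) : InDomain l ξ κ (fun _ => 0) where
  contDiffOn := contDiffOn_const
  memLp := MemLp.zero
  sixth := ⟨fun _ => 0, MemLp.zero, fun a b _ _ => by simp⟩
  bc := by
    refine ⟨fun _ => 0, fun j _ => ?_, ?_⟩
    · have : iteratedDeriv j (fun _ : ℝ => (0 : ℂ)) = fun _ => 0 := by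
        funext x
        simp
      rw [this]
      exact tendsto_const_nhds
    · unfold BoundaryRel
      split_ifs <;> simp
  memLp_radT3 := by
    have := radT3_smul l 0 (fun _ => 0)
    simp only [zero_mul] at this
    rw [this]
    exact MemLp.zero

theorem InDomain.radT3_congr_ae {l ξ : ℕ} {κ : ℝ} {u v : ℝ → ℂ} (hu : InDomain l ξ κ u)
    (hv : InDomain l ξ κ v) (h : u =ᵐ[halfLine] v) : radT3 l u =ᵐ[halfLine] radT3 l v := by
  have heq : EqOn u v (Ioi 0) := Measure.eqOn_open_of_ae_eq h isOpen_Ioi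
    hu.contDiffOn.continuousOn hv.contDiffOn.continuousOn
  filter_upwards [ae_restrict_mem measurableSet_Ioi] with r hr
  exact radT3_congr (heq.eventuallyEq_of_mem (Ioi_mem_nhds hr))

/-- The domain of `T_{lξκ}³` as a subspace of `L²(0, ∞)`. -/
def domain (l ξ : ℕ) (κ : ℝ) : Submodule ℂ HalfL2 where
  carrier := {f | ∃ u : ℝ → ℂ, InDomain l ξ κ u ∧ f =ᵐ[halfLine] u}
  zero_mem' := ⟨_, InDomain.zero l ξ κ, Lp.coeFn_zero ℂ 2 halfLine⟩
  add_mem' := by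
    rintro f g ⟨u, hu, hfu⟩ ⟨v, hv, hgv⟩
    refine ⟨_, hu.add hv, (Lp.coeFn_add f g).trans ?_⟩
    filter_upwards [hfu, hgv] with x h1 h2
    simp [h1, h2]
  smul_mem' := by
    rintro c f ⟨u, hu, hfu⟩
    refine ⟨_, hu.smul c, (Lp.coeFn_smul c f).trans ?_⟩
    filter_upwards [hfu] with x h1
    simp [h1]

/-- The regular representative of an element of the domain. -/
def rep {l ξ : ℕ} {κ : ℝ} (f : domain l ξ κ) : ℝ → ℂ := f.2.choose

theorem rep_inDomain {l ξ : ℕ} {κ : ℝ} (f : domain l ξ κ) : InDomain l ξ κ (rep f) :=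
  f.2.choose_spec.1

theorem coe_ae_eq_rep {l ξ : ℕ} {κ : ℝ} (f : domain l ξ κ) : (f : HalfL2) =ᵐ[halfLine] rep f :=
  f.2.choose_spec.2

/-- The operator `T_{lξκ}³` in `L²(0, ∞)`: it acts on its domain as the differential operation
`T_l³`. -/
def operator (l ξ : ℕ) (κ : ℝ) : HalfL2 →ₗ.[ℂ] HalfL2 where
  domain := domain l ξ κ
  toFun :=
    { toFun := fun f => (rep_inDomain f).memLp_radT3.toLp (radT3 l (rep f))
      map_add' := by
        intro f g
        rw [← MemLp.toLp_add, MemLp.toLp_eq_toLp_iff]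
        have h : rep (f + g) =ᵐ[halfLine] fun x => rep f x + rep g x := by
          filter_upwards [coe_ae_eq_rep f, coe_ae_eq_rep g, coe_ae_eq_rep (f + g),
            Lp.coeFn_add (f : HalfL2) (g : HalfL2)] with x h1 h2 h3 h4
          rw [← h3, ← h1, ← h2]
          exact h4
        exact ((rep_inDomain (f + g)).radT3_congr_ae
          ((rep_inDomain f).add (rep_inDomain g)) h).trans
          ((rep_inDomain f).radT3_add_ae (rep_inDomain g))
      map_smul' := by
        intro c f
        rw [RingHom.id_apply, ← MemLp.toLp_const_smul, MemLp.toLp_eq_toLp_iff]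
        have h : rep (c • f) =ᵐ[halfLine] fun x => c * rep f x := by
          filter_upwards [coe_ae_eq_rep f, coe_ae_eq_rep (c • f),
            Lp.coeFn_smul c (f : HalfL2)] with x h1 h3 h4
          rw [← h3, ← h1]
          exact h4
        have h2 := (rep_inDomain (c • f)).radT3_congr_ae ((rep_inDomain f).smul c) h
        rw [radT3_smul] at h2
        exact h2 }

/-- `R` is the resolvent kernel of the operator `T` at the point `w`: the operator `T - w` has a
bounded everywhere defined inverse, and this inverse is the integral operator on `(0, ∞)` with
kernel `R`. -/
def IsResolventKernel (T : HalfL2 →ₗ.[ℂ] HalfL2) (w : ℂ) (R : ℝ → ℝ → ℂ) : Prop :=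
  ∃ G : HalfL2 →L[ℂ] HalfL2,
    (∀ f : HalfL2, ∃ h : G f ∈ T.domain, T ⟨G f, h⟩ - w • G f = f) ∧
    (∀ u : T.domain, G (T u - w • (u : HalfL2)) = u) ∧
    (∀ f : HalfL2,
      (∀ r : ℝ, 0 < r → IntegrableOn (fun s => R r s * f s) (Ioi 0)) ∧
      ∀ᵐ r ∂halfLine, G f r = ∫ s in Ioi (0 : ℝ), R r s * f s)

/-! ### The explicit kernel -/

/-- The phase `e^{iπt}`. -/
def phase (t : ℝ) : ℂ := Complex.exp (Complex.I * π * t)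

/-- The decaying solutions `g_k(z, r) = D_l exp(i e^{iπk/3} z r)`, `k = 0, 1, 2`. -/
def solG (l : ℕ) (z : ℂ) (k : Fin 3) : ℝ → ℂ :=
  radD l (fun r => Complex.exp (Complex.I * phase ((k : ℕ) / 3) * z * r))

/-- The growing solutions `d_k(z, r) = D_l exp(-i e^{iπk/3} z r)`, `k = 0, 1, 2`. -/
def solD (l : ℕ) (z : ℂ) (k : Fin 3) : ℝ → ℂ :=
  radD l (fun r => Complex.exp (-Complex.I * phase ((k : ℕ) / 3) * z * r))

/-- The Wronskians `W_k(z)` (which do not depend on `r`). -/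
def wron (l : ℕ) (z : ℂ) : Fin 3 → ℂ :=
  if l = 1 then ![-2 * Complex.I * z ^ 3, 2 * Complex.I * z ^ 3, -2 * Complex.I * z ^ 3]
  else ![-2 * Complex.I * z ^ 5, 2 * Complex.I * phase (2 / 3) * z ^ 5,
    2 * Complex.I * phase (1 / 3) * z ^ 5]

/-- The real parameter `c` through which the boundary parameter `κ` enters the coefficients:
`8κ/9` for `l = 1`, `5κ/8` for `l = 2, ξ = 1` and `-7κ⁵/8` for `l = 2, ξ = 2`. -/
def param (l ξ : ℕ) (κ : ℝ) : ℂ :=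
  if l = 1 then 8 / 9 * (κ : ℂ) else if ξ = 1 then 5 / 8 * (κ : ℂ) else -(7 / 8) * (κ : ℂ) ^ 5

/-- The denominator `p(z)`. -/
def denom (l ξ : ℕ) (κ : ℝ) (z : ℂ) : ℂ :=
  let c := param l ξ κ
  if ξ = 1 then
    if l = 1 then 3 * z + 2 * phase (1 / 6) * c else 2 * z + 3 * phase (1 / 6) * c
  else
    if l = 1 then z + 2 * phase (1 / 6) * c else z ^ 5 + 2 * phase (5 / 6) * c

/-- The coefficients `α_k`. -/
def coefA (l ξ : ℕ) (κ : ℝ) (z : ℂ) (k : Fin 3) : ℂ :=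
  let c := param l ξ κ
  (if ξ = 1 then
    if l = 1 then
      ![2 * phase (5 / 6) * c - 3 * z,
        -3 * z,
        -(2 * Complex.I * c + 3 * z)]
    else
      ![3 * phase (7 / 6) * c - 2 * phase (1 / 3) * z,
        3 * phase (7 / 6) * c,
        3 * phase (7 / 6) * c + 2 * phase (2 / 3) * z]
  else
    if l = 1 then
      ![z + 2 * phase (-1 / 6) * c,
        -3 * z,
        z + 2 * Complex.I * c]
    else
      ![2 * phase (1 / 6) * c - z ^ 5,
        3 * z ^ 5,
        -(z ^ 5 + 2 * Complex.I * c)]) k / denom l ξ κ z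

/-- The coefficients `β_k`. -/
def coefB (l ξ : ℕ) (κ : ℝ) (z : ℂ) (k : Fin 3) : ℂ :=
  let c := param l ξ κ
  (if ξ = 1 then
    if l = 1 then
      ![2 * phase (7 / 6) * c,
        2 * phase (5 / 6) * c,
        2 * Complex.I * c]
    else
      ![2 * phase (1 / 3) * z,
        2 * phase (2 / 3) * z,
        -2 * z]
  else
    if l = 1 then
      ![-2 * (phase (1 / 3) * z + phase (1 / 6) * c),
        2 * (phase (1 / 3) * z + phase (5 / 6) * c),
        -2 * (phase (1 / 3) * z + Complex.I * c)]
    else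
      ![2 * (z ^ 5 - phase (1 / 6) * c),
        -2 * (z ^ 5 + Complex.I * c),
        -2 * (z ^ 5 + phase (5 / 6) * c)]) k / denom l ξ κ z

/-- The coefficients `γ_k`. -/
def coefC (l ξ : ℕ) (κ : ℝ) (z : ℂ) (k : Fin 3) : ℂ :=
  let c := param l ξ κ
  (if ξ = 1 then
    if l = 1 then
      ![2 * phase (-1 / 6) * c,
        -2 * Complex.I * c,
        2 * phase (7 / 6) * c]
    else
      ![-2 * z,
        -2 * phase (1 / 3) * z,
        -2 * phase (2 / 3) * z]
  else
    if l = 1 then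
      ![2 * (phase (2 / 3) * z + phase (5 / 6) * c),
        -2 * (phase (2 / 3) * z + Complex.I * c),
        2 * (phase (2 / 3) * z - phase (1 / 6) * c)]
    else
      ![-2 * (z ^ 5 + phase (5 / 6) * c),
        2 * (phase (1 / 6) * c - z ^ 5),
        2 * (z ^ 5 + Complex.I * c)]) k / denom l ξ κ z

/-- The combination `d_k + a g_k + b g_{k+1} + c g_{k+2}` (indices modulo 3). -/
def combo (l : ℕ) (z : ℂ) (k : Fin 3) (a b c : ℂ) : ℝ → ℂ :=
  fun r => solD l z k r + a * solG l z k r + b * solG l z (k + 1) r + c * solG l z (k + 2) r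

/-- The solutions `h_k = d_k + α_k g_k + β_k g_{k+1} + γ_k g_{k+2}` (indices modulo 3). -/
def solH (l ξ : ℕ) (κ : ℝ) (z : ℂ) (k : Fin 3) : ℝ → ℂ :=
  combo l z k (coefA l ξ κ z k) (coefB l ξ κ z k) (coefC l ξ κ z k)

/-- The Heaviside step function, with `θ(0) = 1/2`, so that `θ(x) + θ(-x) = 1`. -/
def heav (x : ℝ) : ℂ := if 0 < x then 1 else if x = 0 then 1 / 2 else 0

/-- The kernel `R(r, s; z)`. -/
def kernelR (l ξ : ℕ) (κ : ℝ) (z : ℂ) (r s : ℝ) : ℂ :=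
  ∑ k : Fin 3, phase (2 * (k : ℕ) / 3) / (3 * z ^ 4 * wron l z k) *
    (solH l ξ κ z k r * solG l z k s * heav (s - r) +
      solH l ξ κ z k s * solG l z k r * heav (r - s))

end RadialCube

end

noncomputable section

namespace RadialCube

/-! ### The solutions `D_l e^{ar}` -/

/-! The functions D_l e^{ar} satisfy T_l ψ = -a²ψ. With a_k = i e^{iπk/3} z, all λ_k = -a_k² are
cube roots of z⁶, so g_k and d_k (exponents a_k and -a_k) solve the sixth-order equation, and the
range of arg z gives Re a_k < 0.

Boundary conditions. Near 0 each solution is r^{-l} times a power series in ar whose coefficients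
vanish at n = 1, and also at n = 3 when l = 2. A linear combination ∑ x_i D_l e^{b_i r} therefore
has boundary values exactly when its moment ∑ x_i vanishes, and the boundary conditions become
linear equations between the moments ∑ x_i b_i^m (`satisfiesBC_lin_iff`). The listed coefficients
solve this system (`satisfiesBC_solH`), and elimination shows that it is nondegenerate when p ≠ 0
(`eq_zero_of_momentRel`).

Kernel. The resolvent comes from the partial fractions 1/(λ³ - z⁶) = ∑ (3λ_k²)⁻¹/(λ - λ_k): the
weight c_k of h_k(r) g_k(s) satisfies c_k W_k = 1/(3λ_k²). The resulting moment identities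
(`kerCoeff_sum`), together with the symmetry of c_k μ_{kj} (`kerCoeff_mul_coefMat`), where μ_{kj}
are the coefficients of h_k, give the jumps on the diagonal: none up to the fourth derivative and -1
in the fifth (`jump`).

Existence. Although the g_k are singular at 0, the same identities cancel the singular parts of the
kernel (`kernel_expansion`). Its derivatives of order j ≤ 5 are bounded by a multiple of
e^{-ε|r-s|}, while j = 6 adds 1/max(r,s) (`ker_bound`). The Schur test bounds all these operators on
L². Variation of constants then shows that Rf lies in the domain and solves the equation
(`inDomain_convD`, `radT3_convD`).

Uniqueness. A homogeneous solution in the domain grows at most polynomially because its sixth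
derivative is in L². The partial fractions split it into solutions of T_l q = λ_k q of polynomial
growth, which are multiples of g_k (`exists_eq_sum_of_homogeneous`); the boundary conditions then
force it to vanish. So R is a two-sided inverse, and the delta equation follows by applying R(T_l³ -
z⁶) = 1 to test functions. -/

/-- The function `D_l e^{ar}`. -/
def psi (l : ℕ) (a : ℂ) : ℝ → ℂ := radD l (fun r : ℝ => Complex.exp (a * r))

/-- The polynomial `q_l` in `1/r` with `D_l e^{ar} = q_l(1/r) e^{ar}`. -/
def psiPoly (l : ℕ) (a : ℂ) : Polynomial ℂ :=
  if l = 1 then Polynomial.C a - Polynomial.X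
  else Polynomial.C (a ^ 2) - Polynomial.C (3 * a) * Polynomial.X + 3 * Polynomial.X ^ 2

theorem hasDerivAt_cexp_mul (a : ℂ) (r : ℝ) :
    HasDerivAt (fun x : ℝ => Complex.exp (a * x)) (a * Complex.exp (a * r)) r := by
  have h : HasDerivAt (fun x : ℂ => Complex.exp (a * x)) (Complex.exp (a * r) * (a * 1)) (r : ℂ) :=
    ((hasDerivAt_id (r : ℂ)).const_mul a).cexp
  have := h.comp_ofReal
  convert this using 1
  ring

theorem hasDerivAt_ofReal_inv {r : ℝ} (hr : 0 < r) :
    HasDerivAt (fun x : ℝ => (x : ℂ)⁻¹) (-((r : ℂ)⁻¹ ^ 2)) r := by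
  have hne : (r : ℂ) ≠ 0 := by exact_mod_cast hr.ne'
  have := (hasDerivAt_inv hne).comp_ofReal
  convert this using 1
  field_simp

/-- Since the derivative of 1/r is -(1/r)², polynomials in 1/r times e^{ar} are closed under
differentiation. All derivatives of the exponential solutions are computed by this rule. -/
theorem hasDerivAt_evalInv_mul_exp (q : Polynomial ℂ) (a : ℂ) {r : ℝ} (hr : 0 < r) :
    HasDerivAt (fun x : ℝ => q.eval (x : ℂ)⁻¹ * Complex.exp (a * x))
      ((Polynomial.C a * q - Polynomial.X ^ 2 * Polynomial.derivative q).eval (r : ℂ)⁻¹ *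
        Complex.exp (a * r)) r := by
  have h1 := (q.hasDerivAt ((r : ℂ)⁻¹)).scomp r (hasDerivAt_ofReal_inv hr)
  have h2 := h1.mul (hasDerivAt_cexp_mul a r)
  refine h2.congr_deriv ?_
  simp only [Polynomial.eval_sub, Polynomial.eval_mul, Polynomial.eval_C, Polynomial.eval_pow,
    Polynomial.eval_X, smul_eq_mul, Function.comp_apply]
  ring

theorem psi_one (a : ℂ) {r : ℝ} (hr : 0 < r) :
    psi 1 a r = (a - (r : ℂ)⁻¹) * Complex.exp (a * r) := by
  have hne : (r : ℂ) ≠ 0 := by exact_mod_cast hr.ne'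
  have h := (hasDerivAt_cexp_mul a r).mul (hasDerivAt_ofReal_inv hr)
  simp only [psi, radD, Function.iterate_one, invD, div_eq_mul_inv]
  erw [h.deriv]
  field_simp
  ring

theorem psi_two (a : ℂ) {r : ℝ} (hr : 0 < r) :
    psi 2 a r = (a ^ 2 - 3 * a * (r : ℂ)⁻¹ + 3 * (r : ℂ)⁻¹ ^ 2) * Complex.exp (a * r) := by
  have hne : (r : ℂ) ≠ 0 := by exact_mod_cast hr.ne'
  have key : ∀ x : ℝ, 0 < x → invD (fun x : ℝ => Complex.exp (a * x) / (x : ℂ)) x =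
      (Polynomial.C a * Polynomial.X ^ 2 - Polynomial.X ^ 3).eval (x : ℂ)⁻¹ *
        Complex.exp (a * x) := by
    intro x hx
    have hne : (x : ℂ) ≠ 0 := by exact_mod_cast hx.ne'
    have h := (hasDerivAt_cexp_mul a x).mul (hasDerivAt_ofReal_inv hx)
    simp only [invD, div_eq_mul_inv]
    erw [h.deriv]
    simp
    field_simp
    ring
  have hev : invD (fun x : ℝ => Complex.exp (a * x) / (x : ℂ)) =ᶠ[𝓝 r] fun x : ℝ =>
      (Polynomial.C a * Polynomial.X ^ 2 - Polynomial.X ^ 3).eval (x : ℂ)⁻¹ *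
        Complex.exp (a * x) := by
    filter_upwards [eventually_gt_nhds hr] with x hx using key x hx
  have h := (hev.hasDerivAt_iff.2 (hasDerivAt_evalInv_mul_exp
    (Polynomial.C a * Polynomial.X ^ 2 - Polynomial.X ^ 3) a hr)).deriv
  simp only [psi, radD, Function.iterate_succ, Function.iterate_zero, Function.comp, id]
  rw [invD, h]
  simp
  field_simp
  ring

theorem psi_eq {l : ℕ} (hl : l = 1 ∨ l = 2) (a : ℂ) {r : ℝ} (hr : 0 < r) :
    psi l a r = (psiPoly l a).eval (r : ℂ)⁻¹ * Complex.exp (a * r) := by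
  rcases hl with rfl | rfl
  · rw [psi_one a hr]
    simp [psiPoly]
  · rw [psi_two a hr]
    simp [psiPoly]

/-- The polynomials with `(d/dr)^j (q(1/r) e^{ar}) = q_j(1/r) e^{ar}`. -/
def derivPoly (a : ℂ) (q : Polynomial ℂ) : ℕ → Polynomial ℂ
  | 0 => q
  | j + 1 => Polynomial.C a * derivPoly a q j -
      Polynomial.X ^ 2 * Polynomial.derivative (derivPoly a q j)

/-- Turns a chain of first derivatives known only on r > 0 into iterated derivatives. It serves both
the explicit solutions and the integral operator. -/
theorem iteratedDeriv_of_hasDerivAt {u : ℕ → ℝ → ℂ} {n : ℕ}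
    (h : ∀ j < n, ∀ r : ℝ, 0 < r → HasDerivAt (u j) (u (j + 1) r) r) :
    ∀ j ≤ n, ∀ r : ℝ, 0 < r → iteratedDeriv j (u 0) r = u j r := by
  intro j
  induction j with
  | zero => simp
  | succ j ih =>
    intro hj r hr
    rw [iteratedDeriv_succ]
    have hev : iteratedDeriv j (u 0) =ᶠ[𝓝 r] u j := by
      filter_upwards [eventually_gt_nhds hr] with x hx using ih (by omega) x hx
    rw [hev.deriv_eq]
    exact (h j (by omega) r hr).deriv

theorem iteratedDeriv_congr_pos {u v : ℝ → ℂ} (h : ∀ r : ℝ, 0 < r → u r = v r) (j : ℕ) {r : ℝ}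
    (hr : 0 < r) : iteratedDeriv j u r = iteratedDeriv j v r := by
  have hev : u =ᶠ[𝓝 r] v := by
    filter_upwards [eventually_gt_nhds hr] with x hx using h x hx
  exact hev.iteratedDeriv_eq j

theorem iteratedDeriv_psi {l : ℕ} (hl : l = 1 ∨ l = 2) (a : ℂ) (j : ℕ) {r : ℝ} (hr : 0 < r) :
    iteratedDeriv j (psi l a) r =
      (derivPoly a (psiPoly l a) j).eval (r : ℂ)⁻¹ * Complex.exp (a * r) := by
  rw [iteratedDeriv_congr_pos (fun r hr => psi_eq hl a hr) j hr]
  exact iteratedDeriv_of_hasDerivAt (n := j)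
    (u := fun j (x : ℝ) => (derivPoly a (psiPoly l a) j).eval (x : ℂ)⁻¹ * Complex.exp (a * x))
    (fun i _ x hx => hasDerivAt_evalInv_mul_exp _ a hx) j le_rfl r hr

theorem hasDerivAt_iteratedDeriv_psi {l : ℕ} (hl : l = 1 ∨ l = 2) (a : ℂ) (j : ℕ) {r : ℝ}
    (hr : 0 < r) :
    HasDerivAt (iteratedDeriv j (psi l a)) (iteratedDeriv (j + 1) (psi l a) r) r := by
  have hev : iteratedDeriv j (psi l a) =ᶠ[𝓝 r] fun x : ℝ =>
      (derivPoly a (psiPoly l a) j).eval (x : ℂ)⁻¹ * Complex.exp (a * x) := by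
    filter_upwards [eventually_gt_nhds hr] with x hx using iteratedDeriv_psi hl a j hx
  rw [iteratedDeriv_psi hl a _ hr]
  exact hev.hasDerivAt_iff.2 (hasDerivAt_evalInv_mul_exp _ a hr)

theorem contDiffAt_psi {l : ℕ} (hl : l = 1 ∨ l = 2) (a : ℂ) {r : ℝ} (hr : 0 < r) {n : ℕ∞} :
    ContDiffAt ℝ n (psi l a) r := by
  have hev : psi l a =ᶠ[𝓝 r] fun x : ℝ =>
      (psiPoly l a).eval (x : ℂ)⁻¹ * Complex.exp (a * x) := by
    filter_upwards [eventually_gt_nhds hr] with x hx using psi_eq hl a hx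
  refine ContDiffAt.congr_of_eventuallyEq ?_ hev
  have hx : ContDiffAt ℝ n (fun x : ℝ => (x : ℂ)) r := Complex.ofRealCLM.contDiff.contDiffAt
  have hne : (r : ℂ) ≠ 0 := by exact_mod_cast hr.ne'
  refine ContDiffAt.mul ?_ ((contDiffAt_const.mul hx).cexp)
  have hq : ContDiff ℝ n (fun y : ℂ => (psiPoly l a).eval y) := by
    simpa using (psiPoly l a).contDiff_aeval (𝕜 := ℂ) n |>.restrict_scalars ℝ
  exact hq.contDiffAt.comp r (hx.inv hne)

theorem continuousOn_iteratedDeriv_psi {l : ℕ} (hl : l = 1 ∨ l = 2) (a : ℂ) (j : ℕ) :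
    ContinuousOn (iteratedDeriv j (psi l a)) (Ioi 0) := fun _ hr =>
  (hasDerivAt_iteratedDeriv_psi hl a j hr).continuousAt.continuousWithinAt

theorem norm_cexp_mul_ofReal (a : ℂ) (r : ℝ) :
    ‖Complex.exp (a * r)‖ = Real.exp (a.re * r) := by
  rw [Complex.norm_exp]
  simp

/-- For r ≥ 1 the point 1/r stays in the closed unit disc, where the polynomial factor is bounded.
-/
theorem exists_bound_iteratedDeriv_psi {l : ℕ} (hl : l = 1 ∨ l = 2) (a : ℂ) (j : ℕ) :
    ∃ C : ℝ, ∀ r : ℝ, 1 ≤ r → ‖iteratedDeriv j (psi l a) r‖ ≤ C * Real.exp (a.re * r) := by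
  obtain ⟨C, hC⟩ := (isCompact_closedBall (0 : ℂ) 1).exists_bound_of_continuousOn
    (derivPoly a (psiPoly l a) j).continuous.continuousOn
  refine ⟨C, fun r hr => ?_⟩
  rw [iteratedDeriv_psi hl a j (by linarith), norm_mul, norm_cexp_mul_ofReal]
  refine mul_le_mul_of_nonneg_right (hC _ ?_) (Real.exp_nonneg _)
  rw [mem_closedBall_zero_iff, norm_inv, Complex.norm_real, Real.norm_of_nonneg (by linarith)]
  exact inv_le_one_of_one_le₀ hr

/-- D_l intertwines -d²/dr² with T_l, so the eigenvalue of e^{ar} is inherited; for l = 1, 2 this is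
checked by direct expansion. -/
theorem radT_psi {l : ℕ} (hl : l = 1 ∨ l = 2) (a : ℂ) {r : ℝ} (hr : 0 < r) :
    radT l (psi l a) r = -a ^ 2 * psi l a r := by
  have hne : (r : ℂ) ≠ 0 := by exact_mod_cast hr.ne'
  rw [radT, iteratedDeriv_psi hl a 2 hr, psi_eq hl a hr]
  rcases hl with rfl | rfl
  · simp [psiPoly, derivPoly, Polynomial.derivative_pow]
    field_simp
    ring
  · simp [psiPoly, derivPoly, Polynomial.derivative_pow]
    field_simp
    ring

theorem iteratedDeriv_two_psi {l : ℕ} (hl : l = 1 ∨ l = 2) (a : ℂ) {r : ℝ} (hr : 0 < r) :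
    iteratedDeriv 2 (psi l a) r = ((l : ℂ) * (l + 1) / (r : ℂ) ^ 2 + a ^ 2) * psi l a r := by
  have := radT_psi hl a hr
  rw [radT] at this
  linear_combination -this

theorem radT3_psi {l : ℕ} (hl : l = 1 ∨ l = 2) (a : ℂ) {r : ℝ} (hr : 0 < r) :
    radT3 l (psi l a) r = -a ^ 6 * psi l a r := by
  have h1 : ∀ x : ℝ, 0 < x → radT l (psi l a) =ᶠ[𝓝 x] fun y => -a ^ 2 * psi l a y := by
    intro x hx
    filter_upwards [eventually_gt_nhds hx] with y hy using radT_psi hl a hy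
  have h2 : ∀ x : ℝ, 0 < x → radT l (radT l (psi l a)) x = -a ^ 2 * (-a ^ 2 * psi l a x) := by
    intro x hx
    rw [(radT_congr (h1 x hx)).eq_of_nhds, radT_smul]
    simp only [radT_psi hl a hx]
  have h3 : radT l (radT l (psi l a)) =ᶠ[𝓝 r] fun y => -a ^ 2 * (-a ^ 2 * psi l a y) := by
    filter_upwards [eventually_gt_nhds hr] with y hy using h2 y hy
  rw [radT3, (radT_congr h3).eq_of_nhds, radT_smul, radT_smul]
  simp only [radT_psi hl a hr]
  ring

/-- The Wronskian `d' g - d g'` of `d = D_l e^{-ar}` and `g = D_l e^{ar}`. -/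
theorem wronskian_psi {l : ℕ} (hl : l = 1 ∨ l = 2) (a : ℂ) {r : ℝ} (hr : 0 < r) :
    deriv (psi l (-a)) r * psi l a r - psi l (-a) r * deriv (psi l a) r =
      2 * (-1) ^ (l + 1) * a ^ (2 * l + 1) := by
  have hne : (r : ℂ) ≠ 0 := by exact_mod_cast hr.ne'
  have he : Complex.exp (a * r) * Complex.exp (-a * r) = 1 := by
    rw [← Complex.exp_add]
    simp
  simp only [← iteratedDeriv_one]
  rw [iteratedDeriv_psi hl a 1 hr, iteratedDeriv_psi hl (-a) 1 hr, psi_eq hl a hr,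
    psi_eq hl (-a) hr]
  rcases hl with rfl | rfl
  · simp [psiPoly, derivPoly]
    field_simp
    simp only [neg_mul] at he
    linear_combination (2 * a ^ 3 * (r:ℂ) ^ 3) * he
  · simp [psiPoly, derivPoly, Polynomial.derivative_pow]
    field_simp
    simp only [neg_mul] at he
    linear_combination (-2 * a ^ 5 * (r:ℂ) ^ 5) * he

end RadialCube

end

noncomputable section

namespace RadialCube

/-! ### Functions of the form `r^m U(r)` with `U` smooth up to the origin -/

/-- On `r > 0` the function `u` is `r^m` times a function that is smooth on the whole line. -/
def Reg (m : ℤ) (u : ℝ → ℂ) : Prop :=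
  ∃ U : ℝ → ℂ, ContDiff ℝ ∞ U ∧ ∀ r : ℝ, 0 < r → u r = (r : ℂ) ^ m * U r

theorem contDiff_ofReal_complex {n : WithTop ℕ∞} : ContDiff ℝ n (fun x : ℝ => (x : ℂ)) :=
  Complex.ofRealCLM.contDiff

theorem Reg.congr {m : ℤ} {u v : ℝ → ℂ} (h : Reg m u) (huv : ∀ r : ℝ, 0 < r → v r = u r) :
    Reg m v := by
  obtain ⟨U, hU, h⟩ := h
  exact ⟨U, hU, fun r hr => (huv r hr).trans (h r hr)⟩

theorem Reg.add {m : ℤ} {u v : ℝ → ℂ} (hu : Reg m u) (hv : Reg m v) :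
    Reg m (fun r => u r + v r) := by
  obtain ⟨U, hU, h⟩ := hu
  obtain ⟨V, hV, h'⟩ := hv
  exact ⟨_, hU.add hV, fun r hr => by simp only [h r hr, h' r hr]; ring⟩

theorem Reg.const_mul {m : ℤ} {u : ℝ → ℂ} (c : ℂ) (hu : Reg m u) : Reg m (fun r => c * u r) := by
  obtain ⟨U, hU, h⟩ := hu
  exact ⟨fun r => c * U r, contDiff_const.mul hU, fun r hr => by simp only [h r hr]; ring⟩

theorem Reg.sub {m : ℤ} {u v : ℝ → ℂ} (hu : Reg m u) (hv : Reg m v) :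
    Reg m (fun r => u r - v r) :=
  (hu.add (hv.const_mul (-1))).congr fun r _ => by ring

theorem Reg.zero (m : ℤ) : Reg m (fun _ => 0) :=
  ⟨fun _ => 0, contDiff_const, fun _ _ => by simp⟩

theorem Reg.sum {ι : Type*} {m : ℤ} {s : Finset ι} {u : ι → ℝ → ℂ} (h : ∀ i ∈ s, Reg m (u i)) :
    Reg m (fun r => ∑ i ∈ s, u i r) := by
  classical
  induction s using Finset.induction_on with
  | empty => simpa using Reg.zero m
  | insert i s hi ih =>
    refine ((h i (by simp)).add (ih fun j hj => h j (by simp [hj]))).congr fun r _ => ?_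
    rw [Finset.sum_insert hi]

theorem Reg.zpow (m : ℤ) : Reg m (fun r => (r : ℂ) ^ m) :=
  ⟨fun _ => 1, contDiff_const, fun _ _ => by simp⟩

theorem Reg.mono {m n : ℤ} (hmn : n ≤ m) {u : ℝ → ℂ} (h : Reg m u) : Reg n u := by
  obtain ⟨U, hU, h⟩ := h
  refine ⟨fun r => (r : ℂ) ^ (m - n).toNat * U r, (contDiff_ofReal_complex.pow _).mul hU,
    fun r hr => ?_⟩
  have hne : (r : ℂ) ≠ 0 := by exact_mod_cast hr.ne'
  rw [h r hr, ← mul_assoc, ← zpow_natCast, ← zpow_add₀ hne, Int.toNat_of_nonneg (by omega)]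
  congr 2
  ring

theorem hasDerivAt_ofReal_zpow (m : ℤ) {r : ℝ} (hr : 0 < r) :
    HasDerivAt (fun x : ℝ => (x : ℂ) ^ m) (m * (r : ℂ) ^ (m - 1)) r := by
  have hne : (r : ℂ) ≠ 0 := by exact_mod_cast hr.ne'
  exact (hasDerivAt_zpow m (r : ℂ) (Or.inl hne)).comp_ofReal

theorem Reg.hasDerivAt {m : ℤ} {u U : ℝ → ℂ} (hU : ContDiff ℝ ∞ U)
    (h : ∀ r : ℝ, 0 < r → u r = (r : ℂ) ^ m * U r) {r : ℝ} (hr : 0 < r) :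
    HasDerivAt u (m * (r : ℂ) ^ (m - 1) * U r + (r : ℂ) ^ m * deriv U r) r := by
  have hev : u =ᶠ[𝓝 r] fun x : ℝ => (x : ℂ) ^ m * U x := by
    filter_upwards [eventually_gt_nhds hr] with x hx using h x hx
  exact hev.hasDerivAt_iff.2 ((hasDerivAt_ofReal_zpow m hr).mul
    (hU.differentiable (by simp) r).hasDerivAt)

theorem contDiff_deriv_top {U : ℝ → ℂ} (hU : ContDiff ℝ ∞ U) : ContDiff ℝ ∞ (deriv U) :=
  (contDiff_infty_iff_deriv.1 hU).2

theorem Reg.deriv {m : ℤ} {u : ℝ → ℂ} (h : Reg m u) : Reg (m - 1) (deriv u) := by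
  obtain ⟨U, hU, h⟩ := h
  refine ⟨fun r => m * U r + r * _root_.deriv U r, (contDiff_const.mul hU).add
    (contDiff_ofReal_complex.mul (contDiff_deriv_top hU)), fun r hr => ?_⟩
  have hne : (r : ℂ) ≠ 0 := by exact_mod_cast hr.ne'
  have hz : (r : ℂ) ^ m = (r : ℂ) ^ (m - 1) * r := by
    rw [← zpow_add_one₀ hne, sub_add_cancel]
  simp only [(Reg.hasDerivAt hU h hr).deriv, hz]
  ring

/-- With exponent 0 the term from differentiating r^m is absent, so no order is lost, in contrast to
`Reg.deriv`. Derivatives of functions regular at 0 thus stay bounded there. -/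
theorem Reg.deriv_zero {u : ℝ → ℂ} (h : Reg 0 u) : Reg 0 (_root_.deriv u) := by
  obtain ⟨U, hU, h⟩ := h
  refine ⟨_root_.deriv U, contDiff_deriv_top hU, fun r hr => ?_⟩
  rw [(Reg.hasDerivAt hU h hr).deriv]
  simp

theorem Reg.iteratedDeriv {m : ℤ} {u : ℝ → ℂ} (h : Reg m u) (j : ℕ) :
    Reg (m - j) (iteratedDeriv j u) := by
  induction j with
  | zero => simpa using h
  | succ j ih =>
    rw [iteratedDeriv_succ]
    refine ih.deriv.mono (le_of_eq ?_)
    push_cast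
    ring

theorem Reg.iteratedDeriv_zero {u : ℝ → ℂ} (h : Reg 0 u) (j : ℕ) :
    Reg 0 (_root_.iteratedDeriv j u) := by
  induction j with
  | zero => simpa using h
  | succ j ih =>
    rw [iteratedDeriv_succ]
    exact ih.deriv_zero

theorem Reg.exists_bound {m : ℤ} {u : ℝ → ℂ} (h : Reg m u) :
    ∃ C : ℝ, 0 ≤ C ∧ ∀ r : ℝ, 0 < r → r ≤ 1 → ‖u r‖ ≤ C * r ^ m := by
  obtain ⟨U, hU, h⟩ := h
  obtain ⟨C, hC⟩ := (isCompact_Icc (a := (0 : ℝ)) (b := 1)).exists_bound_of_continuousOn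
    hU.continuous.continuousOn
  refine ⟨C, (norm_nonneg _).trans (hC 0 (by simp)), fun r h0 h1 => ?_⟩
  rw [h r h0, norm_mul, norm_zpow, Complex.norm_real, Real.norm_of_nonneg h0.le, mul_comm]
  exact mul_le_mul_of_nonneg_right (hC r ⟨h0.le, h1⟩) (zpow_nonneg h0.le _)

theorem Reg.tendsto_zero {m : ℤ} (hm : 1 ≤ m) {u : ℝ → ℂ} (h : Reg m u) :
    Tendsto u (𝓝[>] (0 : ℝ)) (𝓝 0) := by
  obtain ⟨U, hU, h⟩ := h.mono hm
  have hc : Continuous fun r : ℝ => (r : ℂ) * U r := Complex.continuous_ofReal.mul hU.continuous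
  have := (hc.tendsto 0).mono_left (nhdsWithin_le_nhds (s := Ioi 0))
  simp only [Complex.ofReal_zero, zero_mul] at this
  refine this.congr' ?_
  filter_upwards [self_mem_nhdsWithin] with r hr
  rw [h r hr]
  simp

/-- A function with a Taylor expansion at the origin of order at least six has the boundary
values given by the coefficients. -/
theorem hasBoundaryValues_of_expansion {u : ℝ → ℂ} {b : ℕ → ℂ}
    (h : Reg 6 (fun r => u r - ∑ i ∈ Finset.range 6, b i / (i.factorial : ℂ) * (r : ℂ) ^ i)) :
    HasBoundaryValues u b := by
  -- The order is made variable for an induction: differentiating an expansion of order n + 1 gives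
  -- one of order n for u', with the coefficient sequence b shifted by one.
  have key : ∀ n : ℕ, ∀ (u : ℝ → ℂ) (b : ℕ → ℂ), 
      Reg n (fun r => u r - ∑ i ∈ Finset.range n, b i / (i.factorial : ℂ) * (r : ℂ) ^ i) →
      ∀ j < n, Tendsto (iteratedDeriv j u) (𝓝[>] (0 : ℝ)) (𝓝 (b j)) := by
    intro n
    induction n with
    | zero => intro u b _ j hj; omega
    | succ n ih =>
      intro u b hu j hj
      have hpoly : ∀ (n : ℕ) (r : ℝ),
          HasDerivAt (fun x : ℝ => ∑ i ∈ Finset.range (n + 1), b i / (i.factorial : ℂ) * (x : ℂ) ^ i)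
          (∑ i ∈ Finset.range n, b (i + 1) / (i.factorial : ℂ) * (r : ℂ) ^ i) r := by
        intro n r
        induction n with
        | zero => simpa using hasDerivAt_const r (b 0)
        | succ n ih' =>
          have hp : HasDerivAt (fun x : ℝ => (x : ℂ) ^ (n + 1)) (((n + 1 : ℕ) : ℂ) * (r : ℂ) ^ n) r :=
            (hasDerivAt_pow (n + 1) (r : ℂ)).comp_ofReal
          have := ih'.add (hp.const_mul (b (n + 1) / ((n + 1).factorial : ℂ)))
          rw [Finset.sum_range_succ]
          refine (HasDerivAt.congr_deriv (this.congr_of_eventuallyEq (Eventually.of_forall fun x => ?_)) ?_)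
          · simp only [Finset.sum_range_succ _ (n + 1)]
            rfl
          · rw [Nat.factorial_succ]
            have : (n : ℂ) + 1 ≠ 0 := by exact_mod_cast Nat.succ_ne_zero n
            have : (n.factorial : ℂ) ≠ 0 := by exact_mod_cast n.factorial_ne_zero
            push_cast
            field_simp
      obtain rfl | ⟨i, rfl⟩ : j = 0 ∨ ∃ i, j = i + 1 := by
        cases j with
        | zero => exact Or.inl rfl
        | succ i => exact Or.inr ⟨i, rfl⟩
      · have h1 := hu.tendsto_zero (by push_cast; omega)
        have h2 := ((hpoly n 0).continuousAt.tendsto).mono_left (nhdsWithin_le_nhds (s := Ioi 0))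
        have h3 := h1.add h2
        simp only [sub_add_cancel, zero_add] at h3
        rw [Finset.sum_range_succ'] at h3
        simpa [iteratedDeriv_zero] using h3
      · rw [iteratedDeriv_succ']
        refine ih (deriv u) (fun i => b (i + 1)) ?_ i (by omega)
        obtain ⟨U, hU, hu'⟩ := id hu
        have hd := hu.deriv
        refine (hd.mono (n := n) (by push_cast; omega)).congr fun r hr => ?_
        have hdu := (Reg.hasDerivAt hU hu' hr).add (hpoly n r)
        have hdu' := hdu.congr_of_eventuallyEq (f₁ := u) (Eventually.of_forall fun x => by
          simp only [Pi.add_apply]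
          ring)
        rw [(Reg.hasDerivAt hU hu' hr).deriv, hdu'.deriv]
        ring
  exact key 6 u b h

/-! ### Expansions at the origin -/

/-- The exponential function minus its Taylor polynomial is divisible by a power of the
variable. -/
theorem exists_exp_eq_sum_add (N : ℕ) (hN : 0 < N) : ∃ ρ : ℂ → ℂ, Differentiable ℂ ρ ∧
    ∀ w, Complex.exp w = ∑ n ∈ Finset.range N, w ^ n / (n.factorial : ℂ) + w ^ N * ρ w := by
  set f : ℂ → ℂ := fun w =>
    (Complex.exp w - ∑ n ∈ Finset.range N, w ^ n / (n.factorial : ℂ)) / w ^ N with hf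
  have hd : DifferentiableOn ℂ f (univ \ {0}) := by
    intro w hw
    have hw : w ≠ 0 := by simpa using hw
    have hs : DifferentiableAt ℂ
        (fun w : ℂ => ∑ n ∈ Finset.range N, w ^ n / (n.factorial : ℂ)) w := by
      fun_prop
    have hp : DifferentiableAt ℂ (fun w : ℂ => w ^ N) w := by fun_prop
    exact ((Complex.differentiableAt_exp.sub hs).div hp (pow_ne_zero N hw)).differentiableWithinAt
  -- The Taylor remainder estimate bounds the quotient by e on the punctured unit disc, so its
  -- singularity at 0 is removable.
  have hb : BddAbove (norm ∘ f '' (Metric.ball 0 1 \ {0})) := by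
    refine ⟨Real.exp 1, ?_⟩
    rintro _ ⟨w, ⟨hw1, hw0⟩, rfl⟩
    have hw0 : w ≠ 0 := by simpa using hw0
    have hw1 : ‖w‖ < 1 := by simpa using hw1
    have h1 := Complex.norm_exp_sub_sum_le_norm_mul_exp w N
    have hpos : 0 < ‖w‖ ^ N := pow_pos (norm_pos_iff.2 hw0) _
    simp only [Function.comp, hf, norm_div, norm_pow]
    rw [div_le_iff₀ hpos, mul_comm]
    exact h1.trans (mul_le_mul_of_nonneg_left (Real.exp_le_exp.2 hw1.le) hpos.le)
  have hball : Metric.ball (0 : ℂ) 1 ∈ 𝓝 0 := Metric.ball_mem_nhds _ one_pos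
  have h1 := Complex.differentiableOn_update_limUnder_of_bddAbove hball
    (hd.mono (sdiff_subset_sdiff_left (subset_univ _))) hb
  refine ⟨Function.update f 0 (limUnder (𝓝[≠] 0) f), fun w => ?_, fun w => ?_⟩
  · by_cases hw : w = 0
    · rw [hw]
      exact h1.differentiableAt hball
    · have hn : univ \ {0} ∈ 𝓝 w := (isOpen_univ.sdiff isClosed_singleton).mem_nhds (by simpa)
      refine (hd.differentiableAt hn).congr_of_eventuallyEq ?_
      filter_upwards [hn] with x hx
      rw [Function.update_of_ne (by simpa using hx)]
  · by_cases hw : w = 0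
    · obtain ⟨M, rfl⟩ : ∃ M, N = M + 1 := ⟨N - 1, by omega⟩
      rw [hw, Finset.sum_range_succ']
      simp
    · rw [Function.update_of_ne hw]
      have : w ^ N ≠ 0 := pow_ne_zero _ hw
      simp only [hf]
      field_simp
      ring

/-- The Taylor coefficients of `(w - 1) e^w` for `l = 1` and of `(w² - 3w + 3) e^w` for `l = 2`. -/
def phiCoeff (l n : ℕ) : ℂ :=
  (if l = 1 then (n : ℂ) - 1 else ((n : ℂ) - 1) * (n - 3)) / (n.factorial : ℂ)

/-- Ten terms are enough for every later use: the longest truncation needed has 2l + 5 ≤ 9 terms.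
The remainder is one entire function of ar. -/
theorem exists_psi_eq {l : ℕ} (hl : l = 1 ∨ l = 2) : ∃ χ : ℂ → ℂ, Differentiable ℂ χ ∧
    ∀ (a : ℂ) (r : ℝ), 0 < r → psi l a r = (r : ℂ) ^ (-l : ℤ) *
      (∑ n ∈ Finset.range 10, phiCoeff l n * (a * r) ^ n + (a * r) ^ 10 * χ (a * r)) := by
  obtain ⟨ρ, hρ, he⟩ := exists_exp_eq_sum_add 10 (by norm_num)
  rcases hl with rfl | rfl
  -- The constant is 1/9!: the factor w lifts the last retained term w⁹/9! to degree ten.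
  · refine ⟨fun w => 1 / 362880 + (w - 1) * ρ w, by fun_prop, fun a r hr => ?_⟩
    have hne : (r : ℂ) ≠ 0 := by exact_mod_cast hr.ne'
    rw [psi_one a hr, he]
    simp only [Finset.sum_range_succ, Finset.sum_range_zero, phiCoeff, Nat.factorial]
    simp
    field_simp
    ring
  -- Multiplying the degree-nine Taylor polynomial by w² - 3w + 3 leaves 1/8! - 3/9! at w¹⁰ and 1/9!
  -- at w¹¹.
  · refine ⟨fun w => (1 / 40320 - 3 / 362880) + w / 362880 + (w ^ 2 - 3 * w + 3) * ρ w,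
      by fun_prop, fun a r hr => ?_⟩
    have hne : (r : ℂ) ≠ 0 := by exact_mod_cast hr.ne'
    rw [psi_two a hr, he]
    simp only [Finset.sum_range_succ, Finset.sum_range_zero, phiCoeff, Nat.factorial]
    simp
    field_simp
    ring

theorem reg_psi_sub {l : ℕ} (hl : l = 1 ∨ l = 2) (a : ℂ) {N : ℕ} (hN : N ≤ 10) :
    Reg ((N : ℤ) - l) (fun r => psi l a r -
      ∑ n ∈ Finset.range N, phiCoeff l n * a ^ n * (r : ℂ) ^ ((n : ℤ) - l)) := by
  obtain ⟨χ, hχ, h⟩ := exists_psi_eq hl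
  have h10 : Reg ((10 : ℤ) - l) (fun r => psi l a r -
      ∑ n ∈ Finset.range 10, phiCoeff l n * a ^ n * (r : ℂ) ^ ((n : ℤ) - l)) := by
    have hχ' : ContDiff ℝ ∞ χ := hχ.contDiff.restrict_scalars ℝ
    refine ⟨fun r => a ^ 10 * χ (a * r), contDiff_const.mul
      (hχ'.comp (contDiff_const.mul contDiff_ofReal_complex)), fun r hr => ?_⟩
    have hne : (r : ℂ) ≠ 0 := by exact_mod_cast hr.ne'
    simp only [h a r hr, mul_add, Finset.mul_sum, zpow_sub₀ hne (10 : ℤ)]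
    have : ∀ n : ℕ, phiCoeff l n * a ^ n * (r : ℂ) ^ ((n : ℤ) - l) =
        (r : ℂ) ^ (-l : ℤ) * (phiCoeff l n * (a * r) ^ n) := by
      intro n
      rw [zpow_sub₀ hne, zpow_neg, zpow_natCast, zpow_natCast]
      ring
    simp only [this, zpow_neg, zpow_natCast]
    norm_cast
    push_cast
    ring
  have hrest : Reg ((N : ℤ) - l) (fun r =>
      ∑ n ∈ Finset.Ico N 10, phiCoeff l n * a ^ n * (r : ℂ) ^ ((n : ℤ) - l)) := by
    refine Reg.sum fun n hn => ((Reg.zpow _).mono ?_).const_mul _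
    have := (Finset.mem_Ico.1 hn).1
    omega
  refine ((h10.mono (n := N - l) (by omega)).add hrest).congr fun r _ => ?_
  rw [← Finset.sum_range_add_sum_Ico _ hN]
  ring

end RadialCube

end

noncomputable section

namespace RadialCube

/-! ### Boundary conditions for linear combinations of exponential solutions -/

/-- The linear combination `∑ x_i D_l e^{b_i r}`. -/
def lin {n : ℕ} (l : ℕ) (x b : Fin n → ℂ) : ℝ → ℂ := fun r => ∑ i, x i * psi l (b i) r

/-- The moments `∑ x_i b_i^m`. -/
def moment {n : ℕ} (x b : Fin n → ℂ) (m : ℕ) : ℂ := ∑ i, x i * b i ^ m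

theorem reg_lin_sub {n l : ℕ} (hl : l = 1 ∨ l = 2) (x b : Fin n → ℂ) {N : ℕ} (hN : N ≤ 10) :
    Reg ((N : ℤ) - l) (fun r => lin l x b r -
      ∑ m ∈ Finset.range N, phiCoeff l m * moment x b m * (r : ℂ) ^ ((m : ℤ) - l)) := by
  refine (Reg.sum (s := Finset.univ) fun i _ =>
    (reg_psi_sub hl (b i) hN).const_mul (x i)).congr fun r _ => ?_
  simp only [lin, moment, mul_sub, Finset.sum_sub_distrib, Finset.mul_sum, Finset.sum_mul]
  rw [Finset.sum_comm (s := Finset.univ)]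
  congr 1
  refine Finset.sum_congr rfl fun m _ => Finset.sum_congr rfl fun i _ => ?_
  ring

/-- As `phiCoeff l 1 = 0`, the only negative power in the expansion is r^{-l}, and its coefficient
is a multiple of the zeroth moment. -/
theorem reg_zero_lin {n l : ℕ} (hl : l = 1 ∨ l = 2) {x b : Fin n → ℂ} (h0 : moment x b 0 = 0) :
    Reg 0 (lin l x b) := by
  have h := reg_lin_sub hl x b (N := l) (by omega)
  rw [sub_self] at h
  refine h.congr fun r _ => ?_
  rcases hl with rfl | rfl
  · simp [h0]
  · simp [Finset.sum_range_succ, h0, phiCoeff]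

theorem hasBoundaryValues_lin {n l : ℕ} (hl : l = 1 ∨ l = 2) {x b : Fin n → ℂ}
    (h0 : moment x b 0 = 0) :
    HasBoundaryValues (lin l x b)
      (fun j => (j.factorial : ℂ) * (phiCoeff l (j + l) * moment x b (j + l))) := by
  apply hasBoundaryValues_of_expansion
  have h := reg_lin_sub hl x b (N := 6 + l) (by omega)
  have h6 : ((6 + l : ℕ) : ℤ) - l = 6 := by push_cast; ring
  rw [h6] at h
  refine h.congr fun r _ => ?_
  congr 1
  have hf : ∀ i : ℕ, (i.factorial : ℂ) ≠ 0 := fun i => by exact_mod_cast i.factorial_ne_zero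
  have e : ∀ i : ℕ, (i.factorial : ℂ) * (phiCoeff l (i + l) * moment x b (i + l)) /
      (i.factorial : ℂ) * (r : ℂ) ^ i =
      phiCoeff l (i + l) * moment x b (i + l) * (r : ℂ) ^ (((i + l : ℕ) : ℤ) - l) := by
    intro i
    have hfi := hf i
    have : (((i + l : ℕ) : ℤ) - l) = i := by push_cast; ring
    rw [this, zpow_natCast]
    field_simp
  simp only [e]
  rw [add_comm 6 l, Finset.sum_range_add]
  simp only [add_comm l]
  rw [right_eq_add]
  rcases hl with rfl | rfl
  · simp [h0]
  · simp [Finset.sum_range_succ, h0, phiCoeff]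

/-- Multiply by r^l: a finite limit of the function forces the limit 0, whereas the expansion gives
the zeroth moment times the nonzero number `phiCoeff l 0`. -/
theorem moment_zero_of_tendsto {n l : ℕ} (hl : l = 1 ∨ l = 2) {x b : Fin n → ℂ} {c : ℂ}
    (h : Tendsto (lin l x b) (𝓝[>] (0 : ℝ)) (𝓝 c)) : moment x b 0 = 0 := by
  obtain ⟨U, hU, hr⟩ := reg_lin_sub hl x b (N := 1) (by norm_num)
  have hx : Tendsto (fun r : ℝ => (r : ℂ)) (𝓝[>] (0 : ℝ)) (𝓝 0) := by
    have := (Complex.continuous_ofReal.tendsto 0).mono_left (nhdsWithin_le_nhds (s := Ioi 0))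
    simpa using this
  have h1 : Tendsto (fun r : ℝ => (r : ℂ) ^ l * lin l x b r - r * U r) (𝓝[>] (0 : ℝ)) (𝓝 0) := by
    have hU' := (hU.continuous.tendsto 0).mono_left (nhdsWithin_le_nhds (s := Ioi 0))
    have := ((hx.pow l).mul h).sub (hx.mul hU')
    have hl0 : l ≠ 0 := by omega
    simpa [hl0] using this
  have h2 : Tendsto (fun r : ℝ => (r : ℂ) ^ l * lin l x b r - r * U r) (𝓝[>] (0 : ℝ))
      (𝓝 (phiCoeff l 0 * moment x b 0)) := by
    refine tendsto_const_nhds.congr' ?_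
    filter_upwards [self_mem_nhdsWithin] with r hr0
    have hne : (r : ℂ) ≠ 0 := by exact_mod_cast (ne_of_gt hr0)
    have := hr r hr0
    simp only [Finset.sum_range_one, Nat.cast_one, zpow_natCast, zpow_sub₀ hne, zpow_one] at this
    field_simp at this
    linear_combination -this
  have := tendsto_nhds_unique h1 h2
  have hphi : phiCoeff l 0 ≠ 0 := by
    rcases hl with rfl | rfl <;> simp [phiCoeff]
  exact (mul_eq_zero.1 this.symm).resolve_left hphi

theorem BoundaryRel.congr {l ξ : ℕ} {κ : ℝ} {b c : ℕ → ℂ} (h : ∀ j < 6, b j = c j)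
    (hb : BoundaryRel l ξ κ b) : BoundaryRel l ξ κ c := by
  unfold BoundaryRel at *
  rw [← h 0, ← h 1, ← h 2, ← h 3, ← h 4, ← h 5] <;> norm_num
  exact hb

/-- The boundary conditions as relations between moments. -/
def MomentRel (l ξ : ℕ) (κ : ℝ) (M : ℕ → ℂ) : Prop :=
  M 0 = 0 ∧ if ξ = 1 then M 2 = 0 ∧ param l ξ κ * M (l + 2) = M (l + 3)
    else if l = 1 then M 5 = 0 ∧ param l ξ κ * M 3 = M 4
    else M 5 = 0 ∧ M 6 = 0 ∧ param l ξ κ * M 2 = M 7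

/-- In each of the four cases exactly one boundary condition is automatic, because `phiCoeff`
vanishes at the index concerned (1 for l = 1, 3 for l = 2). The constants 8/9, 5/8 and -7/8 in
`param` are ratios of the factors j! · `phiCoeff l (j + l)` in the condition containing κ. -/
theorem boundaryRel_moment_iff {l ξ : ℕ} (hl : l = 1 ∨ l = 2) (hξ : ξ = 1 ∨ ξ = 2) (κ : ℝ)
    {M : ℕ → ℂ} (h0 : M 0 = 0) :
    BoundaryRel l ξ κ (fun j => (j.factorial : ℂ) * (phiCoeff l (j + l) * M (j + l))) ↔
      MomentRel l ξ κ M := by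
  rcases hl with rfl | rfl <;> rcases hξ with rfl | rfl <;>
    simp [BoundaryRel, MomentRel, h0, phiCoeff, param, Nat.factorial] <;> norm_num
  · intro _
    exact ⟨fun h => by linear_combination (4 / 3 : ℂ) * h, fun h => by linear_combination (3 / 4 : ℂ) * h⟩
  · intro _
    exact ⟨fun h => by linear_combination (4 / 3 : ℂ) * h, fun h => by linear_combination (3 / 4 : ℂ) * h⟩
  · intro _
    exact ⟨fun h => by linear_combination (5 / 2 : ℂ) * h, fun h => by linear_combination (2 / 5 : ℂ) * h⟩
  · intro _ _
    exact ⟨fun h => by linear_combination (7 / 4 : ℂ) * h, fun h => by linear_combination (4 / 7 : ℂ) * h⟩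

theorem satisfiesBC_lin_iff {n l ξ : ℕ} (hl : l = 1 ∨ l = 2) (hξ : ξ = 1 ∨ ξ = 2) (κ : ℝ)
    (x b : Fin n → ℂ) :
    SatisfiesBC l ξ κ (lin l x b) ↔ MomentRel l ξ κ (moment x b) := by
  constructor
  · rintro ⟨c, hc, hrel⟩
    have h0 := moment_zero_of_tendsto hl (by simpa using hc 0 (by norm_num))
    refine (boundaryRel_moment_iff hl hξ κ h0).1 (hrel.congr fun j hj => ?_)
    exact tendsto_nhds_unique (hc j hj) (hasBoundaryValues_lin hl h0 j hj)
  · intro h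
    exact ⟨_, hasBoundaryValues_lin hl h.1, (boundaryRel_moment_iff hl hξ κ h.1).2 h⟩

/-! ### The sixth roots of unity -/

theorem phase_add (s t : ℝ) : phase (s + t) = phase s * phase t := by
  rw [phase, phase, phase, ← Complex.exp_add]
  push_cast
  ring_nf

theorem phase_eq (t : ℝ) : phase t = Complex.exp ((π * t : ℝ) * Complex.I) := by
  rw [phase]
  push_cast
  ring_nf

theorem phase_half : phase (1 / 2) = Complex.I := by
  rw [phase_eq, show π * (1 / 2) = π / 2 by ring]
  push_cast
  exact Complex.exp_pi_div_two_mul_I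

theorem phase_zero : phase 0 = 1 := by simp [phase]

/-- With w = e^{iπ/3}, every phase in the statement is a polynomial in i and w. The coefficient
identities become polynomial identities modulo w² = w - 1 and i² = -1. -/
theorem phase_one_third_sq : phase (1 / 3) ^ 2 = phase (1 / 3) - 1 := by
  rw [phase_eq, Complex.exp_mul_I, ← Complex.ofReal_cos, ← Complex.ofReal_sin,
    show π * (1 / 3) = π / 3 by ring, Real.cos_pi_div_three, Real.sin_pi_div_three]
  have h3 : ((√3 : ℝ) : ℂ) ^ 2 = 3 := by
    rw [← Complex.ofReal_pow, Real.sq_sqrt (by norm_num)]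
    norm_num
  push_cast
  linear_combination (1 / 4 : ℂ) * Complex.I ^ 2 * h3 + (3 / 4 : ℂ) * Complex.I_sq

theorem phase_two_thirds : phase (2 / 3) = phase (1 / 3) - 1 := by
  rw [← phase_one_third_sq, sq, ← phase_add]
  norm_num

theorem phase_neg_one_third : phase (-1 / 3) = 1 - phase (1 / 3) := by
  have h : phase (1 / 3) * phase (-1 / 3) = 1 := by
    rw [← phase_add, ← phase_zero]
    norm_num
  linear_combination (1 - phase (1 / 3)) * h + phase (-1 / 3) * phase_one_third_sq

theorem phase_one_sixth : phase (1 / 6) = Complex.I * (1 - phase (1 / 3)) := by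
  rw [← phase_neg_one_third, ← phase_half, ← phase_add]
  norm_num

theorem phase_five_sixths : phase (5 / 6) = Complex.I * phase (1 / 3) := by
  rw [← phase_half, ← phase_add]
  norm_num

theorem phase_seven_sixths : phase (7 / 6) = Complex.I * (phase (1 / 3) - 1) := by
  rw [← phase_two_thirds, ← phase_half, ← phase_add]
  norm_num

theorem phase_neg_one_sixth : phase (-1 / 6) = -Complex.I * phase (1 / 3) := by
  have h : phase (1 / 3) ^ 2 * phase (1 / 2) * phase (-1 / 6) = phase (1 / 3) ^ 3 := by
    rw [sq, pow_three, ← phase_add, ← phase_add, ← phase_add, ← phase_add]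
    norm_num
  rw [phase_half] at h
  have h2 := phase_one_third_sq
  generalize phase (1 / 3) = w at *
  generalize phase (-1 / 6) = y at *
  have hI := Complex.I_sq
  generalize Complex.I = i at *
  grind

theorem phase_four_thirds : phase (4 / 3) = -phase (1 / 3) := by
  have h : phase (4 / 3) = phase (2 / 3) * phase (2 / 3) := by
    rw [← phase_add]
    norm_num
  rw [h, phase_two_thirds]
  linear_combination phase_one_third_sq

/-- The exponents `a_k = i e^{iπk/3} z` of the decaying solutions. -/
def expo (z : ℂ) (k : Fin 3) : ℂ := Complex.I * phase ((k : ℕ) / 3) * z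

theorem expo_zero (z : ℂ) : expo z 0 = Complex.I * z := by simp [expo, phase_zero]

theorem expo_one (z : ℂ) : expo z 1 = Complex.I * phase (1 / 3) * z := by simp [expo]

theorem expo_two (z : ℂ) : expo z 2 = Complex.I * (phase (1 / 3) - 1) * z := by
  rw [← phase_two_thirds]
  simp [expo]

theorem solG_eq (l : ℕ) (z : ℂ) (k : Fin 3) : solG l z k = psi l (expo z k) := rfl

theorem solD_eq (l : ℕ) (z : ℂ) (k : Fin 3) : solD l z k = psi l (-expo z k) := by
  simp only [solD, psi, expo, neg_mul]

theorem combo_eq_lin (l : ℕ) (z : ℂ) (k : Fin 3) (a b c : ℂ) :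
    combo l z k a b c =
      lin l ![1, a, b, c] ![-expo z k, expo z k, expo z (k + 1), expo z (k + 2)] := by
  funext r
  simp [combo, lin, solG_eq, solD_eq, Fin.sum_univ_four]

/-- The powers of a primitive sixth root of unity and of its square. -/
theorem sixth_root_powers {w : ℂ} (hw : w ^ 2 = w - 1) :
    (w ^ 3 = -1 ∧ w ^ 4 = -w ∧ w ^ 5 = 1 - w ∧ w ^ 6 = 1 ∧ w ^ 7 = w) ∧ (w - 1) ^ 2 = -w ∧
      (w - 1) ^ 3 = 1 ∧ (w - 1) ^ 4 = w - 1 ∧ (w - 1) ^ 5 = -w ∧ (w - 1) ^ 6 = 1 ∧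
      (w - 1) ^ 7 = w - 1 := by
  have h3 : w ^ 3 = -1 := by linear_combination (w + 1) * hw
  have g2 : (w - 1) ^ 2 = -w := by linear_combination hw
  have g3 : (w - 1) ^ 3 = 1 := by linear_combination (w - 2) * hw
  refine ⟨⟨h3, ?_, ?_, ?_, ?_⟩, g2, g3, ?_, ?_, ?_, ?_⟩
  · linear_combination w * h3
  · linear_combination w ^ 2 * h3 - hw
  · linear_combination (w ^ 3 - 1) * h3
  · linear_combination w * (w ^ 3 - 1) * h3
  · linear_combination (w - 1) * g3
  · linear_combination (w - 1) ^ 2 * g3 + g2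
  · linear_combination ((w - 1) ^ 3 + 1) * g3
  · linear_combination (w - 1) * ((w - 1) ^ 3 + 1) * g3

set_option maxHeartbeats 1000000 in
-- The moment equations for the weights (1, α_k, β_k, γ_k) at the exponents (-a_k, a_k, a_{k+1},
-- a_{k+2}) become polynomial identities in z, c, i and w once p is cleared.
theorem satisfiesBC_solH {l ξ : ℕ} (hl : l = 1 ∨ l = 2) (hξ : ξ = 1 ∨ ξ = 2) {κ : ℝ} {z : ℂ}
    (hp : denom l ξ κ z ≠ 0) (k : Fin 3) : SatisfiesBC l ξ κ (solH l ξ κ z k) := by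
  rw [solH, combo_eq_lin, satisfiesBC_lin_iff hl hξ]
  have hw := phase_one_third_sq
  obtain ⟨⟨w3, w4, w5, w6, w7⟩, v2, v3, v4, v5, v6, v7⟩ := sixth_root_powers hw
  have hI := Complex.I_sq
  have hI5 : Complex.I ^ 5 = Complex.I := by
    linear_combination Complex.I * (Complex.I ^ 2 - 1) * hI
  unfold coefA coefB coefC
  rcases hl with rfl | rfl <;> rcases hξ with rfl | rfl <;> fin_cases k <;>
    simp [MomentRel, moment, Fin.sum_univ_four, expo_zero, expo_one, expo_two,
      phase_five_sixths, phase_seven_sixths, phase_neg_one_sixth, phase_two_thirds] <;>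
    field_simp <;> simp only [denom, phase_one_sixth, phase_five_sixths] <;> norm_num <;>
    generalize Complex.I = i at * <;> generalize phase (1/3) = w at * <;>
    generalize param _ _ κ = c at *  <;>
    simp only [w3, w4, w5, w6, w7, v2, v3, v4, v5, v6, v7, hI5]
  all_goals exact ⟨by grind, Or.inr (by grind), by grind⟩

theorem expo_ne_zero {z : ℂ} (hz : z ≠ 0) (k : Fin 3) : expo z k ≠ 0 :=
  mul_ne_zero (mul_ne_zero Complex.I_ne_zero (Complex.exp_ne_zero _)) hz

set_option maxHeartbeats 1000000 in
-- Elimination: the vanishing of the zeroth moment and of the second or fifth one makes y_1 and y_2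
-- multiples of y_0. The equation containing c then reduces to a power of z times p times y_0 being
-- zero, so p is essentially the determinant of the system.
theorem eq_zero_of_momentRel {l ξ : ℕ} (hl : l = 1 ∨ l = 2) (hξ : ξ = 1 ∨ ξ = 2) {κ : ℝ} {z : ℂ}
    (hz : z ≠ 0) (hp : denom l ξ κ z ≠ 0) {y : Fin 3 → ℂ}
    (h : MomentRel l ξ κ (moment y (expo z))) : y = 0 := by
  have hw := phase_one_third_sq
  obtain ⟨⟨w3, w4, w5, w6, w7⟩, v2, v3, v4, v5, v6, v7⟩ := sixth_root_powers hw
  have hI := Complex.I_sq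
  have hI5 : Complex.I ^ 5 = Complex.I := by
    linear_combination Complex.I * (Complex.I ^ 2 - 1) * hI
  suffices hy : y 0 = 0 ∧ y 1 = 0 ∧ y 2 = 0 by
    funext k
    fin_cases k
    · exact hy.1
    · exact hy.2.1
    · exact hy.2.2
  rcases hl with rfl | rfl <;> rcases hξ with rfl | rfl <;>
    simp [MomentRel, moment, Fin.sum_univ_three, expo_zero, expo_one, expo_two] at h <;>
    simp only [denom, phase_one_sixth, phase_five_sixths] at hp <;> norm_num at hp <;>
    simp only [mul_pow] at h <;> norm_num at h <;>
    generalize Complex.I = i at * <;> generalize phase (1/3) = w at * <;>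
    generalize param _ _ κ = c at *  <;> generalize y 0 = y0 at * <;>
    generalize y 1 = y1 at * <;> generalize y 2 = y2 at * <;>
    simp only [w3, w4, w5, w6, w7, v2, v3, v4, v5, v6, v7, hI5] at h
  · obtain ⟨h1, h2, h3⟩ := h
    have e2 : y0 + (w - 1) * y1 - w * y2 = 0 :=
      mul_left_cancel₀ (pow_ne_zero 2 hz) (by rw [hw] at h2; linear_combination -h2)
    have a1 : y1 = (w - 1) * y0 := by grind
    have a2 : y2 = -w * y0 := by grind
    have h0 : z ^ 3 * (3 * z + 2 * (i * (1 - w)) * c) * y0 = 0 := by grind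
    have h0 := (mul_eq_zero.1 h0).resolve_left (mul_ne_zero (pow_ne_zero 3 hz) hp)
    simp [a1, a2, h0]
  · obtain ⟨h1, h2, h3⟩ := h
    have e2 : y0 + (1 - w) * y1 - w * y2 = 0 :=
      mul_left_cancel₀ (pow_ne_zero 5 hz) (by linear_combination -i * h2 + (y0 + (1 - w) * y1 - w * y2) * z ^ 5 * hI)
    have a1 : y1 = -(1 + w) * y0 := by grind
    have a2 : y2 = w * y0 := by grind
    have h0 : z ^ 3 * (z + 2 * (i * (1 - w)) * c) * y0 = 0 := by grind
    have h0 := (mul_eq_zero.1 h0).resolve_left (mul_ne_zero (pow_ne_zero 3 hz) hp)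
    simp [a1, a2, h0]
  · obtain ⟨h1, h2, h3⟩ := h
    have e2 : y0 + (w - 1) * y1 - w * y2 = 0 :=
      mul_left_cancel₀ (pow_ne_zero 2 hz) (by rw [hw] at h2; linear_combination -h2)
    have a1 : y1 = (w - 1) * y0 := by grind
    have a2 : y2 = -w * y0 := by grind
    have h0 : z ^ 4 * (2 * z + 3 * (i * (1 - w)) * c) * y0 = 0 := by grind
    have h0 := (mul_eq_zero.1 h0).resolve_left (mul_ne_zero (pow_ne_zero 4 hz) hp)
    simp [a1, a2, h0]
  -- All exponents have the same sixth power, so the sixth-moment equation only repeats the zeroth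
  -- one.
  · obtain ⟨h1, h2, -, h3⟩ := h
    have e2 : y0 + (1 - w) * y1 - w * y2 = 0 :=
      mul_left_cancel₀ (pow_ne_zero 5 hz) (by linear_combination -i * h2 + (y0 + (1 - w) * y1 - w * y2) * z ^ 5 * hI)
    have a1 : y1 = -(1 + w) * y0 := by grind
    have a2 : y2 = w * y0 := by grind
    have h0 : z ^ 2 * (z ^ 5 + 2 * (i * w) * c) * y0 = 0 := by grind
    have h0 := (mul_eq_zero.1 h0).resolve_left (mul_ne_zero (pow_ne_zero 2 hz) hp)
    simp [a1, a2, h0]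

theorem satisfiesBC_add {l ξ : ℕ} {κ : ℝ} {u v : ℝ → ℂ} (hu : SatisfiesBC l ξ κ u)
    (hv : SatisfiesBC l ξ κ v) (hu5 : ContDiffOn ℝ 5 u (Ioi 0)) (hv5 : ContDiffOn ℝ 5 v (Ioi 0)) :
    SatisfiesBC l ξ κ (fun x => u x + v x) := by
  obtain ⟨b, hb, hr⟩ := hu
  obtain ⟨c, hc, hr'⟩ := hv
  refine ⟨_, hb.add hc hu5 hv5, ?_⟩
  unfold BoundaryRel at *
  split_ifs at * <;> simp_all [mul_add]

theorem satisfiesBC_const_mul {l ξ : ℕ} {κ : ℝ} (c : ℂ) {u : ℝ → ℂ} (hu : SatisfiesBC l ξ κ u) :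
    SatisfiesBC l ξ κ (fun x => c * u x) := by
  obtain ⟨b, hb, hr⟩ := hu
  refine ⟨fun j => c * b j, fun j hj => ?_, ?_⟩
  · have hd : iteratedDeriv j (fun x => c * u x) = fun x => c * iteratedDeriv j u x := by
      funext x
      simp
    rw [hd]
    exact (hb j hj).const_mul c
  · unfold BoundaryRel at *
    split_ifs at * <;> simp_all [mul_left_comm]

theorem satisfiesBC_congr {l ξ : ℕ} {κ : ℝ} {u v : ℝ → ℂ} (hu : SatisfiesBC l ξ κ u)
    (h : u =ᶠ[𝓝[>] (0 : ℝ)] v) : SatisfiesBC l ξ κ v := by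
  obtain ⟨b, hb, hr⟩ := hu
  refine ⟨b, fun j hj => (hb j hj).congr' ?_, hr⟩
  obtain ⟨ε, hε, hεs⟩ := mem_nhdsGT_iff_exists_Ioo_subset.1 h
  filter_upwards [Ioo_mem_nhdsGT hε] with r hr
  have : u =ᶠ[𝓝 r] v := by
    filter_upwards [Ioo_mem_nhds hr.1 hr.2] with x hx using hεs hx
  exact this.iteratedDeriv_eq j

theorem contDiffOn_lin {n l : ℕ} (hl : l = 1 ∨ l = 2) (x b : Fin n → ℂ) {m : ℕ∞} :
    ContDiffOn ℝ m (lin l x b) (Ioi 0) := fun _ hr =>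
  (ContDiffAt.sum fun i _ => contDiffAt_const.mul (contDiffAt_psi hl (b i) hr)).contDiffWithinAt

/-- Two combinations with the same d_k differ by a combination of the g_j alone. If both obey the
boundary conditions, nondegeneracy makes the difference trivial. -/
theorem satisfiesBC_combo_iff {l ξ : ℕ} (hl : l = 1 ∨ l = 2) (hξ : ξ = 1 ∨ ξ = 2) {κ : ℝ} {z : ℂ}
    (hz : z ≠ 0) (hp : denom l ξ κ z ≠ 0) (k : Fin 3) (a b c : ℂ) :
    SatisfiesBC l ξ κ (combo l z k a b c) ↔
      a = coefA l ξ κ z k ∧ b = coefB l ξ κ z k ∧ c = coefC l ξ κ z k := by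
  refine ⟨fun h => ?_, ?_⟩
  · have hH := satisfiesBC_solH hl hξ hp k
    have h5 : ∀ a b c, ContDiffOn ℝ 5 (combo l z k a b c) (Ioi 0) := fun a b c => by
      rw [combo_eq_lin]
      exact contDiffOn_lin (m := 5) hl _ _
    have hd := satisfiesBC_add h (satisfiesBC_const_mul (-1) hH) (h5 a b c)
      (contDiffOn_const.mul (h5 _ _ _))
    set y : Fin 3 → ℂ := fun j => if j = k then a - coefA l ξ κ z k else
      if j = k + 1 then b - coefB l ξ κ z k else c - coefC l ξ κ z k with hy
    have hlin : (fun x => combo l z k a b c x + -1 * solH l ξ κ z k x) = lin l y (expo z) := by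
      funext r
      simp only [solH, combo, lin, hy, solG_eq, Fin.sum_univ_three]
      fin_cases k <;> simp <;> ring
    rw [hlin, satisfiesBC_lin_iff hl hξ] at hd
    have h0 := eq_zero_of_momentRel hl hξ hz hp hd
    have h1 := congrFun h0 k
    have h2 := congrFun h0 (k + 1)
    have h3 := congrFun h0 (k + 2)
    simp only [hy] at h1 h2 h3
    refine ⟨?_, ?_, ?_⟩
    · simpa [sub_eq_zero] using h1
    · simpa [sub_eq_zero] using h2
    · fin_cases k <;> simpa [sub_eq_zero] using h3
  · rintro ⟨rfl, rfl, rfl⟩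
    exact satisfiesBC_solH hl hξ hp k

/-! ### Algebra of the kernel coefficients -/

/-- The coefficient `e^{2πik/3} / (3 z⁴ W_k)` of the kernel. -/
def kerCoeff (l : ℕ) (z : ℂ) (k : Fin 3) : ℂ :=
  phase (2 * (k : ℕ) / 3) / (3 * z ^ 4 * wron l z k)

/-- The matrix of the coefficients of `h_k` with respect to the `g_j`. -/
def coefMat (l ξ : ℕ) (κ : ℝ) (z : ℂ) (k j : Fin 3) : ℂ :=
  if j = k then coefA l ξ κ z k else if j = k + 1 then coefB l ξ κ z k else coefC l ξ κ z k

theorem wron_eq {l : ℕ} (hl : l = 1 ∨ l = 2) (z : ℂ) (k : Fin 3) :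
    wron l z k = 2 * (-1) ^ (l + 1) * expo z k ^ (2 * l + 1) := by
  have hw := phase_one_third_sq
  obtain ⟨⟨w3, w4, w5, w6, w7⟩, v2, v3, v4, v5, v6, v7⟩ := sixth_root_powers hw
  have hI := Complex.I_sq
  have hI5 : Complex.I ^ 5 = Complex.I := by
    linear_combination Complex.I * (Complex.I ^ 2 - 1) * hI
  rcases hl with rfl | rfl <;> fin_cases k <;>
    simp [wron, expo_zero, expo_one, expo_two, mul_pow] <;> norm_num [phase_two_thirds] at * <;>
    grind

theorem solH_eq (l ξ : ℕ) (κ : ℝ) (z : ℂ) (k : Fin 3) (r : ℝ) :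
    solH l ξ κ z k r = psi l (-expo z k) r + ∑ j, coefMat l ξ κ z k j * psi l (expo z j) r := by
  simp only [solH, combo, coefMat, solG_eq, solD_eq, Fin.sum_univ_three]
  fin_cases k <;> simp <;> ring

/-- By the choice of weights, c_k W_k = 1/(3a_k⁴) = 1/(3λ_k²) with λ_k = -a_k², the residue of 1/(λ³
- z⁶) at λ_k. The three sums are those of the residues against 1, -λ and λ². -/
theorem kerCoeff_sum {l : ℕ} (hl : l = 1 ∨ l = 2) {z : ℂ} (hz : z ≠ 0) :
    ∑ k, kerCoeff l z k * (2 * (-1) ^ (l + 1) * expo z k ^ (2 * l + 1)) = 0 ∧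
    ∑ k, kerCoeff l z k * (2 * (-1) ^ (l + 1) * expo z k ^ (2 * l + 1)) * expo z k ^ 2 = 0 ∧
    ∑ k, kerCoeff l z k * (2 * (-1) ^ (l + 1) * expo z k ^ (2 * l + 1)) * expo z k ^ 4 = 1 := by
  have hw := phase_one_third_sq
  have hne : ∀ k, 2 * (-1) ^ (l + 1) * expo z k ^ (2 * l + 1) ≠ 0 := fun k =>
    mul_ne_zero (by simp) (pow_ne_zero _ (expo_ne_zero hz k))
  have e : ∀ k, kerCoeff l z k * (2 * (-1) ^ (l + 1) * expo z k ^ (2 * l + 1)) =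
      phase (2 * (k : ℕ) / 3) / (3 * z ^ 4) := fun k => by
    rw [kerCoeff, wron_eq hl, ← div_div, div_mul_cancel₀ _ (hne k)]
  simp only [e, Fin.sum_univ_three, expo_zero, expo_one, expo_two]
  have p2 : phase (2 * 2 / 3) = -phase (1 / 3) := by
    rw [← phase_four_thirds]
    norm_num
  have hI := Complex.I_sq
  norm_num [phase_zero, phase_two_thirds, p2] at hw ⊢
  rw [show (4 : ℝ) / 3 = 2 * 2 / 3 by norm_num, p2]
  norm_num
  generalize Complex.I = i at *
  generalize phase (1 / 3) = w at *
  refine ⟨?_, ?_, ?_⟩ <;> field_simp <;> grind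

/-- This is the zeroth-moment equation for h_k: the r^{-l} singularities of d_k and of the g_j
cancel. -/
theorem coefMat_sum {l ξ : ℕ} (hl : l = 1 ∨ l = 2) (hξ : ξ = 1 ∨ ξ = 2) {κ : ℝ} {z : ℂ}
    (hp : denom l ξ κ z ≠ 0) (k : Fin 3) : 1 + ∑ j, coefMat l ξ κ z k j = 0 := by
  have h := satisfiesBC_solH hl hξ hp k
  rw [solH, combo_eq_lin, satisfiesBC_lin_iff hl hξ] at h
  have h0 := h.1
  simp [moment, Fin.sum_univ_four] at h0
  rw [← h0, Fin.sum_univ_three]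
  fin_cases k <;> simp [coefMat] <;> ring

theorem kerCoeff_eq {l : ℕ} (hl : l = 1 ∨ l = 2) (z : ℂ) (k : Fin 3) :
    kerCoeff l z k = (if l = 1 then ![1, 1 - phase (1 / 3), -phase (1 / 3)] else ![1, -1, 1]) k *
      (-6 * Complex.I * z ^ (2 * l + 5))⁻¹ := by
  have hI0 := Complex.I_ne_zero
  have hw0 : phase (1 / 3) ≠ 0 := Complex.exp_ne_zero _
  have hw1 : phase (1 / 3) - 1 ≠ 0 := by
    rw [← phase_two_thirds]
    exact Complex.exp_ne_zero _
  have e : phase (2 * (k : ℕ) / 3) = ![1, phase (1 / 3) - 1, -phase (1 / 3)] k := by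
    rw [← phase_two_thirds, ← phase_four_thirds, ← phase_zero]
    fin_cases k <;> norm_num
  rw [kerCoeff, e]
  -- At z = 0 both sides vanish by the convention for division by zero.
  by_cases hz : z = 0
  · simp [hz]
  rcases hl with rfl | rfl
  · fin_cases k <;> simp [wron] <;> field_simp <;> grind [Complex.I_sq]
  · simp only [wron, phase_two_thirds]
    generalize phase (1 / 3) = w at *
    fin_cases k <;> simp <;> field_simp <;> norm_num

set_option maxHeartbeats 1000000 in
theorem kerCoeff_mul_coefMat {l ξ : ℕ} (hl : l = 1 ∨ l = 2) (hξ : ξ = 1 ∨ ξ = 2) (κ : ℝ) (z : ℂ)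
    (k j : Fin 3) :
    kerCoeff l z k * coefMat l ξ κ z k j = kerCoeff l z j * coefMat l ξ κ z j k := by
  have hw := phase_one_third_sq
  -- Modulo 3 one has (k + 1) + 2 = k, so γ_{k+1} is the entry opposite to β_k; the three instances
  -- cover all off-diagonal pairs.
  have key : ∀ k : Fin 3, kerCoeff l z k * coefB l ξ κ z k =
      kerCoeff l z (k + 1) * coefC l ξ κ z (k + 1) := by
    intro k
    simp only [kerCoeff_eq hl, coefB, coefC, phase_one_sixth,
        phase_five_sixths, phase_seven_sixths, phase_neg_one_sixth, phase_two_thirds]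
    generalize (-6 * Complex.I * z ^ (2 * l + 5))⁻¹ = C
    generalize (denom l ξ κ z) = p
    generalize Complex.I = i at *
    generalize phase (1/3) = w at *
    generalize param _ _ κ = c at *
    rcases hl with rfl | rfl <;> rcases hξ with rfl | rfl <;> fin_cases k <;> simp <;> grind
  have k0 := key 0
  have k1 := key 1
  have k2 := key 2
  fin_cases k <;> fin_cases j <;> simp [coefMat] at k0 k1 k2 ⊢ <;> simp [k0, k1, k2]

end RadialCube

end

noncomputable section

namespace RadialCube

/-! ### Kernels built from exponential solutions -/

/-- The data of a resolvent kernel `∑ c_k h_k(r) g_k(s)`, where `g_k = D_l e^{a_k r}` and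
`h_k = D_l e^{-a_k r} + ∑ m_{kj} g_j`. -/
structure KernelData (l : ℕ) where
  hl : l = 1 ∨ l = 2
  a : Fin 3 → ℂ
  cc : Fin 3 → ℂ
  mu : Fin 3 → Fin 3 → ℂ
  E : ℂ
  re_neg : ∀ k, (a k).re < 0
  pow_six : ∀ k, -a k ^ 6 = E
  -- The three sums carry the partial-fraction identities and fix the jumps on the diagonal. The
  -- field `symm` removes the products of two decaying solutions from these jumps, and `row` makes
  -- the h_k regular at the origin.
  sum_zero : ∑ k, cc k * (2 * (-1) ^ (l + 1) * a k ^ (2 * l + 1)) = 0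
  sum_two : ∑ k, cc k * (2 * (-1) ^ (l + 1) * a k ^ (2 * l + 1)) * a k ^ 2 = 0
  sum_four : ∑ k, cc k * (2 * (-1) ^ (l + 1) * a k ^ (2 * l + 1)) * a k ^ 4 = 1
  symm : ∀ k j, cc k * mu k j = cc j * mu j k
  row : ∀ k, 1 + ∑ j, mu k j = 0

namespace KernelData

variable {l : ℕ} (D : KernelData l)

/-- The decaying solutions. -/
def g (k : Fin 3) : ℝ → ℂ := psi l (D.a k)

/-- The growing solutions. -/
def d (k : Fin 3) : ℝ → ℂ := psi l (-D.a k)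

/-- The solutions that are regular at the origin. -/
def h (k : Fin 3) : ℝ → ℂ := fun r => D.d k r + ∑ j, D.mu k j * D.g j r

theorem exists_eps : ∃ ε : ℝ, 0 < ε ∧ ∀ k, (D.a k).re ≤ -ε := by
  refine ⟨min (-(D.a 0).re) (min (-(D.a 1).re) (-(D.a 2).re)), ?_, fun k => ?_⟩
  · simp [D.re_neg]
  · have h0 := min_le_left (-(D.a 0).re) (min (-(D.a 1).re) (-(D.a 2).re))
    have h1 := (min_le_right (-(D.a 0).re) (min (-(D.a 1).re) (-(D.a 2).re)))
    have h2 := min_le_left (-(D.a 1).re) (-(D.a 2).re)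
    have h3 := min_le_right (-(D.a 1).re) (-(D.a 2).re)
    have : ∀ k, min (-(D.a 0).re) (min (-(D.a 1).re) (-(D.a 2).re)) ≤ -(D.a k).re := by
      rw [Fin.forall_fin_succ, Fin.forall_fin_two]
      exact ⟨h0, h1.trans h2, h1.trans h3⟩
    linarith [this k]

theorem contDiffAt_g (k : Fin 3) {r : ℝ} (hr : 0 < r) {n : ℕ∞} : ContDiffAt ℝ n (D.g k) r :=
  contDiffAt_psi D.hl _ hr

theorem contDiffAt_d (k : Fin 3) {r : ℝ} (hr : 0 < r) {n : ℕ∞} : ContDiffAt ℝ n (D.d k) r :=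
  contDiffAt_psi D.hl _ hr

theorem contDiffAt_h (k : Fin 3) {r : ℝ} (hr : 0 < r) {n : ℕ∞} : ContDiffAt ℝ n (D.h k) r :=
  (D.contDiffAt_d k hr).add
    (ContDiffAt.sum fun j _ => contDiffAt_const.mul (D.contDiffAt_g j hr))

end KernelData

theorem iteratedDeriv_sum_const_mul {ι : Type*} (s : Finset ι) (c : ι → ℂ) (f : ι → ℝ → ℂ) (j : ℕ)
    {r : ℝ} (hf : ∀ i ∈ s, ContDiffAt ℝ j (f i) r) :
    iteratedDeriv j (fun x => ∑ i ∈ s, c i * f i x) r = ∑ i ∈ s, c i * iteratedDeriv j (f i) r := by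
  rw [iteratedDeriv_fun_sum fun i hi => contDiffAt_const.mul (hf i hi)]
  simp

theorem Reg.contDiffAt {m : ℤ} {u : ℝ → ℂ} (h : Reg m u) {r : ℝ} (hr : 0 < r) {n : ℕ∞} :
    ContDiffAt ℝ n u r := by
  obtain ⟨U, hU, h⟩ := h
  have hne : (r : ℂ) ≠ 0 := by exact_mod_cast hr.ne'
  have hev : u =ᶠ[𝓝 r] fun x : ℝ => (x : ℂ) ^ m * U x := by
    filter_upwards [eventually_gt_nhds hr] with x hx using h x hx
  refine ContDiffAt.congr_of_eventuallyEq ?_ hev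
  have hz : ContDiffAt ℝ n (fun x : ℝ => (x : ℂ) ^ m) r := by
    have hx : ContDiffAt ℝ n (fun x : ℝ => (x : ℂ)) r := contDiff_ofReal_complex.contDiffAt
    obtain ⟨k, rfl | rfl⟩ := m.eq_nat_or_neg
    · simpa using hx.pow k
    · simp only [zpow_neg, zpow_natCast]
      exact (hx.pow k).inv (pow_ne_zero _ hne)
  exact hz.mul (hU.of_le (by exact_mod_cast le_top)).contDiffAt

/-! ### Bounds near the origin -/

theorem Reg.bound_mul_zero {u v : ℝ → ℂ} (hu : Reg 0 u) (hv : Reg 0 v) :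
    ∃ C : ℝ, ∀ x y : ℝ, 0 < y → y ≤ x → x ≤ 1 → ‖u y * v x‖ ≤ C := by
  obtain ⟨A, hA, h1⟩ := hu.exists_bound
  obtain ⟨B, hB, h2⟩ := hv.exists_bound
  refine ⟨A * B, fun x y hy hyx hx => ?_⟩
  have h1 := h1 y hy (hyx.trans hx)
  have h2 := h2 x (hy.trans_le hyx) hx
  rw [zpow_zero, mul_one] at h1 h2
  rw [norm_mul]
  gcongr

/-- Because p ≥ 0 and y ≤ x, the power y^p may be traded for x^p; only the total order p + q
matters. -/
theorem Reg.bound_mul {p q m : ℤ} (hp : 0 ≤ p) (hpq : m ≤ p + q) {u v : ℝ → ℂ} (hu : Reg p u)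
    (hv : Reg q v) :
    ∃ C : ℝ, ∀ x y : ℝ, 0 < y → y ≤ x → x ≤ 1 → ‖u y * v x‖ ≤ C * x ^ m := by
  obtain ⟨A, hA, h1⟩ := hu.exists_bound
  obtain ⟨B, hB, h2⟩ := hv.exists_bound
  refine ⟨A * B, fun x y hy hyx hx => ?_⟩
  have hx0 := hy.trans_le hyx
  have h1 := h1 y hy (hyx.trans hx)
  have h2 := h2 x hx0 hx
  have h3 : y ^ p ≤ x ^ p := zpow_le_zpow_left₀ hp hy.le hyx
  rw [norm_mul]
  calc ‖u y‖ * ‖v x‖ ≤ (A * x ^ p) * (B * x ^ q) := by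
        gcongr
        exact h1.trans (by gcongr)
    _ = A * B * x ^ (p + q) := by rw [zpow_add₀ hx0.ne']; ring
    _ ≤ A * B * x ^ m := by
        have := zpow_le_zpow_right_of_le_one₀ hx0 hx hpq
        gcongr

/-! ### Cancellation of the singular parts of the kernel at the origin -/

namespace KernelData

variable {l : ℕ} (D : KernelData l)

/-- The regular solutions `d_k - g_k`. -/
def sol (k : Fin 3) : ℝ → ℂ := fun r => D.d k r - D.g k r

/-- The leading monomial of `d_k - g_k` removed. -/
def sol1 (k : Fin 3) : ℝ → ℂ := fun r => D.sol k r -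
  -2 * phiCoeff l (2 * l + 1) * D.a k ^ (2 * l + 1) * (r : ℂ) ^ ((l : ℤ) + 1)

/-- The two leading monomials of `d_k - g_k` removed. -/
def sol2 (k : Fin 3) : ℝ → ℂ := fun r => D.sol1 k r -
  -2 * phiCoeff l (2 * l + 3) * D.a k ^ (2 * l + 3) * (r : ℂ) ^ ((l : ℤ) + 3)

/-- The half sum `(d_k + g_k) / 2` with the two leading monomials removed. -/
def even2 (k : Fin 3) : ℝ → ℂ := fun r => (D.d k r + D.g k r) / 2 -
  phiCoeff l 0 * (r : ℂ) ^ (-(l : ℤ)) - phiCoeff l 2 * D.a k ^ 2 * (r : ℂ) ^ (2 - (l : ℤ))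

/-- The regular combination `g_k - g_0`. -/
def diff (k : Fin 3) : ℝ → ℂ := fun r => D.g k r - D.g 0 r

/-- The regular combination `g_k + ∑ m_{kj} g_j`. -/
def eta (k : Fin 3) : ℝ → ℂ := fun r => D.g k r + ∑ j, D.mu k j * D.g j r

/-- In d_k - g_k only odd n survive, and `phiCoeff l` vanishes at the odd n below 2l + 1. The
leading term is therefore n = 2l + 1, that is r^{l+1}, and the next ones are two orders apart. -/
theorem reg_sol (k : Fin 3) : Reg ((l : ℤ) + 1) (D.sol k) := by
  have h1 := reg_psi_sub D.hl (-D.a k) (N := 2 * l + 1) (by have := D.hl; omega)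
  have h2 := reg_psi_sub D.hl (D.a k) (N := 2 * l + 1) (by have := D.hl; omega)
  refine ((h1.sub h2).mono (by push_cast; omega)).congr fun r _ => ?_
  simp only [sol, d, g]
  rcases D.hl with rfl | rfl <;> simp [Finset.sum_range_succ, phiCoeff] <;> ring

theorem reg_sol1 (k : Fin 3) : Reg ((l : ℤ) + 3) (D.sol1 k) := by
  have h1 := reg_psi_sub D.hl (-D.a k) (N := 2 * l + 3) (by have := D.hl; omega)
  have h2 := reg_psi_sub D.hl (D.a k) (N := 2 * l + 3) (by have := D.hl; omega)
  refine ((h1.sub h2).mono (by push_cast; omega)).congr fun r _ => ?_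
  simp only [sol1, sol, d, g]
  rcases D.hl with rfl | rfl <;> simp [Finset.sum_range_succ, phiCoeff] <;> norm_num <;> ring

theorem reg_sol2 (k : Fin 3) : Reg ((l : ℤ) + 5) (D.sol2 k) := by
  have h1 := reg_psi_sub D.hl (-D.a k) (N := 2 * l + 5) (by have := D.hl; omega)
  have h2 := reg_psi_sub D.hl (D.a k) (N := 2 * l + 5) (by have := D.hl; omega)
  refine ((h1.sub h2).mono (by push_cast; omega)).congr fun r _ => ?_
  simp only [sol2, sol1, sol, d, g]
  rcases D.hl with rfl | rfl <;> simp [Finset.sum_range_succ, phiCoeff] <;> norm_num <;> ring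

/-- The half sum keeps only even n; removing n = 0 and n = 2 leaves n ≥ 4. -/
theorem reg_even2 (k : Fin 3) : Reg (4 - (l : ℤ)) (D.even2 k) := by
  have h1 := reg_psi_sub D.hl (-D.a k) (N := 4) (by norm_num)
  have h2 := reg_psi_sub D.hl (D.a k) (N := 4) (by norm_num)
  refine ((h1.add h2).const_mul (1 / 2)).congr fun r _ => ?_
  simp only [even2, d, g]
  rcases D.hl with rfl | rfl <;> simp [Finset.sum_range_succ, phiCoeff] <;> norm_num <;> ring

theorem reg_diff (k : Fin 3) : Reg 0 (D.diff k) := by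
  refine (reg_zero_lin D.hl (x := ![1, -1]) (b := ![D.a k, D.a 0]) ?_).congr fun r _ => ?_
  · simp [moment]
  · simp [lin, diff, g]
    ring

/-- The coefficients of the g_j in η_k add up to zero by `row`, so g_0 may be subtracted from each
of them. This exhibits η_k as a combination of regular functions. -/
theorem sum_g_eq_sum_diff (k : Fin 3) (r : ℝ) : D.eta k r =
    D.diff k r + ∑ j, D.mu k j * D.diff j r := by
  have := D.row k
  simp only [eta, diff, Fin.sum_univ_three] at *
  linear_combination (D.g 0 r) * this

theorem reg_eta (k : Fin 3) : Reg 0 (D.eta k) :=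
  ((D.reg_diff k).add (Reg.sum (s := Finset.univ)
    fun j _ => (D.reg_diff j).const_mul (D.mu k j))).congr fun r _ => D.sum_g_eq_sum_diff k r

theorem h_eq (k : Fin 3) (r : ℝ) : D.h k r = D.sol k r + D.eta k r := by
  simp only [h, sol, eta]
  ring

theorem reg_h (k : Fin 3) : Reg 0 (D.h k) :=
  (((D.reg_sol k).mono (by omega)).add (D.reg_eta k)).congr fun r _ => D.h_eq k r

/-- By `symm` the double sum of c_k μ_{kj} g_j equals the sum of c_j g_j times the row sum of μ at
j, which is -1 by `row`; it cancels the sum of c_k g_k. Hence the singular g_0(x) can be subtracted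
from every g_k(x) multiplying η_k(y). -/
theorem sum_eta (r : ℝ) : ∑ k, D.cc k * D.eta k r = 0 := by
  have h0 := D.row 0
  have h1 := D.row 1
  have h2 := D.row 2
  have s01 := D.symm 0 1
  have s02 := D.symm 0 2
  have s12 := D.symm 1 2
  simp only [eta, Fin.sum_univ_three] at *
  linear_combination D.cc 0 * D.g 0 r * h0 + D.cc 1 * D.g 1 r * h1 + D.cc 2 * D.g 2 r * h2 +
    (D.g 1 r - D.g 0 r) * s01 + (D.g 2 r - D.g 0 r) * s02 + (D.g 2 r - D.g 1 r) * s12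

theorem coeff_moments : ∑ k, D.cc k * D.a k ^ (2 * l + 1) = 0 ∧
    ∑ k, D.cc k * D.a k ^ (2 * l + 3) = 0 := by
  have h0 := D.sum_zero
  have h2 := D.sum_two
  have hc : (2 * (-1) ^ (l + 1) : ℂ) ≠ 0 := by simp
  constructor
  · refine mul_left_cancel₀ hc ?_
    rw [mul_zero, ← h0, Finset.mul_sum]
    exact Finset.sum_congr rfl fun k _ => by ring
  · refine mul_left_cancel₀ hc ?_
    rw [mul_zero, ← h2, Finset.mul_sum]
    exact Finset.sum_congr rfl fun k _ => by ring

/-- The kernel as a sum of products in which the factors have compensating orders at the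
origin. -/
theorem kernel_expansion (x y : ℝ) :
    ∑ k, D.cc k * (D.g k x * D.h k y) = ∑ k, (D.cc k * (D.sol k y * D.even2 k x) +
      D.cc k * phiCoeff l 0 * (D.sol2 k y * (x : ℂ) ^ (-(l : ℤ))) +
      D.cc k * phiCoeff l 2 * D.a k ^ 2 * (D.sol1 k y * (x : ℂ) ^ (2 - (l : ℤ))) +
      (-1 / 2) * D.cc k * (D.sol k y * D.sol k x) + D.cc k * (D.eta k y * D.diff k x)) := by
  have he := D.sum_eta y
  obtain ⟨m1, m3⟩ := D.coeff_moments
  have hterm : ∀ k, D.cc k * (D.g k x * D.h k y) - (D.cc k * (D.sol k y * D.even2 k x) +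
      D.cc k * phiCoeff l 0 * (D.sol2 k y * (x : ℂ) ^ (-(l : ℤ))) +
      D.cc k * phiCoeff l 2 * D.a k ^ 2 * (D.sol1 k y * (x : ℂ) ^ (2 - (l : ℤ))) +
      (-1 / 2) * D.cc k * (D.sol k y * D.sol k x) + D.cc k * (D.eta k y * D.diff k x)) =
      (D.cc k * D.a k ^ (2 * l + 1)) * (-2 * phiCoeff l 0 * phiCoeff l (2 * l + 1) *
        (y : ℂ) ^ ((l : ℤ) + 1) * (x : ℂ) ^ (-(l : ℤ))) +
      (D.cc k * D.a k ^ (2 * l + 3)) * (-2 * phiCoeff l 0 * phiCoeff l (2 * l + 3) *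
        (y : ℂ) ^ ((l : ℤ) + 3) * (x : ℂ) ^ (-(l : ℤ)) +
        -2 * phiCoeff l 2 * phiCoeff l (2 * l + 1) *
        (y : ℂ) ^ ((l : ℤ) + 1) * (x : ℂ) ^ (2 - (l : ℤ))) +
      (D.cc k * D.eta k y) * D.g 0 x := by
    intro k
    have hs : D.sol k x = D.d k x - D.g k x := rfl
    simp only [diff, even2, sol2, sol1, h_eq, hs]
    ring
  rw [← sub_eq_zero, ← Finset.sum_sub_distrib, Finset.sum_congr rfl fun k _ => hterm k,
    Finset.sum_add_distrib, Finset.sum_add_distrib, ← Finset.sum_mul, ← Finset.sum_mul,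
    ← Finset.sum_mul, m1, m3, he]
  ring

/-- The numerical coefficients of the expansion of the kernel at the origin. -/
def expCoeff (k : Fin 3) : Fin 5 → ℂ :=
  ![D.cc k, D.cc k * phiCoeff l 0, D.cc k * phiCoeff l 2 * D.a k ^ 2, (-1 / 2) * D.cc k, D.cc k]

/-- The factors of the expansion of the kernel in the smaller variable. -/
def expSmall (k : Fin 3) : Fin 5 → ℝ → ℂ := ![D.sol k, D.sol2 k, D.sol1 k, D.sol k, D.eta k]

/-- The factors of the expansion of the kernel in the larger variable. -/
def expLarge (k : Fin 3) : Fin 5 → ℝ → ℂ :=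
  ![D.even2 k, fun x => (x : ℂ) ^ (-(l : ℤ)), fun x => (x : ℂ) ^ (2 - (l : ℤ)), D.sol k, D.diff k]

theorem kernel_eq_sum (x y : ℝ) : ∑ k, D.cc k * (D.g k x * D.h k y) =
    ∑ p : Fin 3 × Fin 5, D.expCoeff p.1 p.2 * (D.expSmall p.1 p.2 y * D.expLarge p.1 p.2 x) := by
  rw [kernel_expansion, Fintype.sum_prod_type]
  simp [expCoeff, expSmall, expLarge, Fin.sum_univ_five]

/-- The final alternative is shaped for differentiation up to order six. When q ≥ 0 both factors are
smooth up to 0, and derivatives of the small-variable factor stay bounded; otherwise p ≥ 6, and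
after j ≤ 6 derivatives that factor still has nonnegative order. -/
theorem exists_orders (k : Fin 3) (i : Fin 5) : ∃ p q : ℤ, 0 ≤ p ∧ Reg p (D.expSmall k i) ∧
    Reg q (D.expLarge k i) ∧
    ((5 ≤ p + q ∧ (6 ≤ p ∨ 0 ≤ q)) ∨ (0 ≤ p ∧ 0 ≤ q)) := by
  have hl := D.hl
  fin_cases i
  · exact ⟨l + 1, 4 - l, by omega, D.reg_sol k, D.reg_even2 k, by omega⟩
  · exact ⟨l + 5, -l, by omega, D.reg_sol2 k, Reg.zpow _, by omega⟩
  · exact ⟨l + 3, 2 - l, by omega, D.reg_sol1 k, Reg.zpow _, by omega⟩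
  · exact ⟨l + 1, l + 1, by omega, D.reg_sol k, D.reg_sol k, by omega⟩
  · exact ⟨0, 0, le_rfl, D.reg_eta k, D.reg_diff k, by omega⟩

theorem exists_bound_term (k : Fin 3) (i : Fin 5) {j : ℕ} (hj : j ≤ 6) :
    ∃ C : ℝ, ∀ x y : ℝ, 0 < y → y ≤ x → x ≤ 1 →
      ‖D.expSmall k i y * iteratedDeriv j (D.expLarge k i) x‖ ≤ C * (1 + x ^ (5 - j : ℤ)) ∧
      ‖iteratedDeriv j (D.expSmall k i) y * D.expLarge k i x‖ ≤ C * (1 + x ^ (5 - j : ℤ)) := by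
  obtain ⟨p, q, hp, hU, hV, h⟩ := D.exists_orders k i
  have one : ∀ {u v : ℝ → ℂ}, Reg 0 u → Reg 0 v → ∃ C : ℝ, ∀ x y : ℝ, 0 < y → y ≤ x → x ≤ 1 →
      ‖u y * v x‖ ≤ C * (1 + x ^ (5 - j : ℤ)) := by
    intro u v hu hv
    obtain ⟨C, hC⟩ := hu.bound_mul_zero hv
    refine ⟨|C|, fun x y hy hyx hx => (hC x y hy hyx hx).trans ?_⟩
    have : 0 ≤ x ^ (5 - j : ℤ) := zpow_nonneg (hy.trans_le hyx).le _
    nlinarith [le_abs_self C, mul_nonneg (abs_nonneg C) this]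
  have two : ∀ {p q : ℤ} {u v : ℝ → ℂ}, 0 ≤ p → (5 - j : ℤ) ≤ p + q → Reg p u → Reg q v →
      ∃ C : ℝ, ∀ x y : ℝ, 0 < y → y ≤ x → x ≤ 1 → ‖u y * v x‖ ≤ C * (1 + x ^ (5 - j : ℤ)) := by
    intro p q u v hp hpq hu hv
    obtain ⟨C, hC⟩ := hu.bound_mul hp hpq hv
    refine ⟨|C|, fun x y hy hyx hx => (hC x y hy hyx hx).trans ?_⟩
    have h0 : 0 ≤ x ^ (5 - j : ℤ) := zpow_nonneg (hy.trans_le hyx).le _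
    have h1 : C * x ^ (5 - j : ℤ) ≤ |C| * x ^ (5 - j : ℤ) :=
      mul_le_mul_of_nonneg_right (le_abs_self C) h0
    nlinarith [abs_nonneg C]
  have hA : ∃ C : ℝ, ∀ x y : ℝ, 0 < y → y ≤ x → x ≤ 1 →
      ‖D.expSmall k i y * iteratedDeriv j (D.expLarge k i) x‖ ≤ C * (1 + x ^ (5 - j : ℤ)) := by
    rcases h with ⟨h5, -⟩ | ⟨-, hq⟩
    · exact two hp (by omega) hU (hV.iteratedDeriv j)
    · exact one (hU.mono hp) ((hV.mono hq).iteratedDeriv_zero j)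
  have hB : ∃ C : ℝ, ∀ x y : ℝ, 0 < y → y ≤ x → x ≤ 1 →
      ‖iteratedDeriv j (D.expSmall k i) y * D.expLarge k i x‖ ≤ C * (1 + x ^ (5 - j : ℤ)) := by
    by_cases hq : 0 ≤ q
    · exact one ((hU.mono hp).iteratedDeriv_zero j) (hV.mono hq)
    · exact two (by omega) (by omega) (hU.iteratedDeriv j) hV
  obtain ⟨A, hA⟩ := hA
  obtain ⟨B, hB⟩ := hB
  refine ⟨max A B, fun x y hy hyx hx => ?_⟩
  have h0 : 0 ≤ 1 + x ^ (5 - j : ℤ) := by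
    have := zpow_nonneg (hy.trans_le hyx).le (5 - j : ℤ)
    linarith
  exact ⟨(hA x y hy hyx hx).trans (mul_le_mul_of_nonneg_right (le_max_left _ _) h0),
    (hB x y hy hyx hx).trans (mul_le_mul_of_nonneg_right (le_max_right _ _) h0)⟩

/-- The `j`-th derivative of the kernel in its first variable, away from the diagonal. -/
def ker (j : ℕ) (r s : ℝ) : ℂ :=
  if s < r then ∑ k, D.cc k * (iteratedDeriv j (D.g k) r * D.h k s)
  else ∑ k, D.cc k * (iteratedDeriv j (D.h k) r * D.g k s)

/-- One function of a larger variable x and a smaller variable y describes both sides of the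
diagonal. Its expansion is differentiated term by term, in x when s < r and in y otherwise. -/
theorem ker_bound_near_zero {j : ℕ} (hj : j ≤ 6) : ∃ C : ℝ, 0 ≤ C ∧ ∀ r s : ℝ, 0 < r → 0 < s →
    max r s ≤ 1 → ‖D.ker j r s‖ ≤ C * (1 + (max r s) ^ (5 - j : ℤ)) := by
  choose C hC using fun k i => D.exists_bound_term k i hj
  refine ⟨∑ p : Fin 3 × Fin 5, ‖D.expCoeff p.1 p.2‖ * |C p.1 p.2|,
    Finset.sum_nonneg fun p _ => by positivity, fun r s hr hs h1 => ?_⟩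
  have h0 : 0 ≤ 1 + (max r s) ^ (5 - j : ℤ) := by
    have := zpow_nonneg (hr.le.trans (le_max_left r s)) (5 - j : ℤ)
    linarith
  have hS : ∀ p : Fin 3 × Fin 5, ∀ x : ℝ, 0 < x → ContDiffAt ℝ j (D.expSmall p.1 p.2) x := by
    intro p x hx
    obtain ⟨m, q, -, hU, -, -⟩ := D.exists_orders p.1 p.2
    exact hU.contDiffAt hx (n := (j : ℕ∞))
  have hL : ∀ p : Fin 3 × Fin 5, ∀ x : ℝ, 0 < x → ContDiffAt ℝ j (D.expLarge p.1 p.2) x := by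
    intro p x hx
    obtain ⟨m, q, -, -, hV, -⟩ := D.exists_orders p.1 p.2
    exact hV.contDiffAt hx (n := (j : ℕ∞))
  have habs : ∀ k i, C k i * (1 + (max r s) ^ (5 - j : ℤ)) ≤
      |C k i| * (1 + (max r s) ^ (5 - j : ℤ)) := fun k i =>
    mul_le_mul_of_nonneg_right (le_abs_self _) h0
  rw [ker, Finset.sum_mul]
  split_ifs with hsr
  · have e : ∑ k, D.cc k * (iteratedDeriv j (D.g k) r * D.h k s) =
        ∑ p : Fin 3 × Fin 5, D.expCoeff p.1 p.2 *
          (D.expSmall p.1 p.2 s * iteratedDeriv j (D.expLarge p.1 p.2) r) := by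
      have e1 := iteratedDeriv_sum_const_mul Finset.univ (fun k => D.cc k * D.h k s) D.g j
        (r := r) fun k _ => D.contDiffAt_g k hr (n := (j : ℕ∞))
      have e2 := iteratedDeriv_sum_const_mul Finset.univ
        (fun p : Fin 3 × Fin 5 => D.expCoeff p.1 p.2 * D.expSmall p.1 p.2 s)
        (fun p => D.expLarge p.1 p.2) j (r := r) fun p _ => hL p r hr
      have e3 : (fun x => ∑ k, D.cc k * D.h k s * D.g k x) = fun x =>
          ∑ p : Fin 3 × Fin 5, D.expCoeff p.1 p.2 * D.expSmall p.1 p.2 s * D.expLarge p.1 p.2 x := by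
        funext x
        refine Eq.trans ?_ ((D.kernel_eq_sum x s).trans ?_) <;>
          exact Finset.sum_congr rfl fun k _ => by ring
      rw [e3, e2] at e1
      refine Eq.trans ?_ (e1.symm.trans ?_) <;> exact Finset.sum_congr rfl fun k _ => by ring
    rw [e]
    refine (norm_sum_le _ _).trans (Finset.sum_le_sum fun p _ => ?_)
    rw [norm_mul, mul_assoc]
    refine mul_le_mul_of_nonneg_left (le_trans ?_ (habs _ _)) (norm_nonneg _)
    rw [max_eq_left hsr.le] at h1 ⊢
    exact (hC p.1 p.2 r s hs hsr.le h1).1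
  · have e : ∑ k, D.cc k * (iteratedDeriv j (D.h k) r * D.g k s) =
        ∑ p : Fin 3 × Fin 5, D.expCoeff p.1 p.2 *
          (iteratedDeriv j (D.expSmall p.1 p.2) r * D.expLarge p.1 p.2 s) := by
      have e1 := iteratedDeriv_sum_const_mul Finset.univ (fun k => D.cc k * D.g k s) D.h j
        (r := r) fun k _ => D.contDiffAt_h k hr (n := (j : ℕ∞))
      have e2 := iteratedDeriv_sum_const_mul Finset.univ
        (fun p : Fin 3 × Fin 5 => D.expCoeff p.1 p.2 * D.expLarge p.1 p.2 s)
        (fun p => D.expSmall p.1 p.2) j (r := r) fun p _ => hS p r hr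
      have e3 : (fun x => ∑ k, D.cc k * D.g k s * D.h k x) = fun x =>
          ∑ p : Fin 3 × Fin 5, D.expCoeff p.1 p.2 * D.expLarge p.1 p.2 s * D.expSmall p.1 p.2 x := by
        funext x
        refine Eq.trans ?_ ((D.kernel_eq_sum s x).trans ?_) <;>
          exact Finset.sum_congr rfl fun k _ => by ring
      rw [e3, e2] at e1
      refine Eq.trans ?_ (e1.symm.trans ?_) <;> exact Finset.sum_congr rfl fun k _ => by ring
    rw [e]
    refine (norm_sum_le _ _).trans (Finset.sum_le_sum fun p _ => ?_)
    rw [norm_mul, mul_assoc]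
    refine mul_le_mul_of_nonneg_left (le_trans ?_ (habs _ _)) (norm_nonneg _)
    rw [max_eq_right (not_lt.1 hsr)] at h1 ⊢
    exact (hC p.1 p.2 s r hr (not_lt.1 hsr) h1).2

/-! ### Bounds at infinity -/

theorem exists_bound_g (j : ℕ) (k : Fin 3) : ∃ C : ℝ, 0 ≤ C ∧ ∀ r : ℝ, 1 ≤ r →
    ‖iteratedDeriv j (D.g k) r‖ ≤ C * Real.exp ((D.a k).re * r) := by
  obtain ⟨C, hC⟩ := exists_bound_iteratedDeriv_psi D.hl (D.a k) j
  refine ⟨C, ?_, hC⟩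
  exact nonneg_of_mul_nonneg_left ((norm_nonneg _).trans (hC 1 le_rfl)) (Real.exp_pos _)

theorem iteratedDeriv_h (j : ℕ) (k : Fin 3) {r : ℝ} (hr : 0 < r) : iteratedDeriv j (D.h k) r =
    iteratedDeriv j (D.d k) r + ∑ i, D.mu k i * iteratedDeriv j (D.g i) r := by
  rw [← iteratedDeriv_sum_const_mul Finset.univ (D.mu k) D.g j
    fun i _ => D.contDiffAt_g i hr (n := (j : ℕ∞))]
  exact iteratedDeriv_fun_add (D.contDiffAt_d k hr (n := (j : ℕ∞)))
    (ContDiffAt.sum fun i _ => contDiffAt_const.mul (D.contDiffAt_g i hr (n := (j : ℕ∞))))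

/-- On (0,1] regularity at the origin gives boundedness and the exponential is at least 1; beyond 1
the growing d_k dominates the decaying g_j. -/
theorem exists_bound_h (j : ℕ) (k : Fin 3) : ∃ C : ℝ, 0 ≤ C ∧ ∀ r : ℝ, 0 < r →
    ‖iteratedDeriv j (D.h k) r‖ ≤ C * Real.exp (-(D.a k).re * r) := by
  obtain ⟨A, hA0, hA⟩ := ((D.reg_h k).iteratedDeriv_zero j).exists_bound
  obtain ⟨B, hB⟩ := exists_bound_iteratedDeriv_psi D.hl (-D.a k) j
  choose C hC0 hC using D.exists_bound_g j
  refine ⟨A + (|B| + ∑ i, ‖D.mu k i‖ * C i), ?_, fun r hr => ?_⟩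
  · have : 0 ≤ ∑ i, ‖D.mu k i‖ * C i :=
      Finset.sum_nonneg fun i _ => mul_nonneg (norm_nonneg _) (hC0 i)
    positivity
  have hk := D.re_neg k
  have he : 1 ≤ Real.exp (-(D.a k).re * r) := Real.one_le_exp (by nlinarith)
  have hs : 0 ≤ ∑ i, ‖D.mu k i‖ * C i :=
    Finset.sum_nonneg fun i _ => mul_nonneg (norm_nonneg _) (hC0 i)
  rcases le_total r 1 with h1 | h1
  · have := hA r hr h1
    rw [zpow_zero, mul_one] at this
    have h2 : 0 ≤ |B| + ∑ i, ‖D.mu k i‖ * C i := by positivity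
    nlinarith
  · rw [D.iteratedDeriv_h j k hr, add_mul, add_mul]
    have h2 : ‖iteratedDeriv j (D.d k) r‖ ≤ |B| * Real.exp (-(D.a k).re * r) := by
      have := hB r h1
      rw [Complex.neg_re] at this
      exact this.trans (mul_le_mul_of_nonneg_right (le_abs_self B) (Real.exp_nonneg _))
    have h3 : ‖∑ i, D.mu k i * iteratedDeriv j (D.g i) r‖ ≤
        (∑ i, ‖D.mu k i‖ * C i) * Real.exp (-(D.a k).re * r) := by
      rw [Finset.sum_mul]
      refine (norm_sum_le _ _).trans (Finset.sum_le_sum fun i _ => ?_)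
      rw [norm_mul, mul_assoc]
      refine mul_le_mul_of_nonneg_left ((hC i r h1).trans ?_) (norm_nonneg _)
      refine mul_le_mul_of_nonneg_left (le_trans ?_ he) (hC0 i)
      exact Real.exp_le_one_iff.2 (by nlinarith [D.re_neg i])
    have h4 := norm_add_le (iteratedDeriv j (D.d k) r) (∑ i, D.mu k i * iteratedDeriv j (D.g i) r)
    have h5 : 0 ≤ A * Real.exp (-(D.a k).re * r) := by positivity
    linarith

/-- The larger variable is at least 1, so the exponential bound for g_k applies there, while the
bound for h_k holds everywhere. The exponents combine to Re a_k · |r - s|. -/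
theorem ker_bound_far {ε : ℝ} (hε : ∀ k, (D.a k).re ≤ -ε) (j : ℕ) :
    ∃ C : ℝ, 0 ≤ C ∧ ∀ r s : ℝ, 0 < r → 0 < s → 1 ≤ max r s →
      ‖D.ker j r s‖ ≤ C * Real.exp (-ε * |r - s|) := by
  choose A hA0 hA using D.exists_bound_g j
  choose A' hA0' hA' using D.exists_bound_g 0
  choose B hB0 hB using D.exists_bound_h j
  choose B' hB0' hB' using D.exists_bound_h 0
  have hn : ∀ k, 0 ≤ ‖D.cc k‖ * (A k * B' k + B k * A' k) := fun k =>
    mul_nonneg (norm_nonneg _) (add_nonneg (mul_nonneg (hA0 k) (hB0' k))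
      (mul_nonneg (hB0 k) (hA0' k)))
  refine ⟨∑ k, ‖D.cc k‖ * (A k * B' k + B k * A' k), Finset.sum_nonneg fun k _ => hn k,
    fun r s hr hs h1 => ?_⟩
  simp only [iteratedDeriv_zero] at hA' hB'
  rw [ker, Finset.sum_mul]
  split_ifs with hsr
  · rw [max_eq_left hsr.le] at h1
    rw [abs_of_pos (sub_pos.2 hsr)]
    refine (norm_sum_le _ _).trans (Finset.sum_le_sum fun k _ => ?_)
    rw [norm_mul, norm_mul, mul_assoc]
    refine mul_le_mul_of_nonneg_left ?_ (norm_nonneg _)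
    calc _ ≤ (A k * Real.exp ((D.a k).re * r)) * (B' k * Real.exp (-(D.a k).re * s)) :=
          mul_le_mul (hA k r h1) (hB' k s hs) (norm_nonneg _)
            (mul_nonneg (hA0 k) (Real.exp_nonneg _))
      _ = A k * B' k * Real.exp ((D.a k).re * (r - s)) := by
          rw [mul_mul_mul_comm, ← Real.exp_add]
          ring_nf
      _ ≤ A k * B' k * Real.exp (-ε * (r - s)) := by
          refine mul_le_mul_of_nonneg_left (Real.exp_le_exp.2 ?_) (mul_nonneg (hA0 k) (hB0' k))
          exact mul_le_mul_of_nonneg_right (hε k) (sub_pos.2 hsr).le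
      _ ≤ _ := mul_le_mul_of_nonneg_right
          (le_add_of_nonneg_right (mul_nonneg (hB0 k) (hA0' k))) (Real.exp_nonneg _)
  · have hsr := not_lt.1 hsr
    rw [max_eq_right hsr] at h1
    rw [abs_of_nonpos (sub_nonpos.2 hsr), neg_sub]
    refine (norm_sum_le _ _).trans (Finset.sum_le_sum fun k _ => ?_)
    rw [norm_mul, norm_mul, mul_assoc]
    refine mul_le_mul_of_nonneg_left ?_ (norm_nonneg _)
    calc _ ≤ (B k * Real.exp (-(D.a k).re * r)) * (A' k * Real.exp ((D.a k).re * s)) :=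
          mul_le_mul (hB k r hr) (hA' k s h1) (norm_nonneg _)
            (mul_nonneg (hB0 k) (Real.exp_nonneg _))
      _ = B k * A' k * Real.exp ((D.a k).re * (s - r)) := by
          rw [mul_mul_mul_comm, ← Real.exp_add]
          ring_nf
      _ ≤ B k * A' k * Real.exp (-ε * (s - r)) := by
          refine mul_le_mul_of_nonneg_left (Real.exp_le_exp.2 ?_) (mul_nonneg (hB0 k) (hA0' k))
          exact mul_le_mul_of_nonneg_right (hε k) (sub_nonneg.2 hsr)
      _ ≤ _ := mul_le_mul_of_nonneg_right
          (le_add_of_nonneg_left (mul_nonneg (hA0 k) (hB0' k))) (Real.exp_nonneg _)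

theorem ker_bound {ε : ℝ} (hε0 : 0 < ε) (hε : ∀ k, (D.a k).re ≤ -ε) {j : ℕ} (hj : j ≤ 6) :
    ∃ C : ℝ, 0 ≤ C ∧ ∀ r s : ℝ, 0 < r → 0 < s →
      ‖D.ker j r s‖ ≤ C * (Real.exp (-ε * |r - s|) + if j = 6 then (max r s)⁻¹ else 0) := by
  obtain ⟨A, hA0, hA⟩ := D.ker_bound_near_zero hj
  obtain ⟨B, hB0, hB⟩ := D.ker_bound_far hε j
  -- When max(r,s) ≤ 1 also |r - s| ≤ 1, so e^ε e^{-ε|r-s|} ≥ 1 absorbs constants; the factor 2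
  -- covers 1 + max(r,s)^{5-j} for j ≤ 5.
  refine ⟨B + A * (2 * Real.exp ε), by positivity, fun r s hr hs => ?_⟩
  have hm : 0 < max r s := lt_max_of_lt_left hr
  have hi : 0 ≤ (if j = 6 then (max r s)⁻¹ else 0) := by
    split_ifs
    · exact (inv_pos.2 hm).le
    · exact le_rfl
  rcases le_total 1 (max r s) with h1 | h1
  · refine (hB r s hr hs h1).trans (mul_le_mul ?_ ?_ (Real.exp_nonneg _) (by positivity))
    · exact le_add_of_nonneg_right (by positivity)
    · exact le_add_of_nonneg_right hi
  · refine (hA r s hr hs h1).trans ?_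
    have habs : |r - s| ≤ 1 := by
      rw [abs_le]
      constructor <;> linarith [le_max_left r s, le_max_right r s]
    have hexp : 1 ≤ Real.exp ε * Real.exp (-ε * |r - s|) := by
      rw [← Real.exp_add]
      exact Real.one_le_exp (by nlinarith)
    have he1 : 1 ≤ Real.exp ε := Real.one_le_exp hε0.le
    have key : 1 + (max r s) ^ (5 - j : ℤ) ≤ 2 * Real.exp ε *
        (Real.exp (-ε * |r - s|) + if j = 6 then (max r s)⁻¹ else 0) := by
      split_ifs with h6
      · have : (max r s) ^ (5 - j : ℤ) = (max r s)⁻¹ := by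
          rw [h6]
          norm_num
        rw [this]
        have := inv_pos.2 hm
        nlinarith
      · have : (max r s) ^ (5 - j : ℤ) ≤ 1 := by
          obtain ⟨n, hn⟩ : ∃ n : ℕ, (5 - j : ℤ) = n := ⟨5 - j, by omega⟩
          rw [hn, zpow_natCast]
          exact pow_le_one₀ hm.le h1
        linarith
    calc A * (1 + (max r s) ^ (5 - j : ℤ)) ≤ A * (2 * Real.exp ε *
        (Real.exp (-ε * |r - s|) + if j = 6 then (max r s)⁻¹ else 0)) :=
          mul_le_mul_of_nonneg_left key hA0
      _ = (A * (2 * Real.exp ε)) *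
        (Real.exp (-ε * |r - s|) + if j = 6 then (max r s)⁻¹ else 0) := by ring
      _ ≤ _ := mul_le_mul_of_nonneg_right (le_add_of_nonneg_left hB0)
          (add_nonneg (Real.exp_nonneg _) hi)

end KernelData

end RadialCube

end

noncomputable section

namespace RadialCube

/-! ### Jump relations -/

theorem hasDerivAt_inv_pow (n : ℕ) {r : ℝ} (hr : 0 < r) :
    HasDerivAt (fun x : ℝ => (x : ℂ)⁻¹ ^ n) (-(n : ℂ) * (r : ℂ)⁻¹ ^ (n + 1)) r := by
  have h := (hasDerivAt_ofReal_inv hr).pow n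
  refine h.congr_deriv ?_
  rcases n with _ | n
  · simp
  · rw [Nat.add_sub_cancel]
    push_cast
    ring

/-- Repeated substitution of ψ'' = (l(l+1)/r² + b²)ψ leaves only ψ and ψ'. Since b enters only
through b², d_k and g_k obey the same formulas, which reduces the jumps to Wronskians. -/
theorem iteratedDeriv_psi_formulas {l : ℕ} (hl : l = 1 ∨ l = 2) (b : ℂ) {r : ℝ} (hr : 0 < r) :
    iteratedDeriv 2 (psi l b) r = ((l : ℂ) * (l + 1) * (r : ℂ)⁻¹ ^ 2 + b ^ 2) * psi l b r ∧
    iteratedDeriv 3 (psi l b) r = -2 * ((l : ℂ) * (l + 1)) * (r : ℂ)⁻¹ ^ 3 * psi l b r +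
      ((l : ℂ) * (l + 1) * (r : ℂ)⁻¹ ^ 2 + b ^ 2) * iteratedDeriv 1 (psi l b) r ∧
    iteratedDeriv 4 (psi l b) r = (6 * ((l : ℂ) * (l + 1)) * (r : ℂ)⁻¹ ^ 4 +
        ((l : ℂ) * (l + 1) * (r : ℂ)⁻¹ ^ 2 + b ^ 2) ^ 2) * psi l b r +
      -4 * ((l : ℂ) * (l + 1)) * (r : ℂ)⁻¹ ^ 3 * iteratedDeriv 1 (psi l b) r ∧
    iteratedDeriv 5 (psi l b) r = (-24 * ((l : ℂ) * (l + 1)) * (r : ℂ)⁻¹ ^ 5 +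
        -8 * ((l : ℂ) * (l + 1)) * (r : ℂ)⁻¹ ^ 3 *
          ((l : ℂ) * (l + 1) * (r : ℂ)⁻¹ ^ 2 + b ^ 2)) * psi l b r +
      (18 * ((l : ℂ) * (l + 1)) * (r : ℂ)⁻¹ ^ 4 +
        ((l : ℂ) * (l + 1) * (r : ℂ)⁻¹ ^ 2 + b ^ 2) ^ 2) * iteratedDeriv 1 (psi l b) r := by
  set c : ℂ := (l : ℂ) * (l + 1) with hc
  have h0 : ∀ {x : ℝ}, 0 < x → HasDerivAt (psi l b) (iteratedDeriv 1 (psi l b) x) x := by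
    intro x hx
    simpa using hasDerivAt_iteratedDeriv_psi hl b 0 hx
  have e2 : ∀ {x : ℝ}, 0 < x →
      iteratedDeriv 2 (psi l b) x = (c * (x : ℂ)⁻¹ ^ 2 + b ^ 2) * psi l b x := by
    intro x hx
    rw [iteratedDeriv_two_psi hl b hx]
    simp only [hc]
    ring
  have h1 : ∀ {x : ℝ}, 0 < x → HasDerivAt (iteratedDeriv 1 (psi l b))
      ((c * (x : ℂ)⁻¹ ^ 2 + b ^ 2) * psi l b x) x := by
    intro x hx
    rw [← e2 hx]
    exact hasDerivAt_iteratedDeriv_psi hl b 1 hx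
  have hV : ∀ {x : ℝ}, 0 < x → HasDerivAt (fun x : ℝ => c * (x : ℂ)⁻¹ ^ 2 + b ^ 2)
      (-2 * c * (x : ℂ)⁻¹ ^ 3) x := by
    intro x hx
    refine (((hasDerivAt_inv_pow 2 hx).const_mul c).add_const (b ^ 2)).congr_deriv ?_
    push_cast
    ring
  have next : ∀ (j : ℕ) (F : ℝ → ℂ) (F' : ℂ) {x : ℝ}, 0 < x →
      (∀ y : ℝ, 0 < y → iteratedDeriv j (psi l b) y = F y) → HasDerivAt F F' x →
      iteratedDeriv (j + 1) (psi l b) x = F' := by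
    intro j F F' x hx hF hF'
    have hev : F =ᶠ[𝓝 x] iteratedDeriv j (psi l b) := by
      filter_upwards [eventually_gt_nhds hx] with y hy using (hF y hy).symm
    exact (hasDerivAt_iteratedDeriv_psi hl b j hx).unique (hev.hasDerivAt_iff.1 hF')
  have e3 : ∀ {x : ℝ}, 0 < x → iteratedDeriv 3 (psi l b) x =
      -2 * c * (x : ℂ)⁻¹ ^ 3 * psi l b x +
        (c * (x : ℂ)⁻¹ ^ 2 + b ^ 2) * iteratedDeriv 1 (psi l b) x := fun hx =>
    next 2 _ _ hx (fun y hy => e2 hy) ((hV hx).mul (h0 hx))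
  have e4 : ∀ {x : ℝ}, 0 < x → iteratedDeriv 4 (psi l b) x =
      (6 * c * (x : ℂ)⁻¹ ^ 4 + (c * (x : ℂ)⁻¹ ^ 2 + b ^ 2) ^ 2) * psi l b x +
        -4 * c * (x : ℂ)⁻¹ ^ 3 * iteratedDeriv 1 (psi l b) x := fun hx => by
    refine next 3 _ _ hx (fun y hy => e3 hy) (((((hasDerivAt_inv_pow 3 hx).const_mul (-2 * c)).mul
      (h0 hx)).add ((hV hx).mul (h1 hx))).congr_deriv ?_)
    push_cast
    ring
  refine ⟨e2 hr, e3 hr, e4 hr, ?_⟩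
  refine next 4 _ _ hr (fun y hy => e4 hy)
    ((((((hasDerivAt_inv_pow 4 hr).const_mul (6 * c)).add ((hV hr).pow 2)).mul (h0 hr)).add
      (((hasDerivAt_inv_pow 3 hr).const_mul (-4 * c)).mul (h1 hr))).congr_deriv ?_)
  simp only [Pi.add_apply, Pi.pow_apply]
  push_cast
  ring

namespace KernelData

variable {l : ℕ} (D : KernelData l)

theorem wronskian (k : Fin 3) {r : ℝ} (hr : 0 < r) :
    iteratedDeriv 1 (D.d k) r * D.g k r - D.d k r * iteratedDeriv 1 (D.g k) r =
      2 * (-1) ^ (l + 1) * D.a k ^ (2 * l + 1) := by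
  simp only [iteratedDeriv_one]
  exact wronskian_psi D.hl _ hr

/-- Symmetry of c_k μ_{kj} cancels all products of two g's. The remaining d_k, g_k terms are either
zero or the Wronskian W_k times a polynomial in a_k² of degree at most two, and the moment
identities sum them. -/
theorem jump {j : ℕ} (hj : j ≤ 5) {r : ℝ} (hr : 0 < r) :
    ∑ k, D.cc k * (iteratedDeriv j (D.g k) r * D.h k r - iteratedDeriv j (D.h k) r * D.g k r) =
      if j = 5 then -1 else 0 := by
  have h1 : ∑ k, D.cc k * (iteratedDeriv j (D.g k) r * D.h k r -
      iteratedDeriv j (D.h k) r * D.g k r) =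
      ∑ k, D.cc k * (iteratedDeriv j (D.g k) r * D.d k r -
      iteratedDeriv j (D.d k) r * D.g k r) := by
    have s01 := D.symm 0 1
    have s02 := D.symm 0 2
    have s12 := D.symm 1 2
    simp only [D.iteratedDeriv_h j _ hr, h, Fin.sum_univ_three]
    linear_combination
      (iteratedDeriv j (D.g 0) r * D.g 1 r - iteratedDeriv j (D.g 1) r * D.g 0 r) * s01 +
      (iteratedDeriv j (D.g 0) r * D.g 2 r - iteratedDeriv j (D.g 2) r * D.g 0 r) * s02 +
      (iteratedDeriv j (D.g 1) r * D.g 2 r - iteratedDeriv j (D.g 2) r * D.g 1 r) * s12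
  rw [h1]
  have hW := fun k => D.wronskian k hr
  have m0 := D.sum_zero
  have m2 := D.sum_two
  have m4 := D.sum_four
  simp only [← hW] at m0 m2 m4
  obtain ⟨g2, g3, g4, g5⟩ : _ ∧ _ ∧ _ ∧ _ :=
    ⟨fun k => (iteratedDeriv_psi_formulas D.hl (D.a k) hr).1,
    fun k => (iteratedDeriv_psi_formulas D.hl (D.a k) hr).2.1,
    fun k => (iteratedDeriv_psi_formulas D.hl (D.a k) hr).2.2.1,
    fun k => (iteratedDeriv_psi_formulas D.hl (D.a k) hr).2.2.2⟩
  obtain ⟨d2, d3, d4, d5⟩ : _ ∧ _ ∧ _ ∧ _ :=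
    ⟨fun k => (iteratedDeriv_psi_formulas D.hl (-D.a k) hr).1,
    fun k => (iteratedDeriv_psi_formulas D.hl (-D.a k) hr).2.1,
    fun k => (iteratedDeriv_psi_formulas D.hl (-D.a k) hr).2.2.1,
    fun k => (iteratedDeriv_psi_formulas D.hl (-D.a k) hr).2.2.2⟩
  simp only [g, d, Fin.sum_univ_three] at *
  generalize (l : ℂ) * (l + 1) = c at *
  interval_cases j
  · simp only [iteratedDeriv_zero]
    rw [if_neg (by norm_num)]
    ring
  · rw [if_neg (by norm_num)]
    linear_combination -m0
  · simp only [g2, d2]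
    rw [if_neg (by norm_num)]
    ring
  · simp only [g3, d3]
    rw [if_neg (by norm_num)]
    linear_combination -m2 - c * (r : ℂ)⁻¹ ^ 2 * m0
  · simp only [g4, d4]
    rw [if_neg (by norm_num)]
    linear_combination (4 * c * (r : ℂ)⁻¹ ^ 3) * m0
  · simp only [g5, d5]
    rw [if_pos trivial]
    linear_combination -m4 - 2 * c * (r : ℂ)⁻¹ ^ 2 * m2 -
      (18 * c * (r : ℂ)⁻¹ ^ 4 + c ^ 2 * (r : ℂ)⁻¹ ^ 4) * m0

end KernelData

end RadialCube

end

noncomputable section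

namespace RadialCube

/-! ### Integral operators bounded on `L²` -/

open scoped ENNReal NNReal

/-- The integral operator with nonnegative kernel `k` is bounded on `L²(0, ⊤)`. -/
def L2Kernel (k : ℝ → ℝ → ℝ≥0∞) : Prop :=
  ∃ C : ℝ≥0, ∀ f : ℝ → ℝ≥0∞, AEMeasurable f halfLine →
    ∫⁻ r, (∫⁻ s, k r s * f s ∂halfLine) ^ 2 ∂halfLine ≤ C * ∫⁻ s, f s ^ 2 ∂halfLine

/-- The Cauchy–Schwarz inequality for the measure with density `k`. -/
theorem sq_lintegral_mul_le {μ : Measure ℝ} {k v f : ℝ → ℝ≥0∞} (hk : Measurable k)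
    (hv : Measurable v) (hf : Measurable f) (hv0 : ∀ᵐ s ∂μ, v s ≠ 0 ∧ v s ≠ ⊤) :
    (∫⁻ s, k s * f s ∂μ) ^ 2 ≤
      (∫⁻ s, k s * v s ^ 2 ∂μ) * ∫⁻ s, k s * (f s * (v s)⁻¹) ^ 2 ∂μ := by
  have h := ENNReal.lintegral_mul_le_Lp_mul_Lq (μ.withDensity k)
    (Real.HolderConjugate.two_two) hv.aemeasurable (hf.mul hv.inv).aemeasurable
  have e : ∀ x : ℝ≥0∞, (x ^ (1 / (2 : ℝ))) ^ 2 = x := fun x => by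
    rw [← ENNReal.rpow_natCast, ← ENNReal.rpow_mul]
    norm_num
  have h2 := pow_le_pow_left' h 2
  rw [mul_pow, e, e, lintegral_withDensity_eq_lintegral_mul _ hk (hv.mul (hf.mul hv.inv)),
    lintegral_withDensity_eq_lintegral_mul _ hk (hv.pow_const _),
    lintegral_withDensity_eq_lintegral_mul _ hk ((hf.mul hv.inv).pow_const _)] at h2
  simp only [Pi.mul_apply, ENNReal.rpow_two, Pi.inv_apply] at h2
  refine le_trans (le_of_eq ?_) h2
  congr 1
  refine lintegral_congr_ae ?_
  filter_upwards [hv0] with s hs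
  rw [mul_left_comm (v s), ENNReal.mul_inv_cancel hs.1 hs.2, mul_one]

/-- The Schur test. -/
theorem l2Kernel_of_schur {k : ℝ → ℝ → ℝ≥0∞} (hk : Measurable (Function.uncurry k))
    {v : ℝ → ℝ≥0∞} (hv : Measurable v) (hv0 : ∀ᵐ s ∂halfLine, v s ≠ 0 ∧ v s ≠ ⊤) {A B : ℝ≥0}
    (h1 : ∀ r : ℝ, 0 < r → ∫⁻ s, k r s * v s ^ 2 ∂halfLine ≤ A * v r ^ 2)
    (h2 : ∀ s : ℝ, 0 < s → ∫⁻ r, k r s * v r ^ 2 ∂halfLine ≤ B * v s ^ 2) : L2Kernel k := by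
  refine ⟨A * B, fun f hf => ?_⟩
  wlog hfm : Measurable f generalizing f
  · have := this _ hf.measurable_mk.aemeasurable hf.measurable_mk
    have e1 : ∀ r, ∫⁻ s, k r s * f s ∂halfLine = ∫⁻ s, k r s * hf.mk f s ∂halfLine := fun r =>
      lintegral_congr_ae (by filter_upwards [hf.ae_eq_mk] with s hs; rw [hs])
    have e2 : ∫⁻ s, f s ^ 2 ∂halfLine = ∫⁻ s, hf.mk f s ^ 2 ∂halfLine :=
      lintegral_congr_ae (by filter_upwards [hf.ae_eq_mk] with s hs; rw [hs])
    simp only [e1, e2]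
    exact this
  have hG : Measurable (Function.uncurry fun r s => k r s * (f s * (v s)⁻¹) ^ 2) :=
    hk.mul (((hfm.comp measurable_snd).mul (hv.comp measurable_snd).inv).pow_const _)
  calc ∫⁻ r, (∫⁻ s, k r s * f s ∂halfLine) ^ 2 ∂halfLine
      -- The weighted Cauchy–Schwarz inequality brings in the first Schur bound; Tonelli then
      -- exchanges the integrals so that the second one applies.
      ≤ ∫⁻ r, A * (v r ^ 2 * ∫⁻ s, k r s * (f s * (v s)⁻¹) ^ 2 ∂halfLine) ∂halfLine := by
        refine lintegral_mono_ae ?_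
        filter_upwards [ae_restrict_mem measurableSet_Ioi] with r hr
        refine (sq_lintegral_mul_le (hk.comp measurable_prodMk_left) hv hfm hv0).trans ?_
        rw [← mul_assoc]
        exact mul_le_mul_left (h1 r hr) _
    _ = A * ∫⁻ r, ∫⁻ s, v r ^ 2 * (k r s * (f s * (v s)⁻¹) ^ 2) ∂halfLine ∂halfLine := by
        rw [lintegral_const_mul' _ _ ENNReal.coe_ne_top]
        congr 1
        refine lintegral_congr fun r => ?_
        exact (lintegral_const_mul _ (hG.of_uncurry_left (x := r))).symm
    _ = A * ∫⁻ s, ∫⁻ r, v r ^ 2 * (k r s * (f s * (v s)⁻¹) ^ 2) ∂halfLine ∂halfLine := by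
        rw [lintegral_lintegral_swap]
        exact (((hv.comp measurable_fst).pow_const _).mul hG).aemeasurable
    _ ≤ A * ∫⁻ s, B * f s ^ 2 ∂halfLine := by
        refine mul_le_mul_right (lintegral_mono_ae ?_) _
        filter_upwards [ae_restrict_mem measurableSet_Ioi, hv0] with s hs hvs
        have : ∀ r, v r ^ 2 * (k r s * (f s * (v s)⁻¹) ^ 2) =
            (f s * (v s)⁻¹) ^ 2 * (k r s * v r ^ 2) := fun r => by ring
        simp only [this]
        rw [lintegral_const_mul (f := fun r => k r s * v r ^ 2) _
          (hk.of_uncurry_right.mul (hv.pow_const _))]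
        refine (mul_le_mul_right (h2 s hs) _).trans (le_of_eq ?_)
        have hv2 : (v s)⁻¹ ^ 2 * v s ^ 2 = 1 := by
          rw [← mul_pow, ENNReal.inv_mul_cancel hvs.1 hvs.2, one_pow]
        rw [mul_pow, mul_left_comm, mul_assoc (f s ^ 2), hv2, mul_one]
    _ = _ := by
        rw [lintegral_const_mul' _ _ ENNReal.coe_ne_top, ← mul_assoc]
        simp

theorem L2Kernel.mono {k k' : ℝ → ℝ → ℝ≥0∞} (hk : L2Kernel k) (C : ℝ≥0)
    (h : ∀ r s : ℝ, 0 < r → 0 < s → k' r s ≤ C * k r s) : L2Kernel k' := by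
  obtain ⟨A, hA⟩ := hk
  refine ⟨C ^ 2 * A, fun f hf => ?_⟩
  calc ∫⁻ r, (∫⁻ s, k' r s * f s ∂halfLine) ^ 2 ∂halfLine
      ≤ ∫⁻ r, C ^ 2 * (∫⁻ s, k r s * f s ∂halfLine) ^ 2 ∂halfLine := by
        refine lintegral_mono_ae ?_
        filter_upwards [ae_restrict_mem measurableSet_Ioi] with r hr
        rw [← mul_pow, ← lintegral_const_mul' _ _ ENNReal.coe_ne_top]
        refine pow_le_pow_left' (lintegral_mono_ae ?_) 2
        filter_upwards [ae_restrict_mem measurableSet_Ioi] with s hs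
        rw [← mul_assoc]
        exact mul_le_mul_left (h r s hr hs) _
    _ = C ^ 2 * ∫⁻ r, (∫⁻ s, k r s * f s ∂halfLine) ^ 2 ∂halfLine :=
        lintegral_const_mul' _ _ (by simp)
    _ ≤ C ^ 2 * (A * ∫⁻ s, f s ^ 2 ∂halfLine) := mul_le_mul_right (hA f hf) _
    _ = _ := by
        rw [← mul_assoc]
        push_cast
        rfl

theorem sq_add_le (a b : ℝ≥0∞) : (a + b) ^ 2 ≤ 4 * a ^ 2 + 4 * b ^ 2 := by
  have h : ∀ {x y : ℝ≥0∞}, x ≤ y → (x + y) ^ 2 ≤ 4 * y ^ 2 := fun {x y} hxy =>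
    (pow_le_pow_left' (add_le_add_left hxy y) 2).trans (le_of_eq (by ring))
  rcases le_total a b with hab | hab
  · exact (h hab).trans le_add_self
  · rw [add_comm a b]
    exact (h hab).trans le_self_add

theorem L2Kernel.add {k k' : ℝ → ℝ → ℝ≥0∞} (hk : L2Kernel k) (hk' : L2Kernel k')
    (hm : Measurable (Function.uncurry k)) :
    L2Kernel fun r s => k r s + k' r s := by
  obtain ⟨A, hA⟩ := hk
  obtain ⟨B, hB⟩ := hk'
  refine ⟨4 * A + 4 * B, fun f hf => ?_⟩
  have hmeas : AEMeasurable (fun r => 4 * (∫⁻ s, k r s * f s ∂halfLine) ^ 2) halfLine := by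
    have h1 : Measurable fun r => ∫⁻ s, k r s * hf.mk f s ∂halfLine :=
      Measurable.lintegral_prod_right
        (hm.mul (hf.measurable_mk.comp measurable_snd))
    have h2 : ∀ r, ∫⁻ s, k r s * f s ∂halfLine = ∫⁻ s, k r s * hf.mk f s ∂halfLine := fun r =>
      lintegral_congr_ae (by filter_upwards [hf.ae_eq_mk] with s hs; rw [hs])
    simp only [h2]
    exact ((h1.pow_const 2).const_mul 4).aemeasurable
  calc ∫⁻ r, (∫⁻ s, (k r s + k' r s) * f s ∂halfLine) ^ 2 ∂halfLine
      ≤ ∫⁻ r, (4 * (∫⁻ s, k r s * f s ∂halfLine) ^ 2 +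
          4 * (∫⁻ s, k' r s * f s ∂halfLine) ^ 2) ∂halfLine := by
        refine lintegral_mono fun r => ?_
        simp only [add_mul]
        rw [lintegral_add_left' (f := fun s => k r s * f s) (hm.of_uncurry_left.aemeasurable.mul hf)]
        exact sq_add_le _ _
    _ ≤ 4 * (A * ∫⁻ s, f s ^ 2 ∂halfLine) + 4 * (B * ∫⁻ s, f s ^ 2 ∂halfLine) := by
        rw [lintegral_add_left' hmeas, lintegral_const_mul' _ _ (by simp),
          lintegral_const_mul' _ _ (by simp)]
        exact add_le_add (mul_le_mul_right (hA f hf) _) (mul_le_mul_right (hB f hf) _)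
    _ = _ := by
        push_cast
        ring

theorem integrable_exp_mul_abs_real {ε : ℝ} (hε : 0 < ε) :
    Integrable fun x : ℝ => Real.exp (-ε * |x|) := by
  rw [← integrableOn_univ, ← Iic_union_Ioi (a := (0 : ℝ))]
  refine IntegrableOn.union ?_ ?_
  · refine (integrableOn_exp_mul_Iic hε 0).congr_fun (fun x hx => ?_) measurableSet_Iic
    simp [abs_of_nonpos (mem_Iic.1 hx)]
  · refine (integrableOn_exp_mul_Ioi (neg_lt_zero.2 hε) 0).congr_fun (fun x hx => ?_)
      measurableSet_Ioi
    simp [abs_of_pos (mem_Ioi.1 hx)]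

/-- Schur test with constant weight: by translation invariance every row and column integral is at
most the integral of e^{-ε|x|} over the line. -/
theorem l2Kernel_exp {ε : ℝ} (hε : 0 < ε) :
    L2Kernel fun r s => ENNReal.ofReal (Real.exp (-ε * |r - s|)) := by
  obtain ⟨A, hA⟩ : ∃ A : ℝ≥0, ∫⁻ x : ℝ, ENNReal.ofReal (Real.exp (-ε * |x|)) = A :=
    ⟨_, (ENNReal.coe_toNNReal (integrable_exp_mul_abs_real hε).lintegral_lt_top.ne).symm⟩
  have h : ∀ r : ℝ, ∫⁻ s, ENNReal.ofReal (Real.exp (-ε * |r - s|)) * 1 ^ 2 ∂halfLine ≤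
      A * 1 ^ 2 := fun r => by
    simp only [one_pow, mul_one]
    refine (lintegral_mono' Measure.restrict_le_self le_rfl).trans (le_of_eq ?_)
    rw [← hA, lintegral_sub_left_eq_self (μ := volume)
      (fun x => ENNReal.ofReal (Real.exp (-ε * |x|))) r]
  refine l2Kernel_of_schur (v := fun _ => 1) (A := A) (B := A) ?_ measurable_const (by simp)
    (fun r _ => h r) fun s _ => ?_
  · exact (by fun_prop : Continuous fun p : ℝ × ℝ =>
      Real.exp (-ε * |p.1 - p.2|)).measurable.ennreal_ofReal
  · simp only [abs_sub_comm _ s]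
    exact h s

/-- This Hardy-type kernel is homogeneous of degree -1, so a power weight suits the Schur test. With
v² = s^{-1/2} the parts s ≤ r and s > r each contribute 2r^{-1/2}, which gives the constant 4. -/
theorem l2Kernel_max_inv : L2Kernel fun r s => ENNReal.ofReal (max r s)⁻¹ := by
  have h : ∀ r : ℝ, 0 < r → ∫⁻ s, ENNReal.ofReal (max r s)⁻¹ *
      ENNReal.ofReal (s ^ (-(1 / 4) : ℝ)) ^ 2 ∂halfLine ≤
      (4 : ℝ≥0) * ENNReal.ofReal (r ^ (-(1 / 4) : ℝ)) ^ 2 := fun r hr => by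
    have hsq : ∀ s : ℝ, 0 < s →
        ENNReal.ofReal (s ^ (-(1 / 4) : ℝ)) ^ 2 = ENNReal.ofReal (s ^ (-(1 / 2) : ℝ)) := by
      intro s hs
      rw [← ENNReal.ofReal_pow (by positivity), ← Real.rpow_natCast, ← Real.rpow_mul hs.le]
      norm_num
    have i1 : IntegrableOn (fun s : ℝ => s ^ (-(1 / 2) : ℝ)) (Ioc 0 r) :=
      (intervalIntegrable_iff_integrableOn_Ioc_of_le hr.le).1
        (intervalIntegral.intervalIntegrable_rpow' (by norm_num))
    have i2 : IntegrableOn (fun s : ℝ => s ^ (-(3 / 2) : ℝ)) (Ioi r) :=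
      integrableOn_Ioi_rpow_of_lt (by norm_num) hr
    have e1 : ∫⁻ s in Ioc 0 r, ENNReal.ofReal (max r s)⁻¹ *
        ENNReal.ofReal (s ^ (-(1 / 4) : ℝ)) ^ 2 = ENNReal.ofReal (2 * r ^ (-(1 / 2) : ℝ)) := by
      have : ∀ s ∈ Ioc 0 r, ENNReal.ofReal (max r s)⁻¹ *
          ENNReal.ofReal (s ^ (-(1 / 4) : ℝ)) ^ 2 =
          ENNReal.ofReal r⁻¹ * ENNReal.ofReal (s ^ (-(1 / 2) : ℝ)) := fun s hs => by
        rw [max_eq_left hs.2, hsq s hs.1]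
      rw [setLIntegral_congr_fun measurableSet_Ioc this,
        lintegral_const_mul' _ _ ENNReal.ofReal_ne_top, ← ofReal_integral_eq_lintegral_ofReal i1,
        ← intervalIntegral.integral_of_le hr.le, integral_rpow (by norm_num),
        ← ENNReal.ofReal_mul (by positivity)]
      · congr 1
        rw [Real.zero_rpow (by norm_num), sub_zero, ← Real.rpow_neg_one]
        rw [show (-(1 / 2) + 1 : ℝ) = 1 / 2 by norm_num, mul_div_assoc', ← Real.rpow_add hr]
        norm_num
        ring
      · filter_upwards [ae_restrict_mem measurableSet_Ioc] with s hs
        exact Real.rpow_nonneg hs.1.le _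
    have e2 : ∫⁻ s in Ioi r, ENNReal.ofReal (max r s)⁻¹ *
        ENNReal.ofReal (s ^ (-(1 / 4) : ℝ)) ^ 2 = ENNReal.ofReal (2 * r ^ (-(1 / 2) : ℝ)) := by
      have : ∀ s ∈ Ioi r, ENNReal.ofReal (max r s)⁻¹ *
          ENNReal.ofReal (s ^ (-(1 / 4) : ℝ)) ^ 2 = ENNReal.ofReal (s ^ (-(3 / 2) : ℝ)) := by
        intro s hs
        have hs0 : 0 < s := hr.trans hs
        rw [max_eq_right (le_of_lt hs), hsq s hs0, ← ENNReal.ofReal_mul (by positivity),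
          ← Real.rpow_neg_one, ← Real.rpow_add hs0]
        norm_num
      rw [setLIntegral_congr_fun measurableSet_Ioi this,
        ← ofReal_integral_eq_lintegral_ofReal i2, integral_Ioi_rpow_of_lt (by norm_num) hr]
      · congr 1
        norm_num
        ring
      · filter_upwards [ae_restrict_mem measurableSet_Ioi] with s hs
        exact Real.rpow_nonneg (hr.trans hs).le _
    rw [halfLine, ← Ioc_union_Ioi_eq_Ioi hr.le, lintegral_union measurableSet_Ioi
      (Ioc_disjoint_Ioi le_rfl), e1, e2, hsq r hr, ← ENNReal.ofReal_add (by positivity)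
      (by positivity)]
    refine le_of_eq ?_
    rw [← two_mul, ← mul_assoc, ENNReal.ofReal_mul (by norm_num)]
    norm_num
  refine l2Kernel_of_schur (v := fun s => ENNReal.ofReal (s ^ (-(1 / 4) : ℝ))) (A := 4) (B := 4)
    ?_ ?_ ?_ h fun s hs => ?_
  · exact ((measurable_fst.max measurable_snd).inv).ennreal_ofReal
  · exact (measurable_id.pow_const _).ennreal_ofReal
  · filter_upwards [ae_restrict_mem measurableSet_Ioi] with s hs
    refine ⟨?_, ENNReal.ofReal_ne_top⟩
    rw [Ne, ENNReal.ofReal_eq_zero, not_le]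
    exact Real.rpow_pos_of_pos hs _
  · simp only [max_comm _ s]
    exact h s hs

theorem L2Kernel.exists_eLpNorm_le {k : ℝ → ℝ → ℝ≥0∞} (hk : L2Kernel k) :
    ∃ C : ℝ≥0, ∀ f U : ℝ → ℂ, AEStronglyMeasurable f halfLine →
      (∀ r : ℝ, 0 < r → ‖U r‖ₑ ≤ ∫⁻ s, k r s * ‖f s‖ₑ ∂halfLine) →
      eLpNorm U 2 halfLine ≤ C * eLpNorm f 2 halfLine := by
  obtain ⟨A, hA⟩ := hk
  -- The bound for squares has constant A; using A ≤ (A + 1)² avoids a square root.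
  refine ⟨A + 1, fun f U hf hU => ?_⟩
  have e : ∀ g : ℝ → ℂ, eLpNorm g 2 halfLine ^ 2 = ∫⁻ x, ‖g x‖ₑ ^ 2 ∂halfLine := fun g => by
    have := eLpNorm_nnreal_pow_eq_lintegral (f := g) (μ := halfLine) (p := 2) (by norm_num)
    simpa using this
  rw [← ENNReal.pow_le_pow_left_iff two_ne_zero, mul_pow, e, e]
  calc ∫⁻ x, ‖U x‖ₑ ^ 2 ∂halfLine
      ≤ ∫⁻ r, (∫⁻ s, k r s * ‖f s‖ₑ ∂halfLine) ^ 2 ∂halfLine := by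
        refine lintegral_mono_ae ?_
        filter_upwards [ae_restrict_mem measurableSet_Ioi] with r hr
        exact pow_le_pow_left' (hU r hr) 2
    _ ≤ A * ∫⁻ s, ‖f s‖ₑ ^ 2 ∂halfLine := hA _ hf.enorm
    _ ≤ _ := by
        refine mul_le_mul_left ?_ _
        have : A ≤ (A + 1) ^ 2 := by
          rw [add_sq]
          refine le_trans ?_ le_self_add
          refine le_trans ?_ le_add_self
          rw [mul_one, two_mul]
          exact le_self_add
        exact_mod_cast this

end RadialCube

end

noncomputable section

namespace RadialCube

/-! ### Locally absolutely continuous functions on the half-line -/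

/-- On `(0, ∞)` the function `u` is a primitive of the locally integrable function `f`. -/
def IsPrimitive (u f : ℝ → ℂ) : Prop :=
  ∀ a b : ℝ, 0 < a → 0 < b → IntervalIntegrable f volume a b ∧ u b - u a = ∫ x in a..b, f x

theorem uIcc_subset_Ioi_zero {a b : ℝ} (ha : 0 < a) (hb : 0 < b) : uIcc a b ⊆ Ioi (0 : ℝ) :=
  fun _ hx => (lt_min ha hb).trans_le hx.1

/-- The real and imaginary parts are treated separately and recombined. -/
theorem absolutelyContinuousOnInterval_integral_complex {f : ℝ → ℂ} {a b : ℝ}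
    (hf : IntervalIntegrable f volume a b) :
    AbsolutelyContinuousOnInterval (fun x => ∫ t in a..x, f t) a b := by
  have hre : IntervalIntegrable (fun t => (f t).re) volume a b := ⟨hf.1.re, hf.2.re⟩
  have him : IntervalIntegrable (fun t => (f t).im) volume a b := ⟨hf.1.im, hf.2.im⟩
  have hc : ∀ c : ℂ, AbsolutelyContinuousOnInterval (fun _ : ℝ => c) a b := fun c =>
    ContDiffOn.absolutelyContinuousOnInterval contDiffOn_const
  have h := ((hre.absolutelyContinuousOnInterval_intervalIntegral (c := a) left_mem_uIcc).smul
    (hc 1)).add ((him.absolutelyContinuousOnInterval_intervalIntegral (c := a)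
      left_mem_uIcc).smul (hc Complex.I))
  have he : ∀ x ∈ uIcc a b, ∫ t in a..x, f t =
      (∫ t in a..x, (f t).re) • (1 : ℂ) + (∫ t in a..x, (f t).im) • Complex.I := by
    intro x hx
    have hsub : uIcc a x ⊆ uIcc a b := uIcc_subset_uIcc_left hx
    have e : ∀ t, f t = ((f t).re : ℂ) + ((f t).im : ℂ) * Complex.I := fun t =>
      (Complex.re_add_im (f t)).symm
    have i1 : IntervalIntegrable (fun t => ((f t).re : ℂ)) volume a x :=
      ⟨(hre.mono_set hsub).1.ofReal, (hre.mono_set hsub).2.ofReal⟩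
    have i2 : IntervalIntegrable (fun t => ((f t).im : ℂ) * Complex.I) volume a x :=
      ⟨(him.mono_set hsub).1.ofReal.mul_const _, (him.mono_set hsub).2.ofReal.mul_const _⟩
    rw [intervalIntegral.integral_congr fun t _ => e t, intervalIntegral.integral_add i1 i2,
      intervalIntegral.integral_mul_const, intervalIntegral.integral_ofReal,
      intervalIntegral.integral_ofReal]
    simp
  rw [absolutelyContinuousOnInterval_iff] at h ⊢
  intro ε hε
  obtain ⟨δ, hδ, hE⟩ := h ε hε
  refine ⟨δ, hδ, fun E hd hl => lt_of_eq_of_lt (Finset.sum_congr rfl fun i hi => ?_) (hE E hd hl)⟩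
  obtain ⟨h1, h2⟩ := hd.1 i hi
  simp only [he _ h1, he _ h2]
  rfl

theorem IsPrimitive.congr {u v f g : ℝ → ℂ} (h : IsPrimitive u f)
    (hu : ∀ x : ℝ, 0 < x → v x = u x) (hf : ∀ x : ℝ, 0 < x → g x = f x) : IsPrimitive v g := by
  intro a b ha hb
  obtain ⟨h1, h2⟩ := h a b ha hb
  have he : EqOn f g (uIcc a b) := fun x hx => (hf x (uIcc_subset_Ioi_zero ha hb hx)).symm
  refine ⟨h1.congr (he.mono uIoc_subset_uIcc), ?_⟩
  rw [hu a ha, hu b hb, h2, intervalIntegral.integral_congr he]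

theorem IsPrimitive.add {u v f g : ℝ → ℂ} (h : IsPrimitive u f) (h' : IsPrimitive v g) :
    IsPrimitive (fun x => u x + v x) (fun x => f x + g x) := by
  intro a b ha hb
  obtain ⟨h1, h2⟩ := h a b ha hb
  obtain ⟨h1', h2'⟩ := h' a b ha hb
  refine ⟨h1.add h1', ?_⟩
  rw [intervalIntegral.integral_add h1 h1', ← h2, ← h2']
  ring

theorem IsPrimitive.const_mul {u f : ℝ → ℂ} (c : ℂ) (h : IsPrimitive u f) :
    IsPrimitive (fun x => c * u x) (fun x => c * f x) := by
  intro a b ha hb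
  obtain ⟨h1, h2⟩ := h a b ha hb
  refine ⟨h1.const_mul c, ?_⟩
  rw [intervalIntegral.integral_const_mul, ← h2]
  ring

theorem IsPrimitive.sum {ι : Type*} {s : Finset ι} {u f : ι → ℝ → ℂ}
    (h : ∀ i ∈ s, IsPrimitive (u i) (f i)) :
    IsPrimitive (fun x => ∑ i ∈ s, u i x) (fun x => ∑ i ∈ s, f i x) := by
  classical
  induction s using Finset.induction_on with
  | empty => exact fun a b _ _ => ⟨by simp, by simp⟩
  | insert i s hi ih =>
    simp only [Finset.sum_insert hi]
    exact (h i (Finset.mem_insert_self i s)).add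
      (ih fun j hj => h j (Finset.mem_insert_of_mem hj))

theorem IsPrimitive.continuousOn {u f : ℝ → ℂ} (h : IsPrimitive u f) :
    ContinuousOn u (Ioi 0) := by
  intro r hr
  have hr' : (0 : ℝ) < r := hr
  refine ContinuousAt.continuousWithinAt ?_
  obtain ⟨h1, -⟩ := h (r / 2) (r + 1) (by positivity) (by positivity)
  have hc := (intervalIntegral.continuousOn_primitive_interval' h1 left_mem_uIcc).continuousAt
    (x := r) (by
      rw [uIcc_of_le (by linarith)]
      exact Icc_mem_nhds (by linarith) (by linarith))
  refine (hc.const_add (u (r / 2))).congr ?_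
  filter_upwards [eventually_gt_nhds hr'] with x hx
  rw [← (h (r / 2) x (by positivity) hx).2]
  ring

theorem IsPrimitive.hasDerivAt {u f : ℝ → ℂ} (h : IsPrimitive u f) (hf : ContinuousOn f (Ioi 0))
    {r : ℝ} (hr : 0 < r) : HasDerivAt u (f r) r := by
  have hd : HasDerivAt (fun x => u r + ∫ t in r..x, f t) (f r) r := by
    refine (intervalIntegral.integral_hasDerivAt_right (h r r hr hr).1 ?_
      (hf.continuousAt (Ioi_mem_nhds hr))).const_add _
    exact hf.stronglyMeasurableAtFilter isOpen_Ioi r hr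
  refine hd.congr_of_eventuallyEq ?_
  filter_upwards [eventually_gt_nhds hr] with x hx
  rw [← (h r x hr hx).2]
  ring

/-- The product rule. -/
theorem IsPrimitive.mul {u f φ : ℝ → ℂ} (h : IsPrimitive u f)
    (hφ : ∀ x : ℝ, 0 < x → ContDiffAt ℝ 1 φ x) :
    IsPrimitive (fun x => φ x * u x) (fun x => deriv φ x * u x + φ x * f x) := by
  intro a b ha hb
  obtain ⟨h1, h2⟩ := h a b ha hb
  have hsub := uIcc_subset_Ioi_zero ha hb
  have hφd : ∀ x : ℝ, 0 < x → HasDerivAt φ (deriv φ x) x := fun x hx =>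
    ((hφ x hx).differentiableAt one_ne_zero).hasDerivAt
  have hc : ContinuousOn φ (uIcc a b) := fun x hx =>
    (hφ x (hsub hx)).continuousAt.continuousWithinAt
  have hc' : ContinuousOn (deriv φ) (uIcc a b) := fun x hx => by
    have := (contDiffAt_iteratedDeriv (n := 0) (m := 1) (by exact_mod_cast hφ x (hsub hx)))
    rw [iteratedDeriv_one] at this
    exact this.continuousAt.continuousWithinAt
  have hi : IntervalIntegrable (fun x => deriv φ x * u x + φ x * f x) volume a b :=
    ((hc'.mul (h.continuousOn.mono hsub)).intervalIntegrable).add (h1.continuousOn_mul hc)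
  refine ⟨hi, ?_⟩
  have hac1 : AbsolutelyContinuousOnInterval φ a b :=
    ContDiffOn.absolutelyContinuousOnInterval fun x hx => (hφ x (hsub hx)).contDiffWithinAt
  have hacu : AbsolutelyContinuousOnInterval (fun x => u a + ∫ t in a..x, f t) a b :=
    (ContDiffOn.absolutelyContinuousOnInterval contDiffOn_const).add
      (absolutelyContinuousOnInterval_integral_complex h1)
  -- The product minus the primitive of the expected derivative is absolutely continuous with zero
  -- derivative almost everywhere, hence constant.
  have hac := (hac1.smul hacu).sub (absolutelyContinuousOnInterval_integral_complex hi)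
  obtain ⟨C, hC⟩ := hac.const_of_ae_hasDerivAt_zero (by
    filter_upwards [h1.ae_hasDerivAt_integral, hi.ae_hasDerivAt_integral] with x hx1 hx2 hx
    have d1 := (hx1 hx a left_mem_uIcc).const_add (u a)
    have d2 := ((hφd x (hsub hx)).mul d1).sub (hx2 hx a left_mem_uIcc)
    refine d2.congr_deriv ?_
    rw [← (h a x ha (hsub hx)).2]
    ring)
  have ea := hC a left_mem_uIcc
  have eb := hC b right_mem_uIcc
  simp only [Pi.sub_apply, smul_eq_mul, Pi.mul_apply, intervalIntegral.integral_same, add_zero,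
    sub_zero, ← h2] at ea eb
  linear_combination eb - ea

end RadialCube

end

noncomputable section

namespace RadialCube

/-! ### The integral operator with the resolvent kernel -/

theorem memLp_exp_neg {ε : ℝ} (hε : 0 < ε) (c : ℝ) :
    MemLp (fun s : ℝ => Real.exp (-ε * s)) 2 (volume.restrict (Ioi c)) := by
  rw [memLp_two_iff_integrable_sq (by fun_prop)]
  refine (integrableOn_exp_mul_Ioi (a := -(2 * ε)) (by linarith) c).congr_fun (fun s _ => ?_)
    measurableSet_Ioi
  simp only [← Real.exp_nat_mul]
  congr 1
  push_cast
  ring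

theorem integrableOn_exp_mul_norm {f : ℝ → ℂ} (hf : MemLp f 2 halfLine) {ε : ℝ} (hε : 0 < ε) :
    IntegrableOn (fun s => Real.exp (-ε * s) * ‖f s‖) (Ioi 0) :=
  (memLp_exp_neg hε 0).integrable_mul hf.norm

theorem integrableOn_mul_of_le_exp {f φ : ℝ → ℂ} (hf : MemLp f 2 halfLine) {ε C : ℝ} (hε : 0 < ε)
    {S : Set ℝ} (hS : MeasurableSet S) (hS0 : S ⊆ Ioi 0) (hφ : ContinuousOn φ (Ioi 0))
    (hb : ∀ s ∈ S, ‖φ s‖ ≤ C * Real.exp (-ε * s)) : IntegrableOn (fun s => φ s * f s) S := by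
  refine Integrable.mono' (((integrableOn_exp_mul_norm hf hε).mono_set hS0).const_mul C)
    (((hφ.mono hS0).aestronglyMeasurable hS).mul
      (hf.aestronglyMeasurable.mono_measure (Measure.restrict_mono hS0 le_rfl))) ?_
  filter_upwards [ae_restrict_mem hS] with s hs
  rw [norm_mul, ← mul_assoc]
  exact mul_le_mul_of_nonneg_right (hb s hs) (norm_nonneg _)

theorem contDiffOn_of_hasDerivAt {u : ℕ → ℝ → ℂ} {n : ℕ}
    (h : ∀ j < n, ∀ r : ℝ, 0 < r → HasDerivAt (u j) (u (j + 1) r) r)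
    (hc : ContinuousOn (u n) (Ioi 0)) : ContDiffOn ℝ n (u 0) (Ioi 0) := by
  induction n generalizing u with
  | zero => exact contDiffOn_zero.2 hc
  | succ n ih =>
    push_cast
    rw [contDiffOn_succ_iff_deriv_of_isOpen isOpen_Ioi]
    refine ⟨fun r hr => (h 0 n.succ_pos r hr).differentiableAt.differentiableWithinAt,
      fun h => absurd h (by simp), ?_⟩
    exact (ih (u := fun j => u (j + 1)) (fun j hj => h (j + 1) (by omega)) hc).congr
      fun r hr => (h 0 n.succ_pos r hr).deriv

/-- The half-line is exhausted by the compact intervals [1/(n+1), n+1], and Lebesgue differentiation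
is applied on each. -/
theorem IsPrimitive.ae_hasDerivAt {u f : ℝ → ℂ} (h : IsPrimitive u f) :
    ∀ᵐ r ∂halfLine, HasDerivAt u (f r) r := by
  rw [ae_restrict_iff' measurableSet_Ioi]
  have h1 : ∀ n : ℕ, ∀ᵐ r : ℝ, r ∈ uIcc ((n : ℝ) + 1)⁻¹ (n + 1) → ∀ c ∈ uIcc ((n : ℝ) + 1)⁻¹ (n + 1),
      HasDerivAt (fun x => ∫ t in c..x, f t) (f r) r := fun n =>
    (h _ _ (by positivity) (by positivity)).1.ae_hasDerivAt_integral
  filter_upwards [ae_all_iff.2 h1] with r hr hr0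
  have hr0 : (0 : ℝ) < r := hr0
  obtain ⟨n, hn⟩ := exists_nat_gt (max r r⁻¹)
  have hmem : r ∈ uIcc ((n : ℝ) + 1)⁻¹ (n + 1) := by
    have h1 := (le_max_left r r⁻¹).trans hn.le
    have h2 := (le_max_right r r⁻¹).trans hn.le
    refine Icc_subset_uIcc ⟨?_, by linarith⟩
    rw [inv_le_comm₀ (by positivity) hr0]
    linarith
  refine ((hr n hmem r hmem).const_add (u r)).congr_of_eventuallyEq ?_
  filter_upwards [eventually_gt_nhds hr0] with x hx
  rw [← (h r x hr0 hx).2]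
  ring

namespace KernelData

variable {l : ℕ} (D : KernelData l)

theorem continuousOn_iteratedDeriv_g (j : ℕ) (k : Fin 3) :
    ContinuousOn (iteratedDeriv j (D.g k)) (Ioi 0) := continuousOn_iteratedDeriv_psi D.hl _ j

theorem hasDerivAt_iteratedDeriv_h (j : ℕ) (k : Fin 3) {r : ℝ} (hr : 0 < r) :
    HasDerivAt (iteratedDeriv j (D.h k)) (iteratedDeriv (j + 1) (D.h k) r) r := by
  have := (contDiffAt_iteratedDeriv (n := 1) (m := j)
    (D.contDiffAt_h k hr (n := ((1 + j : ℕ) : ℕ∞)))).differentiableAt one_ne_zero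
  rw [iteratedDeriv_succ]
  exact this.hasDerivAt

theorem continuousOn_iteratedDeriv_h (j : ℕ) (k : Fin 3) :
    ContinuousOn (iteratedDeriv j (D.h k)) (Ioi 0) := fun _ hr =>
  (D.hasDerivAt_iteratedDeriv_h j k hr).continuousAt.continuousWithinAt

theorem exists_bound_g_Ioi (k : Fin 3) {c : ℝ} (hc : 0 < c) :
    ∃ C : ℝ, ∀ s ∈ Ioi c, ‖D.g k s‖ ≤ C * Real.exp ((D.a k).re * s) := by
  obtain ⟨A, hA0, hA⟩ := D.exists_bound_g 0 k
  have hcont : ContinuousOn (D.g k) (Icc c 1) :=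
    (D.continuousOn_iteratedDeriv_g 0 k).mono fun x hx => hc.trans_le hx.1
  obtain ⟨B, hB⟩ := isCompact_Icc.exists_bound_of_continuousOn hcont
  refine ⟨A + |B| * Real.exp (-(D.a k).re), fun s hs => ?_⟩
  have hk := D.re_neg k
  rcases le_total 1 s with h1 | h1
  · refine (hA s h1).trans (mul_le_mul_of_nonneg_right ?_ (Real.exp_nonneg _))
    exact le_add_of_nonneg_right (by positivity)
  · refine (hB s ⟨(mem_Ioi.1 hs).le, h1⟩).trans ?_
    have : 1 ≤ Real.exp (-(D.a k).re) * Real.exp ((D.a k).re * s) := by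
      rw [← Real.exp_add]
      exact Real.one_le_exp (by nlinarith)
    have h2 : |B| * 1 ≤ |B| * (Real.exp (-(D.a k).re) * Real.exp ((D.a k).re * s)) :=
      mul_le_mul_of_nonneg_left this (abs_nonneg B)
    have h3 : 0 ≤ A * Real.exp ((D.a k).re * s) := by positivity
    linarith [le_abs_self B]

variable {f : ℝ → ℂ}

theorem integrableOn_g_mul (hf : MemLp f 2 halfLine) (k : Fin 3) {c : ℝ} (hc : 0 < c) :
    IntegrableOn (fun s => D.g k s * f s) (Ioi c) := by
  obtain ⟨C, hC⟩ := D.exists_bound_g_Ioi k hc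
  refine integrableOn_mul_of_le_exp hf (neg_pos.2 (D.re_neg k)) measurableSet_Ioi
    (Ioi_subset_Ioi hc.le) (D.continuousOn_iteratedDeriv_g 0 k) (C := C) fun s hs => ?_
  rw [neg_neg]
  exact hC s hs

theorem integrableOn_h_mul (hf : MemLp f 2 halfLine) (k : Fin 3) (c : ℝ) :
    IntegrableOn (fun s => D.h k s * f s) (Ioc 0 c) := by
  obtain ⟨C, hC0, hC⟩ := D.exists_bound_h 0 k
  have hk := D.re_neg k
  refine integrableOn_mul_of_le_exp hf one_pos measurableSet_Ioc
    (fun s hs => hs.1) (D.continuousOn_iteratedDeriv_h 0 k)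
    (C := C * Real.exp (-(D.a k).re * c + c)) fun s hs => ?_
  refine (hC s hs.1).trans ?_
  rw [mul_assoc, ← Real.exp_add]
  refine mul_le_mul_of_nonneg_left (Real.exp_le_exp.2 ?_) hC0
  nlinarith [hs.1, hs.2]

/-- The integral of `h_k f` over `(0, r)`. -/
def lowInt (k : Fin 3) (f : ℝ → ℂ) (r : ℝ) : ℂ := ∫ s in (0 : ℝ)..r, D.h k s * f s

/-- The integral of `g_k f` over `(r, ∞)`. -/
def upInt (k : Fin 3) (f : ℝ → ℂ) (r : ℝ) : ℂ := ∫ s in Ioi r, D.g k s * f s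

theorem intervalIntegrable_h_mul (hf : MemLp f 2 halfLine) (k : Fin 3) {c : ℝ} (hc : 0 < c) :
    IntervalIntegrable (fun s => D.h k s * f s) volume 0 c :=
  (intervalIntegrable_iff_integrableOn_Ioc_of_le hc.le).2 (D.integrableOn_h_mul hf k c)

theorem isPrimitive_lowInt (hf : MemLp f 2 halfLine) (k : Fin 3) :
    IsPrimitive (D.lowInt k f) (fun s => D.h k s * f s) := fun _ _ ha hb =>
  ⟨(D.intervalIntegrable_h_mul hf k ha).symm.trans (D.intervalIntegrable_h_mul hf k hb),
    intervalIntegral.integral_interval_sub_left (D.intervalIntegrable_h_mul hf k hb)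
      (D.intervalIntegrable_h_mul hf k ha)⟩

theorem isPrimitive_upInt (hf : MemLp f 2 halfLine) (k : Fin 3) :
    IsPrimitive (D.upInt k f) (fun s => -(D.g k s * f s)) := fun a b ha hb => by
  have hi : IntervalIntegrable (fun s => D.g k s * f s) volume a b := by
    rw [intervalIntegrable_iff]
    exact (D.integrableOn_g_mul hf k (lt_min ha hb)).mono_set fun x hx => hx.1
  refine ⟨hi.neg, ?_⟩
  rw [intervalIntegral.integral_neg, ← intervalIntegral.integral_Ioi_sub_Ioi'
    (D.integrableOn_g_mul hf k ha) (D.integrableOn_g_mul hf k hb), neg_sub]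
  rfl

/-- The combinations `∑ c_k (G_k ∫_{s<r} h_k f + H_k ∫_{s>r} g_k f)`. -/
def conv (G H : Fin 3 → ℝ → ℂ) (f : ℝ → ℂ) (r : ℝ) : ℂ :=
  ∑ k, D.cc k * (G k r * D.lowInt k f r + H k r * D.upInt k f r)

/-- Variation of constants: differentiating the limits of integration adds f times the jump on the
diagonal of the kernel built from G and H. -/
theorem isPrimitive_conv (hf : MemLp f 2 halfLine) {G H : Fin 3 → ℝ → ℂ}
    (hG : ∀ k, ∀ r : ℝ, 0 < r → ContDiffAt ℝ 1 (G k) r)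
    (hH : ∀ k, ∀ r : ℝ, 0 < r → ContDiffAt ℝ 1 (H k) r) :
    IsPrimitive (D.conv G H f) (fun r => D.conv (fun k => deriv (G k)) (fun k => deriv (H k)) f r +
      (∑ k, D.cc k * (G k r * D.h k r - H k r * D.g k r)) * f r) := by
  have h := IsPrimitive.sum (s := Finset.univ) fun k _ =>
    (((D.isPrimitive_lowInt hf k).mul (hG k)).add
      ((D.isPrimitive_upInt hf k).mul (hH k))).const_mul (D.cc k)
  refine h.congr (fun x _ => rfl) fun x _ => ?_
  simp only [conv, Finset.sum_mul, ← Finset.sum_add_distrib]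
  exact Finset.sum_congr rfl fun k _ => by ring

theorem continuousOn_conv (hf : MemLp f 2 halfLine) {G H : Fin 3 → ℝ → ℂ}
    (hG : ∀ k, ContinuousOn (G k) (Ioi 0)) (hH : ∀ k, ContinuousOn (H k) (Ioi 0)) :
    ContinuousOn (D.conv G H f) (Ioi 0) :=
  continuousOn_finsetSum _ fun k _ => continuousOn_const.mul
    (((hG k).mul (D.isPrimitive_lowInt hf k).continuousOn).add
      ((hH k).mul (D.isPrimitive_upInt hf k).continuousOn))

theorem continuousOn_deriv_of_contDiffAt {φ : ℝ → ℂ}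
    (h : ∀ r : ℝ, 0 < r → ContDiffAt ℝ 1 φ r) : ContinuousOn (deriv φ) (Ioi 0) := fun x hx => by
  have := contDiffAt_iteratedDeriv (n := 0) (m := 1) (by exact_mod_cast h x hx)
  rw [iteratedDeriv_one] at this
  exact this.continuousAt.continuousWithinAt

theorem hasDerivAt_conv (hf : MemLp f 2 halfLine) {G H : Fin 3 → ℝ → ℂ}
    (hG : ∀ k, ∀ r : ℝ, 0 < r → ContDiffAt ℝ 1 (G k) r)
    (hH : ∀ k, ∀ r : ℝ, 0 < r → ContDiffAt ℝ 1 (H k) r)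
    (hw : ∀ r : ℝ, 0 < r → ∑ k, D.cc k * (G k r * D.h k r - H k r * D.g k r) = 0) {r : ℝ}
    (hr : 0 < r) :
    HasDerivAt (D.conv G H f) (D.conv (fun k => deriv (G k)) (fun k => deriv (H k)) f r) r := by
  have h : IsPrimitive (D.conv G H f) (D.conv (fun k => deriv (G k)) (fun k => deriv (H k)) f) :=
    (D.isPrimitive_conv hf hG hH).congr (fun _ _ => rfl) fun x hx => by
      rw [hw x hx, zero_mul, add_zero]
  exact h.hasDerivAt (D.continuousOn_conv hf (fun k => continuousOn_deriv_of_contDiffAt (hG k))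
    fun k => continuousOn_deriv_of_contDiffAt (hH k)) hr

/-- The integral operator whose kernel is the `j`-th derivative of the resolvent kernel. -/
def convD (j : ℕ) (f : ℝ → ℂ) : ℝ → ℂ :=
  D.conv (fun k => iteratedDeriv j (D.g k)) (fun k => iteratedDeriv j (D.h k)) f

theorem contDiffAt_iteratedDeriv_g (j : ℕ) (k : Fin 3) (r : ℝ) (hr : 0 < r) :
    ContDiffAt ℝ 1 (iteratedDeriv j (D.g k)) r :=
  contDiffAt_iteratedDeriv (n := 1) (D.contDiffAt_g k hr (n := ((1 + j : ℕ) : ℕ∞)))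

theorem contDiffAt_iteratedDeriv_h (j : ℕ) (k : Fin 3) (r : ℝ) (hr : 0 < r) :
    ContDiffAt ℝ 1 (iteratedDeriv j (D.h k)) r :=
  contDiffAt_iteratedDeriv (n := 1) (D.contDiffAt_h k hr (n := ((1 + j : ℕ) : ℕ∞)))

theorem convD_succ (j : ℕ) (f : ℝ → ℂ) : D.convD (j + 1) f =
    D.conv (fun k => deriv (iteratedDeriv j (D.g k))) (fun k => deriv (iteratedDeriv j (D.h k))) f := by
  simp only [convD, iteratedDeriv_succ]

theorem continuousOn_convD (hf : MemLp f 2 halfLine) (j : ℕ) :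
    ContinuousOn (D.convD j f) (Ioi 0) :=
  D.continuousOn_conv hf (D.continuousOn_iteratedDeriv_g j) (D.continuousOn_iteratedDeriv_h j)

theorem hasDerivAt_convD (hf : MemLp f 2 halfLine) {j : ℕ} (hj : j < 5) {r : ℝ} (hr : 0 < r) :
    HasDerivAt (D.convD j f) (D.convD (j + 1) f r) r := by
  rw [convD_succ]
  exact D.hasDerivAt_conv hf (D.contDiffAt_iteratedDeriv_g j) (D.contDiffAt_iteratedDeriv_h j)
    (fun x hx => by rw [D.jump hj.le hx, if_neg hj.ne]) hr

theorem iteratedDeriv_convD (hf : MemLp f 2 halfLine) {j : ℕ} (hj : j ≤ 5) {r : ℝ} (hr : 0 < r) :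
    iteratedDeriv j (D.convD 0 f) r = D.convD j f r :=
  iteratedDeriv_of_hasDerivAt (u := fun j => D.convD j f) (n := 5)
    (fun _ hj _ hr => D.hasDerivAt_convD hf hj hr) j hj r hr

theorem contDiffOn_convD (hf : MemLp f 2 halfLine) :
    ContDiffOn ℝ 5 (D.convD 0 f) (Ioi 0) :=
  contDiffOn_of_hasDerivAt (u := fun j => D.convD j f) (n := 5)
    (fun _ hj _ hr => D.hasDerivAt_convD hf hj hr) (D.continuousOn_convD hf _)

/-- The jump -1 of the fifth derivative is the source of -f, which puts the sixth derivative in L²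
once `convD 6` is known to be bounded. -/
theorem isPrimitive_iteratedDeriv_five_convD (hf : MemLp f 2 halfLine) :
    IsPrimitive (iteratedDeriv 5 (D.convD 0 f)) fun r => D.convD 6 f r - f r :=
  (D.isPrimitive_conv hf (D.contDiffAt_iteratedDeriv_g 5) (D.contDiffAt_iteratedDeriv_h 5)).congr
    (fun x hx => D.iteratedDeriv_convD hf le_rfl hx) fun x hx => by
      rw [D.jump le_rfl hx, if_pos rfl, convD_succ]
      ring

end KernelData

end RadialCube

end

noncomputable section

namespace RadialCube

/-! ### The resolvent kernel as an integral operator on L² -/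

namespace KernelData

variable {l : ℕ} (D : KernelData l) {f : ℝ → ℂ}

theorem integrableOn_ker_low (hf : MemLp f 2 halfLine) (j : ℕ) (r : ℝ) :
    IntegrableOn (fun s => D.ker j r s * f s) (Ioo 0 r) ∧
    ∫ s in Ioo 0 r, D.ker j r s * f s =
      ∑ k, D.cc k * (iteratedDeriv j (D.g k) r * ∫ s in Ioo 0 r, D.h k s * f s) := by
  have hi : ∀ k, IntegrableOn (fun s => D.h k s * f s) (Ioo 0 r) := fun k =>
    (D.integrableOn_h_mul hf k r).mono_set Ioo_subset_Ioc_self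
  have e : EqOn (fun s => D.ker j r s * f s)
      (fun s => ∑ k, D.cc k * iteratedDeriv j (D.g k) r * (D.h k s * f s)) (Ioo 0 r) := by
    intro s hs
    simp only [ker, if_pos hs.2, Finset.sum_mul]
    exact Finset.sum_congr rfl fun k _ => by ring
  constructor
  · exact IntegrableOn.congr_fun (integrable_finsetSum Finset.univ fun k _ =>
      (hi k).const_mul (D.cc k * iteratedDeriv j (D.g k) r)) e.symm measurableSet_Ioo
  · rw [setIntegral_congr_fun measurableSet_Ioo e,
      integral_finsetSum _ fun k _ => (hi k).const_mul _]
    refine Finset.sum_congr rfl fun k _ => ?_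
    rw [integral_const_mul, mul_assoc]

theorem integrableOn_ker_up (hf : MemLp f 2 halfLine) (j : ℕ) {r : ℝ} (hr : 0 < r) :
    IntegrableOn (fun s => D.ker j r s * f s) (Ici r) ∧
    ∫ s in Ici r, D.ker j r s * f s =
      ∑ k, D.cc k * (iteratedDeriv j (D.h k) r * ∫ s in Ici r, D.g k s * f s) := by
  have hi : ∀ k, IntegrableOn (fun s => D.g k s * f s) (Ici r) := fun k =>
    (integrableOn_Ici_iff_integrableOn_Ioi).2 (D.integrableOn_g_mul hf k hr)
  have e : EqOn (fun s => D.ker j r s * f s)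
      (fun s => ∑ k, D.cc k * iteratedDeriv j (D.h k) r * (D.g k s * f s)) (Ici r) := by
    intro s hs
    simp only [ker, if_neg (not_lt.2 (mem_Ici.1 hs)), Finset.sum_mul]
    exact Finset.sum_congr rfl fun k _ => by ring
  constructor
  · exact IntegrableOn.congr_fun (integrable_finsetSum Finset.univ fun k _ =>
      (hi k).const_mul (D.cc k * iteratedDeriv j (D.h k) r)) e.symm measurableSet_Ici
  · rw [setIntegral_congr_fun measurableSet_Ici e,
      integral_finsetSum _ fun k _ => (hi k).const_mul _]
    refine Finset.sum_congr rfl fun k _ => ?_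
    rw [integral_const_mul, mul_assoc]

theorem integrableOn_ker (hf : MemLp f 2 halfLine) (j : ℕ) {r : ℝ} (hr : 0 < r) :
    IntegrableOn (fun s => D.ker j r s * f s) (Ioi 0) := by
  rw [← Ioo_union_Ici_eq_Ioi hr]
  exact (D.integrableOn_ker_low hf j r).1.union (D.integrableOn_ker_up hf j hr).1

theorem convD_eq_integral (hf : MemLp f 2 halfLine) (j : ℕ) {r : ℝ} (hr : 0 < r) :
    D.convD j f r = ∫ s in Ioi (0 : ℝ), D.ker j r s * f s := by
  obtain ⟨h1, e1⟩ := D.integrableOn_ker_low hf j r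
  obtain ⟨h2, e2⟩ := D.integrableOn_ker_up hf j hr
  rw [← Ioo_union_Ici_eq_Ioi hr, setIntegral_union (by
    rw [Set.disjoint_left]
    exact fun x hx hx' => (not_lt.2 (mem_Ici.1 hx')) hx.2) measurableSet_Ici h1 h2, e1, e2,
    ← Finset.sum_add_distrib]
  simp only [convD, conv, lowInt, upInt]
  refine Finset.sum_congr rfl fun k _ => ?_
  rw [intervalIntegral.integral_of_le hr.le, integral_Ioc_eq_integral_Ioo,
    integral_Ici_eq_integral_Ioi, mul_add]

open scoped ENNReal NNReal in
-- Each derivative of the kernel up to order six is dominated by a multiple of the sum of the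
-- exponential kernel and the Hardy-type kernel 1/max(r,s).
theorem exists_eLpNorm_convD_le {j : ℕ} (hj : j ≤ 6) : ∃ C : ℝ≥0, ∀ f : ℝ → ℂ,
    MemLp f 2 halfLine → eLpNorm (D.convD j f) 2 halfLine ≤ C * eLpNorm f 2 halfLine := by
  obtain ⟨ε, hε0, hε⟩ := D.exists_eps
  obtain ⟨C, hC0, hC⟩ := D.ker_bound hε0 hε hj
  have hk : L2Kernel fun r s => ‖D.ker j r s‖ₑ := by
    refine ((l2Kernel_exp hε0).add l2Kernel_max_inv ?_).mono C.toNNReal fun r s hr hs => ?_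
    · exact (by fun_prop : Continuous fun p : ℝ × ℝ =>
        Real.exp (-ε * |p.1 - p.2|)).measurable.ennreal_ofReal
    · have hm : 0 ≤ (max r s)⁻¹ := (inv_pos.2 (lt_max_of_lt_left hr)).le
      rw [← ENNReal.ofReal_add (Real.exp_nonneg _) hm, ← ENNReal.ofReal.eq_1,
        ← ENNReal.ofReal_mul hC0, ← ofReal_norm]
      refine ENNReal.ofReal_le_ofReal ((hC r s hr hs).trans (mul_le_mul_of_nonneg_left ?_ hC0))
      split_ifs
      · exact le_rfl
      · linarith
  obtain ⟨B, hB⟩ := hk.exists_eLpNorm_le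
  refine ⟨B, fun f hf => hB f _ hf.aestronglyMeasurable fun r hr => ?_⟩
  rw [D.convD_eq_integral hf j hr]
  refine (enorm_integral_le_lintegral_enorm _).trans (le_of_eq ?_)
  simp only [enorm_mul]

theorem memLp_convD (hf : MemLp f 2 halfLine) {j : ℕ} (hj : j ≤ 6) :
    MemLp (D.convD j f) 2 halfLine := by
  obtain ⟨C, hC⟩ := D.exists_eLpNorm_convD_le hj
  exact ⟨(D.continuousOn_convD hf j).aestronglyMeasurable measurableSet_Ioi,
    (hC f hf).trans_lt (ENNReal.mul_lt_top ENNReal.coe_lt_top hf.2)⟩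

/-! ### The boundary conditions -/

/-- Dominated convergence as r tends to 0: for j ≤ 5 the kernel bound contains no 1/max(r,s), so C
e^ε e^{-εs}|f(s)| dominates uniformly for r < 1. -/
theorem tendsto_convD (hf : MemLp f 2 halfLine) {j : ℕ} (hj : j ≤ 5) {b : Fin 3 → ℂ}
    (hb : ∀ k, Tendsto (iteratedDeriv j (D.h k)) (𝓝[>] 0) (𝓝 (b k))) :
    IntegrableOn (fun s => (∑ k, D.cc k * (b k * D.g k s)) * f s) (Ioi 0) ∧
    Tendsto (D.convD j f) (𝓝[>] 0)
      (𝓝 (∫ s in Ioi (0 : ℝ), (∑ k, D.cc k * (b k * D.g k s)) * f s)) := by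
  obtain ⟨ε, hε0, hε⟩ := D.exists_eps
  obtain ⟨C, hC0, hC⟩ := D.ker_bound hε0 hε (hj.trans (by norm_num))
  simp only [if_neg (show j ≠ 6 by omega), add_zero] at hC
  have hlim : ∀ s : ℝ, 0 < s →
      Tendsto (fun r => D.ker j r s) (𝓝[>] 0) (𝓝 (∑ k, D.cc k * (b k * D.g k s))) := by
    intro s hs
    have h1 : Tendsto (fun r => ∑ k, D.cc k * (iteratedDeriv j (D.h k) r * D.g k s)) (𝓝[>] 0)
        (𝓝 (∑ k, D.cc k * (b k * D.g k s))) :=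
      tendsto_finsetSum _ fun k _ => ((hb k).mul_const _).const_mul _
    refine h1.congr' ?_
    filter_upwards [mem_nhdsWithin_of_mem_nhds (Iio_mem_nhds hs)] with r hr
    rw [ker, if_neg (not_lt.2 (mem_Iio.1 hr).le)]
  have hbd : ∀ r s : ℝ, 0 < r → r < 1 → 0 < s →
      ‖D.ker j r s‖ ≤ C * Real.exp ε * Real.exp (-ε * s) := by
    intro r s hr hr1 hs
    refine (hC r s hr hs).trans ?_
    rw [mul_assoc, ← Real.exp_add]
    refine mul_le_mul_of_nonneg_left (Real.exp_le_exp.2 ?_) hC0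
    have := neg_abs_le (r - s)
    nlinarith
  have hcont : ContinuousOn (fun s => ∑ k, D.cc k * (b k * D.g k s)) (Ioi 0) :=
    continuousOn_finsetSum _ fun k _ => continuousOn_const.mul
      (continuousOn_const.mul (D.continuousOn_iteratedDeriv_g 0 k))
  constructor
  · refine integrableOn_mul_of_le_exp hf hε0 measurableSet_Ioi subset_rfl hcont
      (C := C * Real.exp ε) fun s hs => ?_
    refine le_of_tendsto (hlim s hs).norm ?_
    filter_upwards [self_mem_nhdsWithin, mem_nhdsWithin_of_mem_nhds (Iio_mem_nhds one_pos)]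
      with r hr hr1 using hbd r s hr hr1 hs
  · have h : Tendsto (fun r => ∫ s in Ioi (0 : ℝ), D.ker j r s * f s) (𝓝[>] 0)
        (𝓝 (∫ s in Ioi (0 : ℝ), (∑ k, D.cc k * (b k * D.g k s)) * f s)) := by
      refine tendsto_integral_filter_of_dominated_convergence
        (fun s => C * Real.exp ε * (Real.exp (-ε * s) * ‖f s‖)) ?_ ?_ ?_ ?_
      · filter_upwards [self_mem_nhdsWithin] with r hr
        exact (D.integrableOn_ker hf j hr).aestronglyMeasurable
      · filter_upwards [self_mem_nhdsWithin, mem_nhdsWithin_of_mem_nhds (Iio_mem_nhds one_pos)]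
          with r hr hr1
        filter_upwards [ae_restrict_mem measurableSet_Ioi] with s hs
        rw [norm_mul, ← mul_assoc]
        exact mul_le_mul_of_nonneg_right (hbd r s hr hr1 hs) (norm_nonneg _)
      · exact (integrableOn_exp_mul_norm hf hε0).const_mul _
      · filter_upwards [ae_restrict_mem measurableSet_Ioi] with s hs
        exact (hlim s hs).mul_const _
    refine h.congr' ?_
    filter_upwards [self_mem_nhdsWithin] with r hr
    exact (D.convD_eq_integral hf j hr).symm

end KernelData

theorem BoundaryRel.sum {l ξ : ℕ} {κ : ℝ} {ι : Type*} (s : Finset ι) {w : ι → ℂ} {b : ι → ℕ → ℂ}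
    (h : ∀ i ∈ s, BoundaryRel l ξ κ (b i)) : BoundaryRel l ξ κ fun j => ∑ i ∈ s, w i * b i j := by
  have key : ∀ (P Q : ι → ℂ) (c : ℂ), (∀ i ∈ s, c * P i = Q i) →
      c * ∑ i ∈ s, w i * P i = ∑ i ∈ s, w i * Q i := fun P Q c hPQ => by
    rw [Finset.mul_sum]
    exact Finset.sum_congr rfl fun i hi => by rw [← hPQ i hi]; ring
  have zero : ∀ (P : ι → ℂ), (∀ i ∈ s, P i = 0) → ∑ i ∈ s, w i * P i = 0 := fun P hP =>
    Finset.sum_eq_zero fun i hi => by rw [hP i hi, mul_zero]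
  unfold BoundaryRel at *
  split_ifs at *
  · exact ⟨zero _ fun i hi => (h i hi).1, zero _ fun i hi => (h i hi).2.1,
      key _ _ _ fun i hi => (h i hi).2.2⟩
  · exact ⟨zero _ fun i hi => (h i hi).1, zero _ fun i hi => (h i hi).2.1,
      key _ _ _ fun i hi => (h i hi).2.2⟩
  · exact ⟨zero _ fun i hi => (h i hi).1, zero _ fun i hi => (h i hi).2.1,
      zero _ fun i hi => (h i hi).2.2.1, key _ _ _ fun i hi => (h i hi).2.2.2⟩

/-- The boundary relations are linear with constant coefficients, and constants commute with the
Bochner integral even without integrability. -/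
theorem BoundaryRel.integral {l ξ : ℕ} {κ : ℝ} {b : ℝ → ℕ → ℂ} (f : ℝ → ℂ)
    (h : ∀ s, BoundaryRel l ξ κ (b s)) :
    BoundaryRel l ξ κ fun j => ∫ s in Ioi (0 : ℝ), b s j * f s := by
  have key : ∀ (P Q : ℝ → ℂ) (c : ℂ), (∀ s, c * P s = Q s) →
      c * ∫ s in Ioi (0 : ℝ), P s * f s = ∫ s in Ioi (0 : ℝ), Q s * f s := fun P Q c hPQ => by
    rw [← integral_const_mul]
    simp only [← hPQ, mul_assoc]
  have zero : ∀ (P : ℝ → ℂ), (∀ s, P s = 0) → ∫ s in Ioi (0 : ℝ), P s * f s = 0 := fun P hP => by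
    simp [hP]
  unfold BoundaryRel at *
  split_ifs at *
  · exact ⟨zero _ fun s => (h s).1, zero _ fun s => (h s).2.1, key _ _ _ fun s => (h s).2.2⟩
  · exact ⟨zero _ fun s => (h s).1, zero _ fun s => (h s).2.1, key _ _ _ fun s => (h s).2.2⟩
  · exact ⟨zero _ fun s => (h s).1, zero _ fun s => (h s).2.1, zero _ fun s => (h s).2.2.1,
      key _ _ _ fun s => (h s).2.2.2⟩

namespace KernelData

variable {l : ℕ} (D : KernelData l) {f : ℝ → ℂ}

theorem satisfiesBC_convD {ξ : ℕ} {κ : ℝ} (hbc : ∀ k, SatisfiesBC l ξ κ (D.h k))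
    (hf : MemLp f 2 halfLine) : SatisfiesBC l ξ κ (D.convD 0 f) := by
  choose b hb hrel using hbc
  refine ⟨fun j => ∫ s in Ioi (0 : ℝ), (∑ k, D.cc k * (b k j * D.g k s)) * f s, fun j hj => ?_, ?_⟩
  · refine (D.tendsto_convD hf (j := j) (by omega) fun k => hb k j hj).2.congr' ?_
    filter_upwards [self_mem_nhdsWithin] with r hr
    exact (D.iteratedDeriv_convD hf (by omega) hr).symm
  · refine BoundaryRel.integral f fun s => ?_
    have := BoundaryRel.sum (w := fun k => D.cc k * D.g k s) Finset.univ fun k _ => hrel k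
    refine cast ?_ this
    congr 1
    funext j
    exact Finset.sum_congr rfl fun k _ => by ring

/-! ### The differential equation -/

/-- The function `T_l^m g_k`. -/
def gT (m : ℕ) (k : Fin 3) : ℝ → ℂ := fun r => (-D.a k ^ 2) ^ m * D.g k r

/-- The function `T_l^m h_k`. -/
def hT (m : ℕ) (k : Fin 3) : ℝ → ℂ := fun r =>
  (-D.a k ^ 2) ^ m * D.d k r + ∑ j, D.mu k j * ((-D.a j ^ 2) ^ m * D.g j r)

theorem contDiffAt_gT (m : ℕ) (k : Fin 3) {r : ℝ} (hr : 0 < r) {n : ℕ∞} :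
    ContDiffAt ℝ n (D.gT m k) r := contDiffAt_const.mul (D.contDiffAt_g k hr)

theorem contDiffAt_hT (m : ℕ) (k : Fin 3) {r : ℝ} (hr : 0 < r) {n : ℕ∞} :
    ContDiffAt ℝ n (D.hT m k) r :=
  (contDiffAt_const.mul (D.contDiffAt_d k hr)).add (ContDiffAt.sum fun j _ =>
    contDiffAt_const.mul (contDiffAt_const.mul (D.contDiffAt_g j hr)))

theorem iteratedDeriv_gT (m j : ℕ) (k : Fin 3) (r : ℝ) :
    iteratedDeriv j (D.gT m k) r = (-D.a k ^ 2) ^ m * iteratedDeriv j (D.g k) r :=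
  (iteratedDeriv_const_mul_field _ _)

theorem iteratedDeriv_hT (m j : ℕ) (k : Fin 3) {r : ℝ} (hr : 0 < r) :
    iteratedDeriv j (D.hT m k) r = (-D.a k ^ 2) ^ m * iteratedDeriv j (D.d k) r +
      ∑ i, D.mu k i * ((-D.a i ^ 2) ^ m * iteratedDeriv j (D.g i) r) := by
  have h1 := iteratedDeriv_sum_const_mul Finset.univ (fun i => D.mu k i * (-D.a i ^ 2) ^ m) D.g j
    (r := r) fun i _ => D.contDiffAt_g i hr (n := (j : ℕ∞))
  simp only [mul_assoc] at h1
  rw [← h1]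
  have h2 : iteratedDeriv j (fun x => (-D.a k ^ 2) ^ m * D.d k x) r =
      (-D.a k ^ 2) ^ m * iteratedDeriv j (D.d k) r := by simp
  rw [← h2]
  exact iteratedDeriv_fun_add (contDiffAt_const.mul (D.contDiffAt_d k hr (n := (j : ℕ∞))))
    (ContDiffAt.sum fun i _ => contDiffAt_const.mul
      (contDiffAt_const.mul (D.contDiffAt_g i hr (n := (j : ℕ∞)))))

theorem iteratedDeriv_two_gT (m : ℕ) (k : Fin 3) {r : ℝ} (hr : 0 < r) :
    iteratedDeriv 2 (D.gT m k) r =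
      (l : ℂ) * (l + 1) / (r : ℂ) ^ 2 * D.gT m k r - D.gT (m + 1) k r := by
  rw [iteratedDeriv_gT, g, iteratedDeriv_two_psi D.hl _ hr]
  simp only [gT, g]
  ring

theorem iteratedDeriv_two_hT (m : ℕ) (k : Fin 3) {r : ℝ} (hr : 0 < r) :
    iteratedDeriv 2 (D.hT m k) r =
      (l : ℂ) * (l + 1) / (r : ℂ) ^ 2 * D.hT m k r - D.hT (m + 1) k r := by
  rw [D.iteratedDeriv_hT m 2 k hr]
  simp only [g, d, iteratedDeriv_two_psi D.hl _ hr, hT, Fin.sum_univ_three]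
  ring

/-- Applying T_l multiplies the k-th exponential terms by -a_k². The products g_k d_k cancel in the
value jump, and the derivative jump is, up to sign, the sum of c_k W_k a_k^{2m}, which is nonzero
only at m = 2. -/
theorem jump_T {m : ℕ} (hm : m ≤ 2) {r : ℝ} (hr : 0 < r) :
    ∑ k, D.cc k * (D.gT m k r * D.h k r - D.hT m k r * D.g k r) = 0 ∧
    ∑ k, D.cc k * (deriv (D.gT m k) r * D.h k r - deriv (D.hT m k) r * D.g k r) =
      if m = 2 then -1 else 0 := by
  have s01 := D.symm 0 1
  have s02 := D.symm 0 2
  have s12 := D.symm 1 2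
  have hgen : ∀ j, ∑ k, D.cc k * (iteratedDeriv j (D.gT m k) r * D.h k r -
      iteratedDeriv j (D.hT m k) r * D.g k r) = ∑ k, D.cc k * ((-D.a k ^ 2) ^ m *
        (iteratedDeriv j (D.g k) r * D.d k r - iteratedDeriv j (D.d k) r * D.g k r)) := by
    intro j
    simp only [D.iteratedDeriv_hT m j _ hr, iteratedDeriv_gT, h, Fin.sum_univ_three]
    linear_combination
      ((-D.a 0 ^ 2) ^ m * iteratedDeriv j (D.g 0) r * D.g 1 r -
        (-D.a 1 ^ 2) ^ m * iteratedDeriv j (D.g 1) r * D.g 0 r) * s01 +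
      ((-D.a 0 ^ 2) ^ m * iteratedDeriv j (D.g 0) r * D.g 2 r -
        (-D.a 2 ^ 2) ^ m * iteratedDeriv j (D.g 2) r * D.g 0 r) * s02 +
      ((-D.a 1 ^ 2) ^ m * iteratedDeriv j (D.g 1) r * D.g 2 r -
        (-D.a 2 ^ 2) ^ m * iteratedDeriv j (D.g 2) r * D.g 1 r) * s12
  have h0 := hgen 0
  have h1 := hgen 1
  simp only [iteratedDeriv_zero] at h0
  constructor
  · rw [h0]
    exact Finset.sum_eq_zero fun k _ => by ring
  · simp only [← iteratedDeriv_one]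
    rw [h1]
    have hW := fun k => D.wronskian k hr
    have e : ∀ k, D.cc k * ((-D.a k ^ 2) ^ m *
        (iteratedDeriv 1 (D.g k) r * D.d k r - iteratedDeriv 1 (D.d k) r * D.g k r)) =
        -(-1) ^ m * (D.cc k * (2 * (-1) ^ (l + 1) * D.a k ^ (2 * l + 1)) * D.a k ^ (2 * m)) := by
      intro k
      rw [← hW k, neg_pow, ← pow_mul]
      ring
    rw [Finset.sum_congr rfl fun k _ => e k, ← Finset.mul_sum]
    have m0 := D.sum_zero
    interval_cases m
    · simpa using m0
    · rw [D.sum_two]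
      simp
    · rw [D.sum_four]
      simp

/-- The image of the integral operator under `T_l^m`. -/
def convT (m : ℕ) (f : ℝ → ℂ) : ℝ → ℂ := D.conv (D.gT m) (D.hT m) f

theorem convT_zero (f : ℝ → ℂ) : D.convT 0 f = D.convD 0 f := by
  have h1 : D.gT 0 = D.g := by
    funext k r
    simp [gT]
  have h2 : D.hT 0 = D.h := by
    funext k r
    simp [hT, h]
  rw [convT, h1, h2]
  rfl

theorem convT_three (f : ℝ → ℂ) (r : ℝ) : D.convT 3 f r = D.E * D.convT 0 f r := by
  have e : ∀ k, (-D.a k ^ 2) ^ 3 = D.E := fun k => by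
    rw [← D.pow_six k]
    ring
  simp only [convT, conv, gT, hT, e, Fin.sum_univ_three]
  ring

theorem deriv_convT (hf : MemLp f 2 halfLine) {m : ℕ} (hm : m ≤ 2) {r : ℝ} (hr : 0 < r) :
    deriv (D.convT m f) r = D.conv (fun k => deriv (D.gT m k)) (fun k => deriv (D.hT m k)) f r :=
  (D.hasDerivAt_conv hf (fun k _ hr => D.contDiffAt_gT m k hr (n := 1))
    (fun k _ hr => D.contDiffAt_hT m k hr (n := 1)) (fun _ hr => (D.jump_T hm hr).1) hr).deriv

theorem conv_deriv_deriv (m : ℕ) (f : ℝ → ℂ) {r : ℝ} (hr : 0 < r) :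
    D.conv (fun k => deriv (deriv (D.gT m k))) (fun k => deriv (deriv (D.hT m k))) f r =
      (l : ℂ) * (l + 1) / (r : ℂ) ^ 2 * D.convT m f r - D.convT (m + 1) f r := by
  have hg := fun k => D.iteratedDeriv_two_gT m k hr
  have hh := fun k => D.iteratedDeriv_two_hT m k hr
  simp only [iteratedDeriv_succ, iteratedDeriv_zero] at hg hh
  simp only [conv, convT, hg, hh, Fin.sum_univ_three]
  ring

theorem isPrimitive_conv_deriv (hf : MemLp f 2 halfLine) {m : ℕ} (hm : m ≤ 2) :
    IsPrimitive (deriv (D.convT m f)) fun r =>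
      (l : ℂ) * (l + 1) / (r : ℂ) ^ 2 * D.convT m f r - D.convT (m + 1) f r +
        (if m = 2 then -1 else 0) * f r := by
  refine (D.isPrimitive_conv hf (G := fun k => deriv (D.gT m k)) (H := fun k => deriv (D.hT m k))
    (fun k r hr => ?_) fun k r hr => ?_).congr (fun x hx => D.deriv_convT hf hm hx) fun x hx => ?_
  · rw [← iteratedDeriv_one]
    exact contDiffAt_iteratedDeriv (n := 1) (m := 1) (D.contDiffAt_gT m k hr (n := 2))
  · rw [← iteratedDeriv_one]
    exact contDiffAt_iteratedDeriv (n := 1) (m := 1) (D.contDiffAt_hT m k hr (n := 2))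
  · rw [D.conv_deriv_deriv m f hx, (D.jump_T hm hx).2]

theorem continuousOn_convT (hf : MemLp f 2 halfLine) (m : ℕ) :
    ContinuousOn (D.convT m f) (Ioi 0) :=
  D.continuousOn_conv hf
    (fun k _ hr => (D.contDiffAt_gT m k hr (n := 0)).continuousAt.continuousWithinAt)
    fun k _ hr => (D.contDiffAt_hT m k hr (n := 0)).continuousAt.continuousWithinAt

theorem radT_convT (hf : MemLp f 2 halfLine) {m : ℕ} (hm : m ≤ 1) {r : ℝ} (hr : 0 < r) :
    radT l (D.convT m f) r = D.convT (m + 1) f r := by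
  have hp := (D.isPrimitive_conv_deriv hf (hm.trans one_le_two)).congr
    (g := fun r => (l : ℂ) * (l + 1) / (r : ℂ) ^ 2 * D.convT m f r - D.convT (m + 1) f r)
    (fun _ _ => rfl) fun x _ => by
      rw [if_neg (by omega), zero_mul, add_zero]
  have hc : ContinuousOn (fun r : ℝ => (l : ℂ) * (l + 1) / (r : ℂ) ^ 2 * D.convT m f r -
      D.convT (m + 1) f r) (Ioi 0) := by
    refine ((continuousOn_const.div (by fun_prop) fun x hx => ?_).mul
      (D.continuousOn_convT hf m)).sub (D.continuousOn_convT hf _)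
    have : (x : ℂ) ≠ 0 := by exact_mod_cast (mem_Ioi.1 hx).ne'
    exact pow_ne_zero 2 this
  rw [radT, iteratedDeriv_succ, iteratedDeriv_one, (hp.hasDerivAt hc hr).deriv]
  ring

/-- Only the third application of T_l meets a derivative jump; it adds -f to the second derivative
and hence +f to T_l. As f is merely L², this holds almost everywhere. -/
theorem radT_convT_two (hf : MemLp f 2 halfLine) :
    ∀ᵐ r ∂halfLine, radT l (D.convT 2 f) r = D.convT 3 f r + f r := by
  filter_upwards [(D.isPrimitive_conv_deriv hf le_rfl).ae_hasDerivAt] with r hr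
  rw [radT, iteratedDeriv_succ, iteratedDeriv_one, hr.deriv, if_pos rfl]
  ring

theorem radT3_convD (hf : MemLp f 2 halfLine) :
    radT3 l (D.convD 0 f) =ᵐ[halfLine] fun r => D.E * D.convD 0 f r + f r := by
  filter_upwards [D.radT_convT_two hf, ae_restrict_mem measurableSet_Ioi] with r hr hr0
  have hr0 : 0 < r := hr0
  have ev : ∀ m ≤ 1, radT l (D.convT m f) =ᶠ[𝓝 r] D.convT (m + 1) f := fun m hm => by
    filter_upwards [eventually_gt_nhds hr0] with x hx using D.radT_convT hf hm hx
  rw [← D.convT_zero, ← D.convT_three, ← hr]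
  exact (radT_congr ((radT_congr (ev 0 zero_le_one)).trans (ev 1 le_rfl))).eq_of_nhds

theorem inDomain_convD {ξ : ℕ} {κ : ℝ} (hbc : ∀ k, SatisfiesBC l ξ κ (D.h k))
    (hf : MemLp f 2 halfLine) : InDomain l ξ κ (D.convD 0 f) where
  contDiffOn := D.contDiffOn_convD hf
  memLp := D.memLp_convD hf (by norm_num)
  sixth := ⟨_, (D.memLp_convD hf le_rfl).sub hf, fun a b ha hb =>
    (D.isPrimitive_iteratedDeriv_five_convD hf a b ha hb).2⟩
  bc := D.satisfiesBC_convD hbc hf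
  memLp_radT3 := (((D.memLp_convD hf (by norm_num)).const_mul D.E).add hf).ae_eq
    (D.radT3_convD hf).symm

end KernelData

end RadialCube

end

noncomputable section

namespace RadialCube

/-! ### Polynomial growth -/

/-- Polynomial growth at infinity. -/
def PolyBdd (y : ℝ → ℂ) : Prop := ∃ C : ℝ, ∃ n : ℕ, ∀ r : ℝ, 1 ≤ r → ‖y r‖ ≤ C * r ^ n

theorem PolyBdd.congr {y v : ℝ → ℂ} (h : PolyBdd y) (e : ∀ r : ℝ, 0 < r → v r = y r) :
    PolyBdd v := by
  obtain ⟨C, n, h⟩ := h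
  exact ⟨C, n, fun r hr => by rw [e r (by linarith)]; exact h r hr⟩

theorem PolyBdd.add {y v : ℝ → ℂ} (h : PolyBdd y) (h' : PolyBdd v) :
    PolyBdd fun r => y r + v r := by
  obtain ⟨C, n, h⟩ := h
  obtain ⟨B, m, h'⟩ := h'
  refine ⟨|C| + |B|, max n m, fun r hr => (norm_add_le _ _).trans ?_⟩
  rw [add_mul]
  have key : ∀ (A : ℝ) (j : ℕ), j ≤ max n m → A * r ^ j ≤ |A| * r ^ max n m := fun A j hj =>
    mul_le_mul (le_abs_self A) (pow_le_pow_right₀ hr hj) (by positivity) (abs_nonneg A)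
  exact add_le_add ((h r hr).trans (key C n (le_max_left _ _)))
    ((h' r hr).trans (key B m (le_max_right _ _)))

theorem PolyBdd.mul_of_bdd {y φ : ℝ → ℂ} (h : PolyBdd y) {B : ℝ}
    (hφ : ∀ r : ℝ, 1 ≤ r → ‖φ r‖ ≤ B) : PolyBdd fun r => φ r * y r := by
  obtain ⟨C, n, h⟩ := h
  refine ⟨B * C, n, fun r hr => ?_⟩
  rw [norm_mul, mul_assoc]
  exact mul_le_mul (hφ r hr) (h r hr) (norm_nonneg _) ((norm_nonneg _).trans (hφ r hr))

theorem PolyBdd.of_sub_le {y : ℝ → ℂ} {C : ℝ} {n : ℕ}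
    (h : ∀ r : ℝ, 1 ≤ r → ‖y r - y 1‖ ≤ C * r ^ n) : PolyBdd y := by
  have h1 : PolyBdd fun r => (y r - y 1) + y 1 :=
    PolyBdd.add ⟨C, n, h⟩ ⟨‖y 1‖, 0, fun r _ => by simp⟩
  exact h1.congr fun r _ => by ring

theorem PolyBdd.of_deriv {y y' : ℝ → ℂ} (h : ∀ r : ℝ, 0 < r → HasDerivAt y (y' r) r)
    (h' : PolyBdd y') : PolyBdd y := by
  obtain ⟨C, n, h'⟩ := h'
  refine PolyBdd.of_sub_le (C := |C|) (n := n + 1) fun r hr => ?_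
  have hb : ∀ x ∈ Icc 1 r, ‖y' x‖ ≤ |C| * r ^ n := fun x hx =>
    (h' x hx.1).trans (mul_le_mul (le_abs_self C)
      (pow_le_pow_left₀ (zero_le_one.trans hx.1) hx.2 n)
      (pow_nonneg (zero_le_one.trans hx.1) n) (abs_nonneg C))
  have := (convex_Icc (1 : ℝ) r).norm_image_sub_le_of_norm_hasDerivWithin_le
    (fun x hx => (h x (zero_lt_one.trans_le hx.1)).hasDerivWithinAt) hb
    (left_mem_Icc.2 hr) (right_mem_Icc.2 hr)
  refine this.trans ?_
  rw [Real.norm_of_nonneg (by linarith), pow_succ, ← mul_assoc]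
  exact mul_le_mul_of_nonneg_left (by linarith) (by positivity)

/-- From |w| ≤ 1 + |w|² the primitive grows at most linearly. -/
theorem PolyBdd.of_isPrimitive {y w : ℝ → ℂ} (h : IsPrimitive y w) (hw : MemLp w 2 halfLine) :
    PolyBdd y := by
  have hsq : IntegrableOn (fun x => ‖w x‖ ^ 2) (Ioi 0) :=
    (memLp_two_iff_integrable_sq_norm hw.1).1 hw
  refine PolyBdd.of_sub_le (C := 1 + ∫ x in Ioi (0 : ℝ), ‖w x‖ ^ 2) (n := 1) fun r hr => ?_
  obtain ⟨hi, he⟩ := h 1 r one_pos (by linarith)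
  have hsub : Ioc 1 r ⊆ Ioi (0 : ℝ) := fun x hx => one_pos.trans hx.1
  have h2 : IntervalIntegrable (fun x => ‖w x‖ ^ 2) volume 1 r :=
    (intervalIntegrable_iff_integrableOn_Ioc_of_le hr).2 (hsq.mono_set hsub)
  have h0 : 0 ≤ ∫ x in Ioi (0 : ℝ), ‖w x‖ ^ 2 :=
    integral_nonneg fun x => by positivity
  rw [he]
  calc ‖∫ x in (1 : ℝ)..r, w x‖ ≤ ∫ x in (1 : ℝ)..r, ‖w x‖ :=
        intervalIntegral.norm_integral_le_integral_norm hr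
    _ ≤ ∫ x in (1 : ℝ)..r, (1 + ‖w x‖ ^ 2) := by
        refine intervalIntegral.integral_mono_on hr hi.norm (intervalIntegrable_const.add h2)
          fun x _ => ?_
        nlinarith [sq_nonneg (‖w x‖ - 1), norm_nonneg (w x)]
    _ = (r - 1) + ∫ x in (1 : ℝ)..r, ‖w x‖ ^ 2 := by
        rw [intervalIntegral.integral_add intervalIntegrable_const h2]
        simp
    _ ≤ r + ∫ x in Ioi (0 : ℝ), ‖w x‖ ^ 2 := by
        rw [intervalIntegral.integral_of_le hr]
        have := setIntegral_mono_set hsq (ae_of_all _ fun x => by positivity) hsub.eventuallyLE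
        linarith
    _ ≤ _ := by nlinarith

/-- The function and its derivatives up to order `n` have polynomial growth. -/
def DerivPolyBdd : ℕ → (ℝ → ℂ) → Prop
  | 0, y => PolyBdd y
  | n + 1, y => PolyBdd y ∧ (∀ r : ℝ, 0 < r → DifferentiableAt ℝ y r) ∧ DerivPolyBdd n (deriv y)

theorem DerivPolyBdd.polyBdd {n : ℕ} {y : ℝ → ℂ} (h : DerivPolyBdd n y) : PolyBdd y := by
  cases n with
  | zero => exact h
  | succ n => exact h.1

theorem DerivPolyBdd.congr {n : ℕ} {y v : ℝ → ℂ} (h : DerivPolyBdd n y)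
    (e : ∀ r : ℝ, 0 < r → v r = y r) : DerivPolyBdd n v := by
  induction n generalizing y v with
  | zero => exact PolyBdd.congr h e
  | succ n ih =>
    have ev : ∀ r : ℝ, 0 < r → v =ᶠ[𝓝 r] y := fun r hr => by
      filter_upwards [eventually_gt_nhds hr] with x hx using e x hx
    exact ⟨h.1.congr e, fun r hr => (h.2.1 r hr).congr_of_eventuallyEq (ev r hr),
      ih h.2.2 fun r hr => (ev r hr).deriv_eq⟩

theorem DerivPolyBdd.add {n : ℕ} {y v : ℝ → ℂ} (h : DerivPolyBdd n y) (h' : DerivPolyBdd n v) :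
    DerivPolyBdd n fun r => y r + v r := by
  induction n generalizing y v with
  | zero => exact PolyBdd.add h h'
  | succ n ih =>
    exact ⟨h.1.add h'.1, fun r hr => (h.2.1 r hr).add (h'.2.1 r hr),
      (ih h.2.2 h'.2.2).congr fun r hr => deriv_fun_add (h.2.1 r hr) (h'.2.1 r hr)⟩

theorem DerivPolyBdd.mono {n : ℕ} {y : ℝ → ℂ} (h : DerivPolyBdd (n + 1) y) :
    DerivPolyBdd n y := by
  induction n generalizing y with
  | zero => exact h.1
  | succ n ih => exact ⟨h.1, h.2.1, ih h.2.2⟩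

theorem PolyBdd.const_mul_inv_pow {y : ℝ → ℂ} (h : PolyBdd y) (c : ℂ) (m : ℕ) :
    PolyBdd fun r => c * (r : ℂ)⁻¹ ^ m * y r := by
  refine h.mul_of_bdd (B := ‖c‖) fun r hr => ?_
  rw [norm_mul, norm_pow, norm_inv, Complex.norm_real, Real.norm_of_nonneg (by linarith)]
  exact mul_le_of_le_one_right (norm_nonneg c)
    (pow_le_one₀ (by positivity) (inv_le_one_of_one_le₀ hr))

theorem DerivPolyBdd.const_mul_inv_pow {n : ℕ} {y : ℝ → ℂ} (h : DerivPolyBdd n y) (c : ℂ) (m : ℕ) :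
    DerivPolyBdd n fun r => c * (r : ℂ)⁻¹ ^ m * y r := by
  induction n generalizing y c m with
  | zero => exact PolyBdd.const_mul_inv_pow h c m
  | succ n ih =>
    have hd : ∀ r : ℝ, 0 < r → HasDerivAt (fun r : ℝ => c * (r : ℂ)⁻¹ ^ m * y r)
        (c * (-(m : ℂ) * (r : ℂ)⁻¹ ^ (m + 1)) * y r + c * (r : ℂ)⁻¹ ^ m * deriv y r) r :=
      fun r hr => ((hasDerivAt_inv_pow m hr).const_mul c).mul (h.2.1 r hr).hasDerivAt
    refine ⟨h.1.const_mul_inv_pow c m, fun r hr => (hd r hr).differentiableAt, ?_⟩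
    refine ((ih h.mono (c * -(m : ℂ)) (m + 1)).add (ih h.2.2 c m)).congr fun r hr => ?_
    rw [(hd r hr).deriv]
    ring

theorem DerivPolyBdd.radT {n l : ℕ} {y : ℝ → ℂ} (h : DerivPolyBdd (n + 2) y) :
    DerivPolyBdd n (RadialCube.radT l y) := by
  have h1 := h.2.2.2.2.const_mul_inv_pow (-1) 0
  have h2 := h.mono.mono.const_mul_inv_pow ((l : ℂ) * (l + 1)) 2
  refine (h1.add h2).congr fun r _ => ?_
  rw [RadialCube.radT, iteratedDeriv_succ, iteratedDeriv_one]
  ring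

/-- Growth is integrated downwards: the L² function w controls the n-th derivative, which in turn
controls all lower ones. -/
theorem derivPolyBdd_of_isPrimitive {n : ℕ} {u w : ℝ → ℂ} (hu : ContDiffOn ℝ n u (Ioi 0))
    (h : IsPrimitive (iteratedDeriv n u) w) (hw : MemLp w 2 halfLine) : DerivPolyBdd n u := by
  induction n generalizing u with
  | zero => exact PolyBdd.of_isPrimitive (by simpa using h) hw
  | succ n ih =>
    have hd : ∀ r : ℝ, 0 < r → DifferentiableAt ℝ u r := fun r hr =>
      (hu.contDiffAt (Ioi_mem_nhds hr)).differentiableAt (by simp)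
    have h2 : DerivPolyBdd n (deriv u) := by
      refine ih ?_ ?_
      · push_cast at hu
        exact ((contDiffOn_succ_iff_deriv_of_isOpen isOpen_Ioi).1 hu).2.2
      · rwa [← iteratedDeriv_succ']
    exact ⟨PolyBdd.of_deriv (fun r hr => (hd r hr).hasDerivAt) h2.polyBdd, hd, h2⟩

/-! ### Regularity of solutions of the homogeneous equation -/

theorem IsPrimitive.of_contDiffAt {φ : ℝ → ℂ} (hφ : ∀ r : ℝ, 0 < r → ContDiffAt ℝ 1 φ r) :
    IsPrimitive φ (deriv φ) := by
  have h1 : IsPrimitive (fun _ => 1) (fun _ => 0) := fun a b _ _ => by simp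
  exact (h1.mul hφ).congr (fun _ _ => by simp) fun _ _ => by simp

theorem IsPrimitive.congr_ae {u f g : ℝ → ℂ} (h : IsPrimitive u f) (hfg : f =ᵐ[halfLine] g) :
    IsPrimitive u g := by
  intro a b ha hb
  obtain ⟨h1, h2⟩ := h a b ha hb
  have hae : f =ᵐ[volume.restrict (uIoc a b)] g :=
    ae_mono (Measure.restrict_mono (uIoc_subset_uIcc.trans (uIcc_subset_Ioi_zero ha hb)) le_rfl) hfg
  refine ⟨h1.congr_ae hae, ?_⟩
  rw [h2]
  exact intervalIntegral.integral_congr_ae_restrict hae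

theorem ContDiffAt.radT {n l : ℕ} {u : ℝ → ℂ} {r : ℝ} (hr : 0 < r)
    (h : ContDiffAt ℝ (n + 2 : ℕ) u r) : ContDiffAt ℝ n (RadialCube.radT l u) r :=
  (contDiffAt_iteratedDeriv h).neg.add
    (contDiffAt_potential_mul hr (h.of_le (by norm_cast; omega)))

/-- The function `y` is twice differentiable on `(0, ∞)` and `T_l y = f` there. -/
def SolvesT (l : ℕ) (y f : ℝ → ℂ) : Prop :=
  ∀ r : ℝ, 0 < r → HasDerivAt y (deriv y r) r ∧
    HasDerivAt (deriv y) ((l : ℂ) * (l + 1) / (r : ℂ) ^ 2 * y r - f r) r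

theorem solvesT_radT {l : ℕ} {y : ℝ → ℂ} (h : ∀ r : ℝ, 0 < r → ContDiffAt ℝ 2 y r) :
    SolvesT l y (RadialCube.radT l y) := by
  intro r hr
  refine ⟨((h r hr).differentiableAt two_ne_zero).hasDerivAt, ?_⟩
  have h1 := (contDiffAt_iteratedDeriv (n := 1) (m := 1) (h r hr)).differentiableAt one_ne_zero
  rw [iteratedDeriv_one] at h1
  refine h1.hasDerivAt.congr_deriv ?_
  rw [RadialCube.radT, iteratedDeriv_succ, iteratedDeriv_one]
  ring

/-- With V = l(l+1)/r² one has T_l²u = u'''' - (Vu)'' + V T_l u. Its derivative is u⁽⁵⁾, locally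
absolutely continuous by hypothesis, plus continuously differentiable terms. -/
theorem isPrimitive_deriv_radT_radT {l : ℕ} {u w : ℝ → ℂ} (hu : ContDiffOn ℝ 5 u (Ioi 0))
    (hw : IsPrimitive (iteratedDeriv 5 u) w) :
    ∃ F, IsPrimitive (deriv (radT l (radT l u))) F := by
  have hu5 : ∀ r : ℝ, 0 < r → ContDiffAt ℝ (5 : ℕ) u r := fun r hr => by
    exact_mod_cast hu.contDiffAt (Ioi_mem_nhds hr)
  set p : ℝ → ℂ := fun x => ((l : ℂ) * (l + 1) / (x : ℂ) ^ 2) * u x with hp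
  set q : ℝ → ℂ := fun x => ((l : ℂ) * (l + 1) / (x : ℂ) ^ 2) * radT l u x with hq
  have hp5 : ∀ r : ℝ, 0 < r → ContDiffAt ℝ (5 : ℕ) p r := fun r hr =>
    contDiffAt_potential_mul hr (hu5 r hr)
  have hq3 : ∀ r : ℝ, 0 < r → ContDiffAt ℝ (3 : ℕ) q r := fun r hr =>
    contDiffAt_potential_mul hr (ContDiffAt.radT hr (hu5 r hr))
  have hcomp : iteratedDeriv 2 (iteratedDeriv 2 u) = iteratedDeriv 4 u := by
    simp only [iteratedDeriv_eq_iterate, ← Function.iterate_add_apply]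
  have e1 : ∀ r : ℝ, 0 < r → radT l (radT l u) r =
      iteratedDeriv 4 u r + -iteratedDeriv 2 p r + q r := by
    intro r hr
    have hA : ContDiffAt ℝ 2 (-iteratedDeriv 2 u) r :=
      (contDiffAt_iteratedDeriv (n := 2) (m := 2) ((hu5 r hr).of_le (by norm_num))).neg
    have hB : ContDiffAt ℝ 2 p r := (hp5 r hr).of_le (by norm_num)
    have := iteratedDeriv_add hA hB
    rw [iteratedDeriv_neg, hcomp] at this
    have e : radT l u = -iteratedDeriv 2 u + p := rfl
    change -iteratedDeriv 2 (radT l u) r + q r = _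
    rw [e, this]
    ring
  have h4 : ∀ r : ℝ, 0 < r → DifferentiableAt ℝ (iteratedDeriv 4 u) r := fun r hr =>
    (contDiffAt_iteratedDeriv (n := 1) (m := 4) (hu5 r hr)).differentiableAt one_ne_zero
  have h2 : ∀ r : ℝ, 0 < r → DifferentiableAt ℝ (iteratedDeriv 2 p) r := fun r hr =>
    (contDiffAt_iteratedDeriv (n := 1) (m := 2)
      ((hp5 r hr).of_le (by norm_num))).differentiableAt one_ne_zero
  have h0 : ∀ r : ℝ, 0 < r → DifferentiableAt ℝ q r := fun r hr =>
    (hq3 r hr).differentiableAt (by norm_num)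
  have p3 : IsPrimitive (iteratedDeriv 3 p) _ := IsPrimitive.of_contDiffAt fun r hr =>
    contDiffAt_iteratedDeriv (n := 1) (m := 3) ((hp5 r hr).of_le (by norm_num))
  have q1 : IsPrimitive (iteratedDeriv 1 q) _ := IsPrimitive.of_contDiffAt fun r hr =>
    contDiffAt_iteratedDeriv (n := 1) (m := 1) ((hq3 r hr).of_le (by norm_num))
  refine ⟨_, ((hw.add (p3.const_mul (-1))).add q1).congr (fun r hr => ?_) fun _ _ => rfl⟩
  have ev : radT l (radT l u) =ᶠ[𝓝 r] fun x => iteratedDeriv 4 u x + -iteratedDeriv 2 p x + q x := by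
    filter_upwards [eventually_gt_nhds hr] with x hx using e1 x hx
  have hd : HasDerivAt (fun x => iteratedDeriv 4 u x + -iteratedDeriv 2 p x + q x) _ r :=
    ((h4 r hr).hasDerivAt.add (h2 r hr).hasDerivAt.neg).add (h0 r hr).hasDerivAt
  rw [ev.deriv_eq, hd.deriv, iteratedDeriv_succ (n := 4), iteratedDeriv_succ (n := 2),
    iteratedDeriv_one]
  ring

/-- An equation valid almost everywhere becomes pointwise: the derivative of T_l²u is a primitive of
a function that agrees almost everywhere with a continuous one. -/
theorem solvesT_of_ae {l : ℕ} {u w : ℝ → ℂ} {E : ℂ} (hu : ContDiffOn ℝ 5 u (Ioi 0))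
    (hw : IsPrimitive (iteratedDeriv 5 u) w) (h : radT3 l u =ᵐ[halfLine] fun r => E * u r) :
    SolvesT l u (radT l u) ∧ SolvesT l (radT l u) (radT l (radT l u)) ∧
      SolvesT l (radT l (radT l u)) fun r => E * u r := by
  have hu5 : ∀ r : ℝ, 0 < r → ContDiffAt ℝ (5 : ℕ) u r := fun r hr => by
    exact_mod_cast hu.contDiffAt (Ioi_mem_nhds hr)
  have h3 : ∀ r : ℝ, 0 < r → ContDiffAt ℝ (3 : ℕ) (radT l u) r := fun r hr =>
    ContDiffAt.radT hr (hu5 r hr)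
  have h1 : ∀ r : ℝ, 0 < r → ContDiffAt ℝ (1 : ℕ) (radT l (radT l u)) r := fun r hr =>
    ContDiffAt.radT hr (h3 r hr)
  refine ⟨solvesT_radT fun r hr => (hu5 r hr).of_le (by norm_num),
    solvesT_radT fun r hr => (h3 r hr).of_le (by norm_num), fun r hr =>
    ⟨((h1 r hr).differentiableAt (by norm_num)).hasDerivAt, ?_⟩⟩
  obtain ⟨F, hF⟩ := isPrimitive_deriv_radT_radT (l := l) hu hw
  have hF2 : F =ᵐ[halfLine] fun r =>
      (l : ℂ) * (l + 1) / (r : ℂ) ^ 2 * radT l (radT l u) r - E * u r := by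
    filter_upwards [hF.ae_hasDerivAt, h] with x hx h
    have e : radT3 l u x = -iteratedDeriv 2 (radT l (radT l u)) x +
      ((l : ℂ) * (l + 1) / (x : ℂ) ^ 2) * radT l (radT l u) x := rfl
    rw [← h, e, iteratedDeriv_succ, iteratedDeriv_one, hx.deriv]
    ring
  refine (hF.congr_ae hF2).hasDerivAt ?_ hr
  intro x hx
  have hx0 : (0 : ℝ) < x := hx
  exact (((contDiffAt_potential_mul (n := 1) hx0 (h1 x hx0)).continuousAt).sub
    (continuousAt_const.mul (hu5 x hx0).continuousAt)).continuousWithinAt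

theorem SolvesT.add {l : ℕ} {y v f g : ℝ → ℂ} (h : SolvesT l y f) (h' : SolvesT l v g) :
    SolvesT l (fun r => y r + v r) fun r => f r + g r := by
  intro r hr
  have hd : ∀ x : ℝ, 0 < x → HasDerivAt (fun r => y r + v r) (deriv y x + deriv v x) x :=
    fun x hx => (h x hx).1.add (h' x hx).1
  have ev : deriv (fun r => y r + v r) =ᶠ[𝓝 r] fun x => deriv y x + deriv v x := by
    filter_upwards [eventually_gt_nhds hr] with x hx using (hd x hx).deriv
  refine ⟨(hd r hr).differentiableAt.hasDerivAt, ?_⟩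
  refine (((h r hr).2.add (h' r hr).2).congr_of_eventuallyEq ev).congr_deriv ?_
  ring

theorem SolvesT.const_mul {l : ℕ} {y f : ℝ → ℂ} (c : ℂ) (h : SolvesT l y f) :
    SolvesT l (fun r => c * y r) fun r => c * f r := by
  intro r hr
  have hd : ∀ x : ℝ, 0 < x → HasDerivAt (fun r => c * y r) (c * deriv y x) x :=
    fun x hx => (h x hx).1.const_mul c
  have ev : deriv (fun r => c * y r) =ᶠ[𝓝 r] fun x => c * deriv y x := by
    filter_upwards [eventually_gt_nhds hr] with x hx using (hd x hx).deriv
  refine ⟨(hd r hr).differentiableAt.hasDerivAt, ?_⟩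
  refine (((h r hr).2.const_mul c).congr_of_eventuallyEq ev).congr_deriv ?_
  ring

theorem SolvesT.congr {l : ℕ} {y f g : ℝ → ℂ} (h : SolvesT l y f)
    (e : ∀ r : ℝ, 0 < r → g r = f r) : SolvesT l y g := fun r hr => by
  rw [e r hr]
  exact h r hr

theorem solvesT_psi {l : ℕ} (hl : l = 1 ∨ l = 2) (a : ℂ) :
    SolvesT l (psi l a) fun r => -a ^ 2 * psi l a r :=
  (solvesT_radT fun _ hr => contDiffAt_psi hl a hr (n := 2)).congr fun _ hr =>
    (radT_psi hl a hr).symm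

/-- The Wronskian of two solutions of `T_l y = c y` is constant. -/
theorem SolvesT.wronskian_const {l : ℕ} {y v : ℝ → ℂ} {c : ℂ} (h : SolvesT l y fun r => c * y r)
    (h' : SolvesT l v fun r => c * v r) :
    ∃ B : ℂ, ∀ r : ℝ, 0 < r → deriv y r * v r - y r * deriv v r = B := by
  have hd : ∀ r : ℝ, 0 < r → HasDerivAt (fun r => deriv y r * v r - y r * deriv v r) 0 r := by
    intro r hr
    refine (((h r hr).2.mul (h' r hr).1).sub ((h r hr).1.mul (h' r hr).2)).congr_deriv ?_
    ring
  exact isOpen_Ioi.exists_is_const_of_deriv_eq_zero isPreconnected_Ioi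
    (fun r hr => (hd r hr).differentiableAt.differentiableWithinAt) fun r hr => (hd r hr).deriv

theorem PolyBdd.tendsto_mul {y φ : ℝ → ℂ} (h : PolyBdd y) {A ε : ℝ} (hε : 0 < ε)
    (hφ : ∀ r : ℝ, 1 ≤ r → ‖φ r‖ ≤ A * Real.exp (-ε * r)) :
    Tendsto (fun r => y r * φ r) atTop (𝓝 0) := by
  obtain ⟨C, n, h⟩ := h
  refine squeeze_zero_norm' (a := fun r => C * A * (r ^ n * Real.exp (-ε * r))) ?_ ?_
  · filter_upwards [eventually_ge_atTop 1] with r hr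
    rw [norm_mul]
    refine (mul_le_mul (h r hr) (hφ r hr) (norm_nonneg _)
      ((norm_nonneg _).trans (h r hr))).trans (le_of_eq (by ring))
  · have := (tendsto_rpow_mul_exp_neg_mul_atTop_nhds_zero n ε hε).const_mul (C * A)
    simpa using this

/-! ### Homogeneous solutions of polynomial growth -/

namespace KernelData

variable {l : ℕ} (D : KernelData l)

/-- A solution of `T_l y = -a_k² y` of polynomial growth is a multiple of `g_k`. -/
theorem exists_eq_of_solvesT (k : Fin 3) {q : ℝ → ℂ}
    (h : SolvesT l q fun r => -D.a k ^ 2 * q r) (h1 : DerivPolyBdd 1 q) :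
    ∃ B : ℂ, ∀ r : ℝ, 0 < r → 2 * (-1) ^ (l + 1) * D.a k ^ (2 * l + 1) * q r = B * D.g k r := by
  have hd : SolvesT l (D.d k) fun r => -D.a k ^ 2 * D.d k r :=
    (solvesT_psi D.hl (-D.a k)).congr fun r _ => by simp [d]
  obtain ⟨A, hA⟩ := h.wronskian_const (solvesT_psi D.hl (D.a k))
  obtain ⟨B, hB⟩ := h.wronskian_const hd
  obtain ⟨C0, -, hC0⟩ := D.exists_bound_g 0 k
  obtain ⟨C1, -, hC1⟩ := D.exists_bound_g 1 k
  have hε : 0 < -(D.a k).re := neg_pos.2 (D.re_neg k)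
  simp only [iteratedDeriv_one] at hC1
  -- The Wronskian of q with g_k is constant, and at infinity it is polynomial growth against
  -- exponential decay, so it is zero.
  have hA0 : A = 0 := by
    have t : Tendsto (fun r => deriv q r * D.g k r - q r * deriv (D.g k) r) atTop (𝓝 (0 - 0)) :=
      (h1.2.2.tendsto_mul hε fun r hr => by simpa using hC0 r hr).sub
        (h1.1.tendsto_mul hε fun r hr => by simpa using hC1 r hr)
    rw [sub_zero] at t
    refine tendsto_nhds_unique (tendsto_const_nhds.congr' ?_) t
    filter_upwards [eventually_gt_atTop 0] with r hr using (hA r hr).symm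
  refine ⟨-B, fun r hr => ?_⟩
  have hW := D.wronskian k hr
  have h1 := hA r hr
  have h2 := hB r hr
  rw [hA0] at h1
  simp only [iteratedDeriv_one, g] at *
  -- Eliminating q' from the Wronskian relations of q with g_k and with d_k leaves W_k q as a
  -- multiple of g_k.
  linear_combination (-q r) * hW + D.d k r * h1 - psi l (D.a k) r * h2

/-- Partial fractions again: q_k = (T_l² + λ_k T_l + λ_k²)u with λ_k = -a_k² satisfies T_l q_k = λ_k
q_k, because λ_k³ = E. Weighting q_k by c_k W_k and summing recovers u by the moment identities. -/
theorem exists_eq_sum_of_homogeneous {u w : ℝ → ℂ} (hu : ContDiffOn ℝ 5 u (Ioi 0))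
    (hw : IsPrimitive (iteratedDeriv 5 u) w) (hw2 : MemLp w 2 halfLine)
    (h : radT3 l u =ᵐ[halfLine] fun r => D.E * u r) :
    ∃ y : Fin 3 → ℂ, ∀ r : ℝ, 0 < r → u r = ∑ k, y k * D.g k r := by
  obtain ⟨s0, s1, s2⟩ := solvesT_of_ae hu hw h
  have b5 : DerivPolyBdd 5 u := derivPolyBdd_of_isPrimitive (n := 5) hu hw hw2
  have b3 : DerivPolyBdd 3 (radT l u) := b5.radT
  have b1 : DerivPolyBdd 1 (radT l (radT l u)) := b3.radT
  have b1' : DerivPolyBdd 1 (radT l u) := b3.mono.mono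
  have b1'' : DerivPolyBdd 1 u := b5.mono.mono.mono.mono
  have hc : ∀ {n : ℕ} {y : ℝ → ℂ} (c : ℂ), DerivPolyBdd n y → DerivPolyBdd n fun r => c * y r :=
    fun c hy => (hy.const_mul_inv_pow c 0).congr fun r _ => by simp
  have hq : ∀ k, ∃ B : ℂ, ∀ r : ℝ, 0 < r → 2 * (-1) ^ (l + 1) * D.a k ^ (2 * l + 1) *
      (radT l (radT l u) r + -D.a k ^ 2 * radT l u r + D.a k ^ 4 * u r) = B * D.g k r := by
    intro k
    refine D.exists_eq_of_solvesT k (((s2.add (s1.const_mul _)).add (s0.const_mul _)).congr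
      fun r _ => ?_) ((b1.add (hc _ b1')).add (hc _ b1''))
    rw [← D.pow_six k]
    ring
  choose B hB using hq
  refine ⟨fun k => D.cc k * B k, fun r hr => ?_⟩
  have e : ∀ k, D.cc k * B k * D.g k r = D.cc k * (2 * (-1) ^ (l + 1) * D.a k ^ (2 * l + 1) *
      (radT l (radT l u) r + -D.a k ^ 2 * radT l u r + D.a k ^ 4 * u r)) := fun k => by
    rw [hB k r hr, mul_assoc]
  have m0 := D.sum_zero
  have m2 := D.sum_two
  have m4 := D.sum_four
  simp only [e]
  simp only [Fin.sum_univ_three] at *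
  linear_combination (-radT l (radT l u) r) * m0 + radT l u r * m2 - u r * m4

end KernelData

end RadialCube

end

noncomputable section

namespace RadialCube

/-! ### Test functions -/

/-- Smooth functions with compact support in `(0, ∞)`. -/
structure TestFn (φ : ℝ → ℂ) : Prop where
  contDiff : ContDiff ℝ ∞ φ
  compact : HasCompactSupport φ
  support : tsupport φ ⊆ Ioi 0

theorem TestFn.deriv {φ : ℝ → ℂ} (h : TestFn φ) : TestFn (deriv φ) where
  contDiff := (contDiff_infty_iff_deriv.1 h.contDiff).2
  compact := h.compact.deriv
  support := (closure_minimal support_deriv_subset (isClosed_tsupport φ)).trans h.support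

theorem TestFn.eventually_zero {φ : ℝ → ℂ} (h : TestFn φ) {x : ℝ} (hx : x ≤ 0) :
    φ =ᶠ[𝓝 x] fun _ => 0 :=
  notMem_tsupport_iff_eventuallyEq.1 fun hx' => (not_lt.2 hx) (h.support hx')

/-- The singularity of the potential is harmless, since a test function vanishes near every x ≤ 0.
-/
theorem TestFn.radT (l : ℕ) {φ : ℝ → ℂ} (h : TestFn φ) : TestFn (RadialCube.radT l φ) := by
  have hz : ∀ x, φ =ᶠ[𝓝 x] (fun _ => 0) → RadialCube.radT l φ =ᶠ[𝓝 x] fun _ => 0 := fun x hx => by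
    have := radT_smul l 0 (fun _ => 0)
    simp only [zero_mul] at this
    rw [← this]
    exact radT_congr hx
  have hs : Function.support (RadialCube.radT l φ) ⊆ tsupport φ := fun x hx => by
    by_contra hx'
    exact hx (hz x (notMem_tsupport_iff_eventuallyEq.1 hx')).eq_of_nhds
  refine ⟨contDiff_iff_contDiffAt.2 fun x => ?_, h.compact.mono' hs,
    (closure_minimal hs (isClosed_tsupport φ)).trans h.support⟩
  rcases le_or_gt x 0 with hx | hx
  · exact contDiffAt_const.congr_of_eventuallyEq (hz x (h.eventually_zero hx))
  · refine contDiffAt_infty.2 fun n => ContDiffAt.radT hx ?_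
    exact (contDiff_infty.1 h.contDiff (n + 2)).contDiffAt

theorem TestFn.memLp {φ : ℝ → ℂ} (h : TestFn φ) : MemLp φ 2 halfLine :=
  h.contDiff.continuous.memLp_of_hasCompactSupport h.compact

theorem TestFn.inDomain {φ : ℝ → ℂ} (h : TestFn φ) (l ξ : ℕ) (κ : ℝ) : InDomain l ξ κ φ where
  contDiffOn := (contDiff_infty.1 h.contDiff 5).contDiffOn
  memLp := h.memLp
  sixth := by
    have h6 : ∀ n, TestFn (iteratedDeriv n φ) := fun n => by
      induction n with
      | zero => simpa using h
      | succ n ih => rw [iteratedDeriv_succ]; exact ih.deriv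
    refine ⟨iteratedDeriv 6 φ, (h6 6).memLp, fun a b _ _ => ?_⟩
    rw [iteratedDeriv_succ (n := 5), intervalIntegral.integral_deriv_eq_sub]
    · exact fun x _ => ((h6 5).contDiff.differentiable (by simp)).differentiableAt
    · rw [← iteratedDeriv_succ]
      exact (h6 6).contDiff.continuous.intervalIntegrable _ _
  bc := satisfiesBC_congr (InDomain.zero l ξ κ).bc
    ((h.eventually_zero le_rfl).symm.filter_mono nhdsWithin_le_nhds)
  memLp_radT3 := ((h.radT l).radT l).radT l |>.memLp

/-! ### The resolvent of the operator -/

theorem InDomain.intervalIntegrable_of_memLp {w : ℝ → ℂ} (hw : MemLp w 2 halfLine) {a b : ℝ}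
    (ha : 0 < a) (hb : 0 < b) : IntervalIntegrable w volume a b := by
  rw [intervalIntegrable_iff]
  have h2 : MemLp w 2 (volume.restrict (uIoc a b)) := hw.mono_measure
    (Measure.restrict_mono (uIoc_subset_uIcc.trans (uIcc_subset_Ioi_zero ha hb)) le_rfl)
  have : IsFiniteMeasure (volume.restrict (uIoc a b)) := ⟨by simp [uIoc]⟩
  exact h2.integrable (by norm_num)

namespace KernelData

variable {l ξ : ℕ} {κ : ℝ} (D : KernelData l)

/-- The homogeneous equation has no nontrivial solution in the domain. -/
def Injective (ξ : ℕ) (κ : ℝ) : Prop :=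
  ∀ y : Fin 3 → ℂ, SatisfiesBC l ξ κ (fun r => ∑ k, y k * D.g k r) → y = 0

variable {D}

theorem eq_zero_of_homogeneous (hinj : D.Injective ξ κ) {u : ℝ → ℂ} (hu : InDomain l ξ κ u)
    (h : radT3 l u =ᵐ[halfLine] fun r => D.E * u r) {r : ℝ} (hr : 0 < r) : u r = 0 := by
  obtain ⟨w, hw, hi⟩ := hu.sixth
  obtain ⟨y, hy⟩ := D.exists_eq_sum_of_homogeneous hu.contDiffOn (fun a b ha hb =>
    ⟨InDomain.intervalIntegrable_of_memLp hw ha hb, hi a b ha hb⟩) hw h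
  have hbc := satisfiesBC_congr hu.bc (v := fun r => ∑ k, y k * D.g k r) (by
    filter_upwards [self_mem_nhdsWithin] with x hx using hy x hx)
  rw [hy r hr, hinj y hbc]
  simp

/-- The difference u - R(T_l³ - E)u lies in the domain and solves the homogeneous equation, hence
vanishes. This is the left-inverse property. -/
theorem eq_convD (hinj : D.Injective ξ κ) (hbc : ∀ k, SatisfiesBC l ξ κ (D.h k)) {u : ℝ → ℂ}
    (hu : InDomain l ξ κ u) {r : ℝ} (hr : 0 < r) :
    u r = D.convD 0 (fun s => radT3 l u s - D.E * u s) r := by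
  have hf : MemLp (fun s => radT3 l u s - D.E * u s) 2 halfLine :=
    hu.memLp_radT3.sub (hu.memLp.const_mul D.E)
  have hv := D.inDomain_convD hbc hf
  have h := eq_zero_of_homogeneous hinj (hu.add (hv.smul (-1))) (by
    filter_upwards [hu.radT3_add_ae (hv.smul (-1)), D.radT3_convD hf] with s h1 h2
    simp only [h1, radT3_smul, h2]
    ring) hr
  linear_combination h

variable (D)

theorem convD_congr_ae {f g : ℝ → ℂ} (hf : MemLp f 2 halfLine) (hg : MemLp g 2 halfLine)
    (h : f =ᵐ[halfLine] g) {r : ℝ} (hr : 0 < r) : D.convD 0 f r = D.convD 0 g r := by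
  rw [D.convD_eq_integral hf 0 hr, D.convD_eq_integral hg 0 hr]
  exact integral_congr_ae (by filter_upwards [h] with s hs; rw [hs])

theorem convD_add {f g : ℝ → ℂ} (hf : MemLp f 2 halfLine) (hg : MemLp g 2 halfLine) {r : ℝ}
    (hr : 0 < r) : D.convD 0 (f + g) r = D.convD 0 f r + D.convD 0 g r := by
  rw [D.convD_eq_integral hf 0 hr, D.convD_eq_integral hg 0 hr, D.convD_eq_integral (hf.add hg) 0 hr,
    ← integral_add (D.integrableOn_ker hf 0 hr) (D.integrableOn_ker hg 0 hr)]
  simp only [Pi.add_apply, mul_add]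

theorem convD_smul {f : ℝ → ℂ} (c : ℂ) (hf : MemLp f 2 halfLine) {r : ℝ} (hr : 0 < r) :
    D.convD 0 (c • f) r = c * D.convD 0 f r := by
  rw [D.convD_eq_integral hf 0 hr, D.convD_eq_integral (hf.const_smul c) 0 hr,
    ← integral_const_mul]
  simp only [Pi.smul_apply, smul_eq_mul, mul_left_comm]

/-- The resolvent as a bounded operator on `L²(0, ∞)`. -/
def resolvent : HalfL2 →L[ℂ] HalfL2 :=
  LinearMap.mkContinuousOfExistsBound
    { toFun := fun f => (D.memLp_convD (Lp.memLp f) (Nat.zero_le 6)).toLp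
      map_add' := by
        intro f g
        rw [← MemLp.toLp_add, MemLp.toLp_eq_toLp_iff]
        filter_upwards [ae_restrict_mem measurableSet_Ioi] with r hr
        rw [D.convD_congr_ae (Lp.memLp _) ((Lp.memLp f).add (Lp.memLp g)) (Lp.coeFn_add f g) hr]
        exact D.convD_add (Lp.memLp f) (Lp.memLp g) hr
      map_smul' := by
        intro c f
        rw [RingHom.id_apply, ← MemLp.toLp_const_smul, MemLp.toLp_eq_toLp_iff]
        filter_upwards [ae_restrict_mem measurableSet_Ioi] with r hr
        rw [D.convD_congr_ae (Lp.memLp _) ((Lp.memLp f).const_smul c) (Lp.coeFn_smul c f) hr]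
        exact D.convD_smul c (Lp.memLp f) hr }
    (by
      obtain ⟨C, hC⟩ := D.exists_eLpNorm_convD_le (Nat.zero_le 6)
      refine ⟨C, fun f => ?_⟩
      simp only [LinearMap.coe_mk, AddHom.coe_mk]
      rw [Lp.norm_toLp, Lp.norm_def, ← ENNReal.coe_toReal, ← ENNReal.toReal_mul]
      exact ENNReal.toReal_mono (ENNReal.mul_ne_top ENNReal.coe_ne_top (Lp.memLp f).2.ne)
        (hC f (Lp.memLp f)))

theorem resolvent_ae (f : HalfL2) : D.resolvent f =ᵐ[halfLine] D.convD 0 f :=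
  MemLp.coeFn_toLp (D.memLp_convD (Lp.memLp f) (Nat.zero_le 6))

variable {D}

theorem resolvent_mem_domain (hbc : ∀ k, SatisfiesBC l ξ κ (D.h k)) (f : HalfL2) :
    D.resolvent f ∈ domain l ξ κ :=
  ⟨_, D.inDomain_convD hbc (Lp.memLp f), D.resolvent_ae f⟩

theorem operator_ae (x : domain l ξ κ) :
    operator l ξ κ x =ᵐ[halfLine] radT3 l (rep x) :=
  MemLp.coeFn_toLp (rep_inDomain x).memLp_radT3

theorem operator_resolvent (hbc : ∀ k, SatisfiesBC l ξ κ (D.h k)) (f : HalfL2) :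
    operator l ξ κ ⟨D.resolvent f, resolvent_mem_domain hbc f⟩ - D.E • D.resolvent f = f := by
  set x : domain l ξ κ := ⟨D.resolvent f, resolvent_mem_domain hbc f⟩ with hx
  have hv := D.inDomain_convD hbc (Lp.memLp f)
  have hrep : rep x =ᵐ[halfLine] D.convD 0 f := (coe_ae_eq_rep x).symm.trans (D.resolvent_ae f)
  refine Lp.ext ?_
  filter_upwards [Lp.coeFn_sub (operator l ξ κ x) (D.E • D.resolvent f),
    Lp.coeFn_smul D.E (D.resolvent f), operator_ae x,
    (rep_inDomain x).radT3_congr_ae hv hrep, D.radT3_convD (Lp.memLp f), D.resolvent_ae f]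
    with r h1 h2 h3 h4 h5 h6
  refine h1.trans ?_
  rw [Pi.sub_apply, h2, Pi.smul_apply, h3, h4, h5, h6, smul_eq_mul]
  ring

theorem resolvent_operator (hinj : D.Injective ξ κ) (hbc : ∀ k, SatisfiesBC l ξ κ (D.h k))
    (x : domain l ξ κ) :
    D.resolvent (operator l ξ κ x - D.E • (x : HalfL2)) = x := by
  refine Lp.ext ?_
  refine (D.resolvent_ae _).trans ?_
  have hu := rep_inDomain x
  have hf : MemLp (fun s => radT3 l (rep x) s - D.E * rep x s) 2 halfLine :=
    hu.memLp_radT3.sub (hu.memLp.const_mul D.E)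
  have e : (operator l ξ κ x - D.E • (x : HalfL2) : HalfL2) =ᵐ[halfLine]
      fun s => radT3 l (rep x) s - D.E * rep x s := by
    filter_upwards [Lp.coeFn_sub (operator l ξ κ x) (D.E • (x : HalfL2)),
      Lp.coeFn_smul D.E (x : HalfL2), operator_ae x, coe_ae_eq_rep x] with s h1 h2 h3 h4
    rw [h1, Pi.sub_apply, h2, Pi.smul_apply, h3, h4, smul_eq_mul]
  filter_upwards [ae_restrict_mem measurableSet_Ioi, coe_ae_eq_rep x] with r hr hxr
  rw [D.convD_congr_ae (Lp.memLp _) hf e hr, ← eq_convD hinj hbc hu hr, hxr]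

theorem isResolventKernel (hinj : D.Injective ξ κ) (hbc : ∀ k, SatisfiesBC l ξ κ (D.h k)) :
    IsResolventKernel (operator l ξ κ) D.E (D.ker 0) := by
  refine ⟨D.resolvent, fun f => ⟨resolvent_mem_domain hbc f, operator_resolvent hbc f⟩,
    resolvent_operator hinj hbc, fun f => ⟨fun r hr => D.integrableOn_ker (Lp.memLp f) 0 hr, ?_⟩⟩
  filter_upwards [D.resolvent_ae f, ae_restrict_mem measurableSet_Ioi] with r h1 hr
  rw [h1, D.convD_eq_integral (Lp.memLp f) 0 hr]

/-- Test functions vanish near 0 and so lie in the domain for every choice of boundary conditions;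
the left-inverse formula then reproduces φ at each point, by continuity of representatives. -/
theorem integral_ker_mul_testFn (hinj : D.Injective ξ κ) (hbc : ∀ k, SatisfiesBC l ξ κ (D.h k))
    {φ : ℝ → ℂ} (hφ : TestFn φ) {s : ℝ} (hs : 0 < s) :
    ∫ r in Ioi (0 : ℝ), D.ker 0 s r * (radT3 l φ r - D.E * φ r) = φ s := by
  have hu := hφ.inDomain l ξ κ
  have hf : MemLp (fun r => radT3 l φ r - D.E * φ r) 2 halfLine :=
    hu.memLp_radT3.sub (hu.memLp.const_mul D.E)
  rw [eq_convD hinj hbc hu hs, D.convD_eq_integral hf 0 hs]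

end KernelData

end RadialCube

end

noncomputable section

namespace RadialCube

/-! ### The explicit kernel -/

/-- The argument of a_k is π/2 + πk/3 + arg z. It lies strictly between π/2 and 3π/2; the upper
bound for k = 2 uses arg z < π/3. -/
theorem re_expo_neg {z : ℂ} (h0 : 0 < z.arg) (h1 : z.arg < π / 3) (k : Fin 3) :
    (expo z k).re < 0 := by
  have hz : z ≠ 0 := fun h => by simp [h] at h0
  have e : expo z k = (‖z‖ : ℂ) *
      Complex.exp ((π / 2 + π * ((k : ℕ) / 3) + z.arg : ℝ) * Complex.I) := by
    have h : Complex.I * phase ((k : ℕ) / 3) = phase (1 / 2 + (k : ℕ) / 3) := by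
      rw [phase_add, phase_half]
    rw [expo, h, phase_eq]
    conv_lhs => rw [← Complex.norm_mul_exp_arg_mul_I z]
    rw [mul_left_comm, ← Complex.exp_add]
    congr 2
    push_cast
    ring
  rw [e, Complex.re_ofReal_mul, Complex.exp_ofReal_mul_I_re]
  refine mul_neg_of_pos_of_neg (norm_pos_iff.2 hz) (Real.cos_neg_of_pi_div_two_lt_of_lt ?_ ?_)
  · have : 0 ≤ π * ((k : ℕ) / 3) := by positivity
    linarith
  · have hk : ((k : ℕ) : ℝ) ≤ 2 := by exact_mod_cast Nat.lt_succ_iff.1 k.2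
    nlinarith [Real.pi_pos]

theorem neg_expo_pow_six (z : ℂ) (k : Fin 3) : -expo z k ^ 6 = z ^ 6 := by
  have h := phase_one_third_sq
  have h3 : phase (1 / 3) ^ 3 = -1 := by linear_combination (phase (1 / 3) + 1) * h
  have h2 := phase_two_thirds
  rw [← h] at h2
  have hk : phase ((k : ℕ) / 3) ^ 6 = 1 := by
    fin_cases k
    · simp [phase_zero]
    · simp only [Nat.cast_one]
      linear_combination (phase (1 / 3) ^ 3 - 1) * h3
    · simp only [Nat.cast_ofNat]
      rw [h2]
      linear_combination (phase (1 / 3) ^ 6 + 1) * (phase (1 / 3) ^ 3 - 1) * h3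
  have hI : Complex.I ^ 6 = -1 := by
    rw [show 6 = 2 * 3 by norm_num, pow_mul, Complex.I_sq]
    norm_num
  rw [expo, mul_pow, mul_pow, hk, hI]
  ring

theorem ne_zero_of_arg_pos {z : ℂ} (h0 : 0 < z.arg) : z ≠ 0 := fun h => by simp [h] at h0

/-- The data of the kernel `R(r, s; z)`. -/
def kernelData {l ξ : ℕ} (hl : l = 1 ∨ l = 2) (hξ : ξ = 1 ∨ ξ = 2) {κ : ℝ} {z : ℂ}
    (h0 : 0 < z.arg) (h1 : z.arg < π / 3) (hp : denom l ξ κ z ≠ 0) : KernelData l where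
  hl := hl
  a := expo z
  cc := kerCoeff l z
  mu := coefMat l ξ κ z
  E := z ^ 6
  re_neg := re_expo_neg h0 h1
  pow_six := neg_expo_pow_six z
  sum_zero := (kerCoeff_sum hl (ne_zero_of_arg_pos h0)).1
  sum_two := (kerCoeff_sum hl (ne_zero_of_arg_pos h0)).2.1
  sum_four := (kerCoeff_sum hl (ne_zero_of_arg_pos h0)).2.2
  symm := kerCoeff_mul_coefMat hl hξ κ z
  row := coefMat_sum hl hξ hp

section

variable {l ξ : ℕ} (hl : l = 1 ∨ l = 2) (hξ : ξ = 1 ∨ ξ = 2) {κ : ℝ} {z : ℂ}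
  (h0 : 0 < z.arg) (h1 : z.arg < π / 3) (hp : denom l ξ κ z ≠ 0)

theorem kernelData_h (k : Fin 3) : (kernelData hl hξ h0 h1 hp).h k = solH l ξ κ z k :=
  funext fun r => (solH_eq l ξ κ z k r).symm

theorem kernelData_g (k : Fin 3) : (kernelData hl hξ h0 h1 hp).g k = solG l z k := rfl

theorem satisfiesBC_kernelData_h (k : Fin 3) :
    SatisfiesBC l ξ κ ((kernelData hl hξ h0 h1 hp).h k) := by
  rw [kernelData_h]
  exact satisfiesBC_solH hl hξ hp k

theorem injective_kernelData : (kernelData hl hξ h0 h1 hp).Injective ξ κ := fun y hy =>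
  eq_zero_of_momentRel hl hξ (ne_zero_of_arg_pos h0) hp ((satisfiesBC_lin_iff hl hξ κ y (expo z)).1 hy)

theorem kernelR_eq_ker (r s : ℝ) :
    kernelR l ξ κ z r s = (kernelData hl hξ h0 h1 hp).ker 0 r s := by
  simp only [KernelData.ker, kernelData_h, kernelData_g, iteratedDeriv_zero]
  have hc : ∀ k : Fin 3, phase (2 * (k : ℕ) / 3) / (3 * z ^ 4 * wron l z k) =
      (kernelData hl hξ h0 h1 hp).cc k := fun _ => rfl
  simp only [kernelR, hc, heav]
  rcases lt_trichotomy s r with h | h | h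
  · rw [if_pos h, if_neg (by linarith), if_neg (by linarith), if_pos (by linarith)]
    exact Finset.sum_congr rfl fun k _ => by ring
  -- On the diagonal θ(0) = 1/2 averages two equal products, which matches the convention in `ker`.
  · rw [h]
    simp only [sub_self, lt_irrefl, if_true, if_false]
    exact Finset.sum_congr rfl fun k _ => by ring
  · rw [if_neg h.not_gt, if_pos (by linarith), if_neg (by linarith), if_neg (by linarith)]
    exact Finset.sum_congr rfl fun k _ => by ring

end

theorem kernelR_symm (l ξ : ℕ) (κ : ℝ) (z : ℂ) (r s : ℝ) :
    kernelR l ξ κ z r s = kernelR l ξ κ z s r :=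
  Finset.sum_congr rfl fun k _ => by ring

theorem satisfiesBC_sum {l ξ : ℕ} {κ : ℝ} {ι : Type*} (s : Finset ι) {u : ι → ℝ → ℂ}
    (h : ∀ i ∈ s, SatisfiesBC l ξ κ (u i)) (hc : ∀ i ∈ s, ContDiffOn ℝ 5 (u i) (Ioi 0)) :
    SatisfiesBC l ξ κ fun x => ∑ i ∈ s, u i x := by
  classical
  induction s using Finset.induction_on with
  | empty => simpa using (InDomain.zero l ξ κ).bc
  | insert i s hi ih =>
    simp only [Finset.sum_insert hi]
    exact satisfiesBC_add (h i (Finset.mem_insert_self i s))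
      (ih (fun j hj => h j (Finset.mem_insert_of_mem hj))
        fun j hj => hc j (Finset.mem_insert_of_mem hj)) (hc i (Finset.mem_insert_self i s))
      (ContDiffOn.sum fun j hj => hc j (Finset.mem_insert_of_mem hj))

/-- The boundary conditions see only r near 0, and for r < s the kernel is a linear combination of
the h_k. -/
theorem KernelData.satisfiesBC_ker {l ξ : ℕ} {κ : ℝ} (D : KernelData l)
    (hbc : ∀ k, SatisfiesBC l ξ κ (D.h k)) {s : ℝ} (hs : 0 < s) :
    SatisfiesBC l ξ κ fun r => D.ker 0 r s := by
  have hsum : SatisfiesBC l ξ κ fun r => ∑ k, D.cc k * D.g k s * D.h k r :=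
    satisfiesBC_sum _ (fun k _ => satisfiesBC_const_mul _ (hbc k)) fun k _ =>
      contDiffOn_const.mul fun r hr =>
        (D.contDiffAt_h k (mem_Ioi.1 hr) (n := 5)).contDiffWithinAt
  refine satisfiesBC_congr hsum ?_
  filter_upwards [mem_nhdsWithin_of_mem_nhds (Iio_mem_nhds hs)] with r hr
  rw [KernelData.ker, if_neg (not_lt.2 (mem_Iio.1 hr).le)]
  simp only [iteratedDeriv_zero]
  exact Finset.sum_congr rfl fun k _ => by ring

theorem KernelData.ker_exponential_decay {l : ℕ} (D : KernelData l) :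
    ∃ ε : ℝ, 0 < ε ∧ ∀ s : ℝ, 0 < s → ∃ C : ℝ, ∀ r : ℝ, 0 < r →
      ‖D.ker 0 r s‖ ≤ C * Real.exp (-ε * r) := by
  obtain ⟨ε, hε0, hε⟩ := D.exists_eps
  obtain ⟨C, hC0, hC⟩ := D.ker_bound hε0 hε (Nat.zero_le 6)
  -- From |r - s| ≥ r - s one gets C_s = C e^{εs}, with ε independent of s.
  refine ⟨ε, hε0, fun s hs => ⟨C * Real.exp (ε * s), fun r hr => (hC r s hr hs).trans ?_⟩⟩
  rw [if_neg (by norm_num), add_zero, mul_assoc, ← Real.exp_add]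
  refine mul_le_mul_of_nonneg_left (Real.exp_le_exp.2 ?_) hC0
  nlinarith [le_abs_self (r - s)]

theorem KernelData.radT3_h {l : ℕ} (D : KernelData l) (k : Fin 3) {r : ℝ} (hr : 0 < r) :
    radT3 l (D.h k) r = D.E * D.h k r := by
  have e : D.h k = fun x => D.d k x + (D.mu k 0 * D.g 0 x + (D.mu k 1 * D.g 1 x +
      D.mu k 2 * D.g 2 x)) := by
    funext x
    rw [h, Fin.sum_univ_three]
    ring
  have hadd : ∀ {u v : ℝ → ℂ}, ContDiffAt ℝ 6 u r → ContDiffAt ℝ 6 v r →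
      radT3 l (fun x => u x + v x) r = radT3 l u r + radT3 l v r := fun hu hv =>
    radT3_add hr (ContDiffAt.regAt (n := 6) (by norm_num) hu)
      (ContDiffAt.regAt (n := 6) (by norm_num) hv)
  have cg : ∀ j, ContDiffAt ℝ 6 (fun x => D.mu k j * D.g j x) r := fun j =>
    contDiffAt_const.mul (D.contDiffAt_g j hr (n := 6))
  rw [e, hadd (D.contDiffAt_d k hr (n := 6)) ((cg 0).add ((cg 1).add (cg 2))),
    hadd (cg 0) ((cg 1).add (cg 2)), hadd (cg 1) (cg 2)]
  simp only [radT3_smul, d, g, radT3_psi D.hl _ hr, ← D.pow_six 0]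
  have p1 := (D.pow_six 1).trans (D.pow_six 0).symm
  have p2 := (D.pow_six 2).trans (D.pow_six 0).symm
  have pk := (D.pow_six k).trans (D.pow_six 0).symm
  linear_combination psi l (-D.a k) r * pk + D.mu k 1 * psi l (D.a 1) r * p1 +
    D.mu k 2 * psi l (D.a 2) r * p2

end RadialCube

end

theorem mainTheorem3 (l ξ : ℕ) (hl : l = 1 ∨ l = 2) (hξ : ξ = 1 ∨ ξ = 2) (κ : ℝ) (z : ℂ)
    (hz0 : 0 < z.arg) (hz1 : z.arg < π / 3) (hp : RadialCube.denom l ξ κ z ≠ 0) :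
    -- `g_k` and `h_k` solve the homogeneous equation
    (∀ k : Fin 3, ∀ r : ℝ, 0 < r →
      RadialCube.radT3 l (RadialCube.solG l z k) r - z ^ 6 * RadialCube.solG l z k r = 0 ∧
      RadialCube.radT3 l (RadialCube.solH l ξ κ z k) r
        - z ^ 6 * RadialCube.solH l ξ κ z k r = 0) ∧
    -- `g_k` decays exponentially at infinity
    (∃ ε : ℝ, 0 < ε ∧ ∃ C : ℝ, ∀ k : Fin 3, ∀ r : ℝ, 1 ≤ r →
      ‖RadialCube.solG l z k r‖ ≤ C * Real.exp (-ε * r)) ∧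
    -- the boundary conditions determine the coefficients, which have the stated values
    (∀ (k : Fin 3) (a b c : ℂ),
      RadialCube.SatisfiesBC l ξ κ (RadialCube.combo l z k a b c) ↔
        a = RadialCube.coefA l ξ κ z k ∧ b = RadialCube.coefB l ξ κ z k ∧
          c = RadialCube.coefC l ξ κ z k) ∧
    -- `W_k` is the Wronskian of `d_k` and `g_k`
    (∀ k : Fin 3, ∀ r : ℝ, 0 < r →
      deriv (RadialCube.solD l z k) r * RadialCube.solG l z k r
        - RadialCube.solD l z k r * deriv (RadialCube.solG l z k) r = RadialCube.wron l z k) ∧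
    -- the kernel is symmetric
    (∀ r s : ℝ, 0 < r → 0 < s →
      RadialCube.kernelR l ξ κ z r s = RadialCube.kernelR l ξ κ z s r) ∧
    -- it obeys the boundary conditions
    (∀ s : ℝ, 0 < s → RadialCube.SatisfiesBC l ξ κ (fun r => RadialCube.kernelR l ξ κ z r s)) ∧
    -- it vanishes exponentially at infinity
    (∃ ε : ℝ, 0 < ε ∧ ∀ s : ℝ, 0 < s → ∃ C : ℝ, ∀ r : ℝ, 0 < r →
      ‖RadialCube.kernelR l ξ κ z r s‖ ≤ C * Real.exp (-ε * r)) ∧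
    -- `(T_l³ - z⁶) R(·, s; z) = δ(· - s)` in the sense of distributions on `(0, ∞)`
    (∀ s : ℝ, 0 < s → ∀ φ : ℝ → ℂ, ContDiff ℝ ∞ φ → HasCompactSupport φ → tsupport φ ⊆ Ioi 0 →
      ∫ r in Ioi (0 : ℝ), RadialCube.kernelR l ξ κ z r s *
        (RadialCube.radT3 l φ r - z ^ 6 * φ r) = φ s) ∧
    -- it is the kernel of the resolvent `(T_{lξκ}³ - z⁶)⁻¹` in `L²(0, ∞)`
    RadialCube.IsResolventKernel (RadialCube.operator l ξ κ) (z ^ 6)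
      (RadialCube.kernelR l ξ κ z) := by
  set D := RadialCube.kernelData hl hξ hz0 hz1 hp
  have hz := RadialCube.ne_zero_of_arg_pos hz0
  have hbc := RadialCube.satisfiesBC_kernelData_h hl hξ hz0 hz1 hp
  have hinj := RadialCube.injective_kernelData hl hξ hz0 hz1 hp
  have hE : D.E = z ^ 6 := rfl
  have hR : RadialCube.kernelR l ξ κ z = D.ker 0 := by
    funext r s
    exact RadialCube.kernelR_eq_ker hl hξ hz0 hz1 hp r s
  refine ⟨fun k r hr => ⟨?_, ?_⟩, ?_, fun k a b c => RadialCube.satisfiesBC_combo_iff hl hξ hz hp k a b c,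
    fun k r hr => ?_, fun r s _ _ => RadialCube.kernelR_symm l ξ κ z r s, fun s hs => ?_, ?_,
    fun s hs φ h1 h2 h3 => ?_, ?_⟩
  · rw [RadialCube.solG_eq, RadialCube.radT3_psi hl _ hr, RadialCube.neg_expo_pow_six, sub_self]
  · have := D.radT3_h k hr
    rw [RadialCube.kernelData_h] at this
    rw [this]
    exact sub_self _
  · obtain ⟨ε, hε0, hε⟩ := D.exists_eps
    choose C hC0 hC using D.exists_bound_g 0
    refine ⟨ε, hε0, ∑ k, C k, fun k r hr => (hC k r hr).trans (mul_le_mul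
      (Finset.single_le_sum (fun i _ => hC0 i) (Finset.mem_univ k)) (Real.exp_le_exp.2
        (mul_le_mul_of_nonneg_right (hε k) (by linarith))) (Real.exp_nonneg _)
      (Finset.sum_nonneg fun i _ => hC0 i))⟩
  · rw [RadialCube.wron_eq hl, RadialCube.solG_eq, RadialCube.solD_eq]
    exact RadialCube.wronskian_psi hl _ hr
  · rw [hR]
    exact D.satisfiesBC_ker hbc hs
  · rw [hR]
    exact D.ker_exponential_decay
  · have h := RadialCube.KernelData.integral_ker_mul_testFn hinj hbc ⟨h1, h2, h3⟩ hs
    rw [hE] at h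
    refine Eq.trans (integral_congr_ae (ae_of_all _ fun r => ?_)) h
    -- The reproducing formula integrates over the second argument of the kernel; symmetry moves s
    -- to the second place.
    have e : RadialCube.kernelR l ξ κ z r s = D.ker 0 s r := by
      rw [RadialCube.kernelR_symm, hR]
    beta_reduce
    rw [e]
  · have h := RadialCube.KernelData.isResolventKernel (D := D) hinj hbc
    rwa [hE, ← hR] at h
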